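/- Let $\Bbbk$ be a field of arbitrary characteristic and $Q$ a finite connected quiver with vertex set $Q_0$ and arrow set $Q_1$. Let $\widetilde Q$ be the double quiver of $Q$, obtained by adding a reversed arrow $\alpha^*$ for each $\alpha\in Q_1$, and let $\overline Q$ be obtained from $\widetilde Q$ by adding a loop $t_i$ at each vertex $i\in Q_0$. The $2$-Ginzburg dg algebra $B=\Pi_2(Q)$ is the path algebra $\Bbbk\overline Q$, bigraded by giving each arrow of $\widetilde Q$ bidegree $(0,1)$ and each loop $t_i$ bidegree $(-1,2)$ (the first degree is the cohomological one, the second is the Adams degree), with the differential $d$ of bidegree $(1,0)$ determined by the graded Leibniz rule, $d(e_i)=0$, $d(\alpha)=d(\alpha^*)=0$ for $\alpha\in Q_1$, and $d(t_i)=e_i\big(\sum_{\alpha\in Q_1}[\alpha,\alpha^*]\big)e_i$ for $i\in Q_0$. Let $\Lambda_Q=\Bbbk\widetilde Q/\big(\sum_{\alpha\in Q_1}[\alpha,\alpha^*]\big)$ be the preprojective algebra of $Q$, graded by path length, and let $[\Lambda_Q,\Lambda_Q]$ be the subspace spanned by all commutators $xy-yx$ with $x,y\in\Lambda_Q$. For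 a differential bigraded algebra $A$, let $\mathrm{HH}^{p,q}(A,A)$ denote the $p$-th cohomology of the Hochschild cochain complex $C^{\bullet,q}(A,A)$, where $C^{p,q}(A,A)=\prod_{n\ge 0}\mathrm{Hom}^{p-n,q}(A^{\otimes n},A)$, tensor powers are taken over $\Bbbk$, and $\mathrm{Hom}^{i,j}$ denotes the $\Bbbk$-linear maps of bidegree $(i,j)$. Then for every $q\in\mathbb Z$ there is an isomorphism of $\Bbbk$-vector spaces $$\mathrm{HH}^{2,q}(B,B)\;\simeq\;\big(\Lambda_Q/[\Lambda_Q,\Lambda_Q]\big)^{q+2},$$ where the right-hand side is the component of degree $q+2$ (which is zero if $q+2<0$). -/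

import Mathlib

/-! ### Differential bigraded algebras and their bigraded Hochschild cohomology -/

/-- A differential bigraded structure on a `𝕜`-algebra `A`. The first grading is the cohomological
one, the second one is the Adams grading. The multiplication has bidegree `(0, 0)`, the differential
has bidegree `(1, 0)`, squares to zero, and satisfies the graded Leibniz rule with respect to the
cohomological grading. -/
structure DiffBigradedAlgebra (𝕜 : Type*) [Field 𝕜] (A : Type*) [Ring A] [Algebra 𝕜 A] where
  /-- the component of a given bidegree -/
  gr : ℤ × ℤ → Submodule 𝕜 A
  graded : GradedAlgebra gr
  /-- the differential -/
  d : A →ₗ[𝕜] A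
  d_mem : ∀ (p q : ℤ) (a : A), a ∈ gr (p, q) → d a ∈ gr (p + 1, q)
  d_d : ∀ a : A, d (d a) = 0
  leibniz : ∀ (p q : ℤ) (a b : A), a ∈ gr (p, q) →
    d (a * b) = d a * b + (-1 : 𝕜) ^ p • (a * d b)

/-- Collections `(fₙ)ₙ` of `n`-multilinear maps, i.e. elements of `∏ₙ Hom(A^{⊗ n}, A)`, where the
tensor powers are taken over the ground field. -/
def HochschildFamily (𝕜 : Type*) [Field 𝕜] (A : Type*) [Ring A] [Algebra 𝕜 A] : Type _ :=
  ∀ n : ℕ, MultilinearMap 𝕜 (fun _ : Fin n => A) A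

namespace HochschildFamily

variable {𝕜 : Type*} [Field 𝕜] {A : Type*} [Ring A] [Algebra 𝕜 A]

instance : AddCommGroup (HochschildFamily 𝕜 A) :=
  inferInstanceAs (AddCommGroup (∀ n : ℕ, MultilinearMap 𝕜 (fun _ : Fin n => A) A))

instance : Module 𝕜 (HochschildFamily 𝕜 A) :=
  inferInstanceAs (Module 𝕜 (∀ n : ℕ, MultilinearMap 𝕜 (fun _ : Fin n => A) A))

@[simp] theorem zero_apply (n : ℕ) : (0 : HochschildFamily 𝕜 A) n = 0 := rfl

@[simp] theorem add_apply (f g : HochschildFamily 𝕜 A) (n : ℕ) : (f + g) n = f n + g n := rfl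

@[simp] theorem smul_apply (c : 𝕜) (f : HochschildFamily 𝕜 A) (n : ℕ) : (c • f) n = c • f n := rfl

end HochschildFamily

namespace DiffBigradedAlgebra

attribute [instance] DiffBigradedAlgebra.graded

variable {𝕜 : Type*} [Field 𝕜] {A : Type*} [Ring A] [Algebra 𝕜 A]

/-- The linear map given by multiplication by the Koszul sign `(-1)^{m (i - 1)}` on elements of
cohomological degree `i`; here `i - 1` is the degree of the corresponding element of the shift. -/
noncomputable def twist (S : DiffBigradedAlgebra 𝕜 A) (m : ℤ) : A →ₗ[𝕜] A :=
  (DirectSum.toModule 𝕜 (ℤ × ℤ) A fun i => (-1 : 𝕜) ^ (m * (i.1 - 1)) • (S.gr i).subtype) ∘ₗ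
    (DirectSum.decomposeLinearEquiv S.gr).toLinearMap

theorem twist_apply (S : DiffBigradedAlgebra 𝕜 A) (m : ℤ) (i : ℤ × ℤ) (a : A) (ha : a ∈ S.gr i) :
    S.twist m a = (-1 : 𝕜) ^ (m * (i.1 - 1)) • a := by
  lift a to S.gr i using ha
  simp only [twist, LinearMap.comp_apply, LinearEquiv.coe_coe,
    DirectSum.decomposeLinearEquiv_apply, DirectSum.decompose_coe]
  exact DirectSum.toModule_lof 𝕜 (M := fun i => S.gr i)
    (φ := fun i => (-1 : 𝕜) ^ (m * (i.1 - 1)) • (S.gr i).subtype) i a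

/-- `(a₀, …, aₙ) ↦ ± a₀ g(a₁, …, aₙ)`, with the sign `(-1)^{m (|a₀| - 1)}`. -/
noncomputable def leftMul (S : DiffBigradedAlgebra 𝕜 A) (m : ℤ) {n : ℕ}
    (g : MultilinearMap 𝕜 (fun _ : Fin n => A) A) :
    MultilinearMap 𝕜 (fun _ : Fin (n + 1) => A) A :=
  LinearMap.uncurryLeft
    { toFun := fun a => (LinearMap.mulLeft 𝕜 (S.twist m a)).compMultilinearMap g
      map_add' := fun a b => by ext v; simp [add_mul]
      map_smul' := fun c a => by ext v; simp }

theorem leftMul_apply (S : DiffBigradedAlgebra 𝕜 A) (m : ℤ) {n : ℕ}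
    (g : MultilinearMap 𝕜 (fun _ : Fin n => A) A) (a : Fin (n + 1) → A) :
    S.leftMul m g a = S.twist m (a 0) * g (fun j => a j.succ) := rfl

/-- `(a₀, …, aₙ) ↦ ± g(a₀, …, aₙ₋₁) aₙ`, with the sign `∏_{j < n} (-1)^{|aⱼ| - 1}`. -/
noncomputable def rightMul (S : DiffBigradedAlgebra 𝕜 A) {n : ℕ}
    (g : MultilinearMap 𝕜 (fun _ : Fin n => A) A) :
    MultilinearMap 𝕜 (fun _ : Fin (n + 1) => A) A :=
  MultilinearMap.uncurryRight
    ((LinearMap.mul 𝕜 A).compMultilinearMap (g.compLinearMap fun _ => S.twist 1))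

theorem rightMul_apply (S : DiffBigradedAlgebra 𝕜 A) {n : ℕ}
    (g : MultilinearMap 𝕜 (fun _ : Fin n => A) A) (a : Fin (n + 1) → A) :
    S.rightMul g a = g (fun j => S.twist 1 (a j.castSucc)) * a (Fin.last n) := rfl

/-- The tuple `(±a₀, …, ±aᵢ₋₁, ±aᵢ aᵢ₊₁, aᵢ₊₂, …, aₙ)`, where each sign is `(-1)^{|aⱼ| - 1}`. -/
noncomputable def contractArg (S : DiffBigradedAlgebra 𝕜 A) {n : ℕ} (i : Fin n)
    (a : Fin (n + 1) → A) (j : Fin n) : A :=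
  if j < i then S.twist 1 (a j.castSucc)
  else if j = i then S.twist 1 (a j.castSucc) * a j.succ
  else a j.succ

theorem contractArg_update (S : DiffBigradedAlgebra 𝕜 A) {n : ℕ} (i : Fin n)
    (a : Fin (n + 1) → A) (k : Fin (n + 1)) :
    ∃ (j : Fin n) (L : A →ₗ[𝕜] A), ∀ x : A,
      S.contractArg i (Function.update a k x) = Function.update (S.contractArg i a) j (L x) := by
  rcases lt_trichotomy k i.castSucc with h | h | h
  · refine ⟨⟨k, by have := i.2; simp [Fin.lt_def] at h; omega⟩, S.twist 1, fun x => ?_⟩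
    funext j
    simp only [contractArg, Function.update_apply, Fin.ext_iff, Fin.lt_def, Fin.val_succ,
      Fin.val_castSucc] at h ⊢
    split_ifs <;> first | rfl | omega
  · refine ⟨i, LinearMap.mulRight 𝕜 (a i.succ) ∘ₗ S.twist 1, fun x => ?_⟩
    funext j
    simp only [contractArg, Function.update_apply, Fin.ext_iff, Fin.lt_def, Fin.val_succ,
      Fin.val_castSucc] at h ⊢
    split_ifs <;> first | rfl | omega | (obtain rfl : j = i := Fin.ext (by omega); rfl)
  · by_cases h' : k = i.succ
    · refine ⟨i, LinearMap.mulLeft 𝕜 (S.twist 1 (a i.castSucc)), fun x => ?_⟩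
      subst h'
      funext j
      simp only [contractArg, Function.update_apply, Fin.ext_iff, Fin.lt_def, Fin.val_succ,
        Fin.val_castSucc] at h ⊢
      split_ifs <;> first | rfl | omega | (obtain rfl : j = i := Fin.ext (by omega); rfl)
    · refine ⟨⟨k - 1, by have := k.2; simp [Fin.lt_def] at h; omega⟩, LinearMap.id, fun x => ?_⟩
      funext j
      simp only [contractArg, Function.update_apply, Fin.ext_iff, Fin.lt_def, Fin.val_succ,
        Fin.val_castSucc] at h h' ⊢
      split_ifs <;> first | rfl | omega

/-- `(a₀, …, aₙ) ↦ ± g(a₀, …, aᵢ₋₁, aᵢ aᵢ₊₁, aᵢ₊₂, …, aₙ)`, with the sign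
`∏_{j ≤ i} (-1)^{|aⱼ| - 1}`. -/
noncomputable def contract (S : DiffBigradedAlgebra 𝕜 A) {n : ℕ} (i : Fin n)
    (g : MultilinearMap 𝕜 (fun _ : Fin n => A) A) :
    MultilinearMap 𝕜 (fun _ : Fin (n + 1) => A) A :=
  MultilinearMap.mk' (fun a => g (S.contractArg i a))
    (fun a k x y => by
      obtain ⟨j, L, h⟩ := S.contractArg_update i a k
      simp only [h, map_add, MultilinearMap.map_update_add])
    (fun a k c x => by
      obtain ⟨j, L, h⟩ := S.contractArg_update i a k
      simp only [h, map_smul, MultilinearMap.map_update_smul])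

/-- `(a₀, …, aₙ₋₁) ↦ ± g(a₀, …, aᵢ₋₁, d aᵢ, aᵢ₊₁, …, aₙ₋₁)`, with the sign
`∏_{j < i} (-1)^{|aⱼ| - 1}`. -/
noncomputable def innerD (S : DiffBigradedAlgebra 𝕜 A) {n : ℕ} (i : Fin n)
    (g : MultilinearMap 𝕜 (fun _ : Fin n => A) A) : MultilinearMap 𝕜 (fun _ : Fin n => A) A :=
  g.compLinearMap fun j => if j < i then S.twist 1 else if j = i then S.d else LinearMap.id

/-- The part of the Hochschild differential that multiplies by, or multiplies together, arguments. -/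
noncomputable def outerD (S : DiffBigradedAlgebra 𝕜 A) (p : ℤ) (f : HochschildFamily 𝕜 A) :
    HochschildFamily 𝕜 A
  | 0 => 0
  | n + 1 => S.leftMul p (f n) + (-1 : 𝕜) ^ p • ∑ i : Fin n, S.contract i (f n) -
      (-1 : 𝕜) ^ p • S.rightMul (f n)

/-- The Hochschild differential `D` on cochains of cohomological degree `p`, with Koszul signs.
For homogeneous arguments and `εᵢ = ∑_{j < i} (|aⱼ| - 1)` it is
`(D f)(a₀, …, aₙ₋₁) = d (f (a₀, …, aₙ₋₁))`
`  + (-1)^p ∑_{i < n} (-1)^{εᵢ} f (…, d aᵢ, …)`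
`  + (-1)^{p (|a₀| - 1)} a₀ f (a₁, …, aₙ₋₁)`
`  + (-1)^p ∑_{i < n - 1} (-1)^{εᵢ₊₁} f (…, aᵢ aᵢ₊₁, …)`
`  - (-1)^p (-1)^{εₙ₋₁} f (a₀, …, aₙ₋₂) aₙ₋₁`. -/
noncomputable def hochschildD (S : DiffBigradedAlgebra 𝕜 A) (p : ℤ) (f : HochschildFamily 𝕜 A) :
    HochschildFamily 𝕜 A := fun n =>
  S.d.compMultilinearMap (f n) + (-1 : 𝕜) ^ p • (∑ i : Fin n, S.innerD i (f n)) + S.outerD p f n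

/-- The Hochschild differential as a linear map. -/
noncomputable def hochschildDiff (S : DiffBigradedAlgebra 𝕜 A) (p : ℤ) :
    HochschildFamily 𝕜 A →ₗ[𝕜] HochschildFamily 𝕜 A where
  toFun := S.hochschildD p
  map_add' f g := by
    funext n
    ext a
    cases n with
    | zero => simp [hochschildD, outerD]
    | succ n =>
      simp [hochschildD, outerD, leftMul_apply, rightMul_apply, contract, innerD, mul_add, add_mul,
        Finset.sum_add_distrib]
      abel
  map_smul' c f := by
    funext n
    ext a
    cases n with
    | zero => simp [hochschildD, outerD]
    | succ n =>
      simp [hochschildD, outerD, leftMul_apply, rightMul_apply, contract, innerD, smul_add,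
        smul_sub, Finset.smul_sum, smul_comm c]

/-- The bigraded Hochschild cochains `C^{p,q}(A, A) = ∏ₙ Hom^{p-n,q}(A^{⊗ n}, A)`: the families
`(fₙ)ₙ` such that `fₙ` maps homogeneous elements of total bidegree `(i, j)` to elements of bidegree
`(i + p - n, j + q)`. -/
def cochains (S : DiffBigradedAlgebra 𝕜 A) (p q : ℤ) : Submodule 𝕜 (HochschildFamily 𝕜 A) where
  carrier := {f | ∀ (n : ℕ) (e : Fin n → ℤ × ℤ) (a : Fin n → A), (∀ k, a k ∈ S.gr (e k)) →
    f n a ∈ S.gr ((∑ k, e k) + (p - n, q))}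
  add_mem' hf hg n e a ha := add_mem (hf n e a ha) (hg n e a ha)
  zero_mem' _ _ _ _ := zero_mem _
  smul_mem' c _ hf n e a ha := Submodule.smul_mem _ c (hf n e a ha)

/-- Hochschild cocycles of bidegree `(p, q)`. -/
noncomputable def cocycles (S : DiffBigradedAlgebra 𝕜 A) (p q : ℤ) :
    Submodule 𝕜 (HochschildFamily 𝕜 A) :=
  S.cochains p q ⊓ LinearMap.ker (S.hochschildDiff p)

/-- Hochschild coboundaries of bidegree `(p, q)`. -/
noncomputable def coboundaries (S : DiffBigradedAlgebra 𝕜 A) (p q : ℤ) :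
    Submodule 𝕜 (HochschildFamily 𝕜 A) :=
  (S.cochains (p - 1) q).map (S.hochschildDiff (p - 1))

/-- The bigraded Hochschild cohomology `HH^{p,q}(A, A)`, i.e. the `p`-th cohomology of the complex
`C^{•,q}(A, A)`. -/
abbrev HH (S : DiffBigradedAlgebra 𝕜 A) (p q : ℤ) :=
  S.cocycles p q ⧸ (S.coboundaries p q).submoduleOf (S.cocycles p q)

end DiffBigradedAlgebra

/-! ### Path algebras -/

/-- The path algebra of a quiver: the vector space with basis the paths (including the paths of
length zero), with multiplication given by concatenation of paths from left to right. -/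
def PathAlgebra (𝕜 : Type*) [Field 𝕜] (V : Type*) [Quiver V] : Type _ :=
  (Σ i : V, Σ j : V, Quiver.Path i j) →₀ 𝕜

namespace PathAlgebra

variable (𝕜 : Type*) [Field 𝕜] {V : Type*} [Quiver V]

noncomputable instance : AddCommGroup (PathAlgebra 𝕜 V) :=
  inferInstanceAs (AddCommGroup ((Σ i : V, Σ j : V, Quiver.Path i j) →₀ 𝕜))

noncomputable instance : Module 𝕜 (PathAlgebra 𝕜 V) :=
  inferInstanceAs (Module 𝕜 ((Σ i : V, Σ j : V, Quiver.Path i j) →₀ 𝕜))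

/-- The basis of paths. -/
noncomputable def basis : Module.Basis (Σ i : V, Σ j : V, Quiver.Path i j) 𝕜 (PathAlgebra 𝕜 V) :=
  Module.Basis.ofRepr (LinearEquiv.refl 𝕜 ((Σ i : V, Σ j : V, Quiver.Path i j) →₀ 𝕜))

/-- A path, as an element of the path algebra. -/
noncomputable def ofPath {i j : V} (p : Quiver.Path i j) : PathAlgebra 𝕜 V := basis 𝕜 ⟨i, j, p⟩

/-- An arrow, as an element of the path algebra. -/
noncomputable def ofArrow {i j : V} (a : i ⟶ j) : PathAlgebra 𝕜 V := ofPath 𝕜 a.toPath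

/-- The idempotent at a vertex. -/
noncomputable def idem (i : V) : PathAlgebra 𝕜 V := ofPath 𝕜 (Quiver.Path.nil : Quiver.Path i i)

open Classical in
/-- The product of two paths: their concatenation if they are composable, and zero otherwise. -/
noncomputable def pathMul (x y : Σ i : V, Σ j : V, Quiver.Path i j) : PathAlgebra 𝕜 V :=
  if h : x.2.1 = y.1 then ofPath 𝕜 (x.2.2.comp (y.2.2.cast h.symm rfl)) else 0

/-- The multiplication of the path algebra. -/
noncomputable def mulBilin : PathAlgebra 𝕜 V →ₗ[𝕜] PathAlgebra 𝕜 V →ₗ[𝕜] PathAlgebra 𝕜 V :=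
  (basis 𝕜).constr 𝕜 fun x => (basis 𝕜).constr 𝕜 fun y => pathMul 𝕜 x y

noncomputable instance : Mul (PathAlgebra 𝕜 V) := ⟨fun x y => mulBilin 𝕜 x y⟩

theorem mul_def (x y : PathAlgebra 𝕜 V) : x * y = mulBilin 𝕜 x y := rfl

theorem ofPath_mul_ofPath {i j k : V} (p : Quiver.Path i j) (q : Quiver.Path j k) :
    ofPath 𝕜 p * ofPath 𝕜 q = ofPath 𝕜 (p.comp q) := by
  simp [mul_def, mulBilin, ofPath, pathMul]

theorem ofPath_mul_ofPath_of_ne {i j k l : V} (h : j ≠ k) (p : Quiver.Path i j)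
    (q : Quiver.Path k l) : ofPath 𝕜 p * ofPath 𝕜 q = 0 := by
  simp [mul_def, mulBilin, ofPath, pathMul, h]

theorem hom_ext {M : Type*} [AddCommGroup M] [Module 𝕜 M] {f g : PathAlgebra 𝕜 V →ₗ[𝕜] M}
    (h : ∀ (i j : V) (p : Quiver.Path i j), f (ofPath 𝕜 p) = g (ofPath 𝕜 p)) : f = g :=
  (basis 𝕜).ext fun x => h x.1 x.2.1 x.2.2

theorem induction {P : PathAlgebra 𝕜 V → Prop} (x : PathAlgebra 𝕜 V) (zero : P 0)
    (add : ∀ x y, P x → P y → P (x + y))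
    (smul : ∀ (c : 𝕜) (i j : V) (p : Quiver.Path i j), P (c • ofPath 𝕜 p)) : P x :=
  Finsupp.induction_linear (motive := P) x zero add fun y c => by
    have h : (Finsupp.single y c : PathAlgebra 𝕜 V) = c • ofPath 𝕜 y.2.2 := by
      change _ = c • (Finsupp.single _ (1 : 𝕜))
      exact (Finsupp.smul_single_one _ _).symm
    rw [h]
    exact smul c _ _ _

variable {𝕜}

theorem mul_add' (x y z : PathAlgebra 𝕜 V) : x * (y + z) = x * y + x * z :=
  map_add (mulBilin 𝕜 x) y z

theorem add_mul' (x y z : PathAlgebra 𝕜 V) : (x + y) * z = x * z + y * z :=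
  LinearMap.map_add₂ (mulBilin 𝕜) x y z

theorem mul_smul' (c : 𝕜) (x y : PathAlgebra 𝕜 V) : x * (c • y) = c • (x * y) :=
  map_smul (mulBilin 𝕜 x) c y

theorem smul_mul' (c : 𝕜) (x y : PathAlgebra 𝕜 V) : (c • x) * y = c • (x * y) :=
  LinearMap.map_smul₂ (mulBilin 𝕜) c x y

theorem mul_zero' (x : PathAlgebra 𝕜 V) : x * 0 = 0 := map_zero (mulBilin 𝕜 x)

theorem zero_mul' (x : PathAlgebra 𝕜 V) : 0 * x = 0 := LinearMap.map_zero₂ (mulBilin 𝕜) x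

theorem mul_assoc' (x y z : PathAlgebra 𝕜 V) : x * y * z = x * (y * z) := by
  refine induction 𝕜 (P := fun x => x * y * z = x * (y * z)) x (by simp only [zero_mul'])
    (fun a b ha hb => by simp only [add_mul', ha, hb]) fun c i j p => ?_
  refine induction 𝕜 (P := fun y => c • ofPath 𝕜 p * y * z = c • ofPath 𝕜 p * (y * z)) y
    (by simp only [zero_mul', mul_zero'])
    (fun a b ha hb => by simp only [add_mul', mul_add', ha, hb]) fun c' k l q => ?_
  refine induction 𝕜
    (P := fun z => c • ofPath 𝕜 p * c' • ofPath 𝕜 q * z = c • ofPath 𝕜 p * (c' • ofPath 𝕜 q * z)) z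
    (by simp only [mul_zero'])
    (fun a b ha hb => by simp only [mul_add', ha, hb]) fun c'' m n r => ?_
  simp only [smul_mul', mul_smul']
  by_cases h : j = k
  · subst h
    by_cases h' : l = m
    · subst h'
      simp only [ofPath_mul_ofPath, Quiver.Path.comp_assoc]
    · simp only [ofPath_mul_ofPath, ofPath_mul_ofPath_of_ne 𝕜 h', mul_zero']
  · by_cases h' : l = m
    · subst h'
      simp only [ofPath_mul_ofPath, ofPath_mul_ofPath_of_ne 𝕜 h, zero_mul']
    · simp only [ofPath_mul_ofPath_of_ne 𝕜 h, ofPath_mul_ofPath_of_ne 𝕜 h', zero_mul', mul_zero']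

theorem idem_mul_ofPath {i j : V} (p : Quiver.Path i j) : idem 𝕜 i * ofPath 𝕜 p = ofPath 𝕜 p := by
  simp [idem, ofPath_mul_ofPath]

theorem ofPath_mul_idem {i j : V} (p : Quiver.Path i j) : ofPath 𝕜 p * idem 𝕜 j = ofPath 𝕜 p := by
  simp [idem, ofPath_mul_ofPath]

section unit

variable [Fintype V]

/-- The unit of the path algebra is the sum of the idempotents at the vertices. -/
noncomputable instance : One (PathAlgebra 𝕜 V) := ⟨∑ i : V, idem 𝕜 i⟩

theorem one_def : (1 : PathAlgebra 𝕜 V) = ∑ i : V, idem 𝕜 i := rfl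

theorem one_mul' (x : PathAlgebra 𝕜 V) : 1 * x = x := by
  refine induction 𝕜 (P := fun x => 1 * x = x) x (mul_zero' _) (fun a b ha hb => by simp only [mul_add', ha, hb])
    fun c i j p => ?_
  have h : (1 : PathAlgebra 𝕜 V) * ofPath 𝕜 p = ∑ k : V, idem 𝕜 k * ofPath 𝕜 p := by
    simp only [one_def, mul_def, map_sum, LinearMap.sum_apply]
  rw [mul_smul', h, Finset.sum_eq_single i, idem_mul_ofPath]
  · exact fun k _ hk => ofPath_mul_ofPath_of_ne 𝕜 hk _ _
  · exact fun hi => absurd (Finset.mem_univ i) hi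

theorem mul_one' (x : PathAlgebra 𝕜 V) : x * 1 = x := by
  refine induction 𝕜 (P := fun x => x * 1 = x) x (zero_mul' _) (fun a b ha hb => by simp only [add_mul', ha, hb])
    fun c i j p => ?_
  have h : ofPath 𝕜 p * (1 : PathAlgebra 𝕜 V) = ∑ k : V, ofPath 𝕜 p * idem 𝕜 k := by
    simp only [one_def, mul_def, map_sum]
  rw [smul_mul', h, Finset.sum_eq_single j, ofPath_mul_idem]
  · exact fun k _ hk => ofPath_mul_ofPath_of_ne 𝕜 (Ne.symm hk) _ _
  · exact fun hi => absurd (Finset.mem_univ j) hi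

noncomputable instance : Ring (PathAlgebra 𝕜 V) where
  __ := (inferInstance : AddCommGroup (PathAlgebra 𝕜 V))
  zero_mul := zero_mul'
  mul_zero := mul_zero'
  left_distrib := mul_add'
  right_distrib := add_mul'
  mul_assoc := mul_assoc'
  one_mul := one_mul'
  mul_one := mul_one'

noncomputable instance : Algebra 𝕜 (PathAlgebra 𝕜 V) :=
  Algebra.ofModule (fun c x y => smul_mul' c x y) (fun c x y => mul_smul' c x y)

end unit

/-- The sum of the weights of the arrows of a path. -/
def pathWeight {ι : Type*} [AddMonoid ι] (w : ∀ i j : V, (i ⟶ j) → ι) {i : V} :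
    ∀ {j : V}, Quiver.Path i j → ι
  | _, .nil => 0
  | _, .cons p a => pathWeight w p + w _ _ a

theorem pathWeight_comp {ι : Type*} [AddMonoid ι] (w : ∀ i j : V, (i ⟶ j) → ι) {i j k : V}
    (p : Quiver.Path i j) (q : Quiver.Path j k) :
    pathWeight w (p.comp q) = pathWeight w p + pathWeight w q := by
  induction q with
  | nil => simp [pathWeight]
  | cons q a ih => simp [pathWeight, ih, add_assoc]

/-- The subspace of the path algebra spanned by the paths of weight `n`. -/
noncomputable def weightPart (𝕜 : Type*) [Field 𝕜] {ι : Type*} [AddMonoid ι] (w : ∀ i j : V, (i ⟶ j) → ι)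
    (n : ι) : Submodule 𝕜 (PathAlgebra 𝕜 V) :=
  Submodule.span 𝕜 {x | ∃ (i j : V) (p : Quiver.Path i j), pathWeight w p = n ∧ ofPath 𝕜 p = x}

theorem ofPath_mem {ι : Type*} [AddMonoid ι] (w : ∀ i j : V, (i ⟶ j) → ι) {i j : V}
    (p : Quiver.Path i j) : ofPath 𝕜 p ∈ weightPart 𝕜 w (pathWeight w p) :=
  Submodule.subset_span ⟨i, j, p, rfl, rfl⟩

theorem ofArrow_mem {ι : Type*} [AddMonoid ι] (w : ∀ i j : V, (i ⟶ j) → ι) {i j : V}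
    (a : i ⟶ j) : ofArrow 𝕜 a ∈ weightPart 𝕜 w (w i j a) :=
  Submodule.subset_span ⟨i, j, a.toPath, zero_add _, rfl⟩

theorem weightPart_mul_mem {ι : Type*} [AddMonoid ι] (w : ∀ i j : V, (i ⟶ j) → ι) (m n : ι)
    (x y : PathAlgebra 𝕜 V) (hx : x ∈ weightPart 𝕜 w m) (hy : y ∈ weightPart 𝕜 w n) :
    x * y ∈ weightPart 𝕜 w (m + n) := by
  induction hx using Submodule.span_induction with
  | zero => rw [zero_mul']; exact zero_mem _
  | add a b _ _ ha hb => rw [add_mul']; exact add_mem ha hb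
  | smul c a _ ha => rw [smul_mul']; exact Submodule.smul_mem _ _ ha
  | mem a ha =>
    obtain ⟨i, j, p, rfl, rfl⟩ := ha
    induction hy using Submodule.span_induction with
    | zero => rw [mul_zero']; exact zero_mem _
    | add a b _ _ ha hb => rw [mul_add']; exact add_mem ha hb
    | smul c a _ ha => rw [mul_smul']; exact Submodule.smul_mem _ _ ha
    | mem b hb =>
      obtain ⟨k, l, q, rfl, rfl⟩ := hb
      by_cases h : j = k
      · subst h
        rw [ofPath_mul_ofPath, ← pathWeight_comp]
        exact ofPath_mem w _
      · rw [ofPath_mul_ofPath_of_ne 𝕜 h]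
        exact zero_mem _

/-- The decomposition of an element of the path algebra into its parts of given weights. -/
noncomputable def weightDecompose (𝕜 : Type*) [Field 𝕜] {ι : Type*} [AddMonoid ι] [DecidableEq ι]
    (w : ∀ i j : V, (i ⟶ j) → ι) :
    PathAlgebra 𝕜 V →ₗ[𝕜] DirectSum ι fun n => weightPart 𝕜 w n :=
  (basis 𝕜).constr 𝕜 fun x =>
    DirectSum.lof 𝕜 ι (fun n => weightPart 𝕜 w n) (pathWeight w x.2.2)
      ⟨ofPath 𝕜 x.2.2, ofPath_mem w x.2.2⟩

theorem weightDecompose_ofPath {ι : Type*} [AddMonoid ι] [DecidableEq ι]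
    (w : ∀ i j : V, (i ⟶ j) → ι) {i j : V} (p : Quiver.Path i j) :
    weightDecompose 𝕜 w (ofPath 𝕜 p) =
      DirectSum.lof 𝕜 ι (fun n => weightPart 𝕜 w n) (pathWeight w p)
        ⟨ofPath 𝕜 p, ofPath_mem w p⟩ := by
  simp [weightDecompose, ofPath]

theorem weightDecompose_coe {ι : Type*} [AddMonoid ι] [DecidableEq ι]
    (w : ∀ i j : V, (i ⟶ j) → ι) (n : ι) (x : PathAlgebra 𝕜 V) (hx : x ∈ weightPart 𝕜 w n) :
    weightDecompose 𝕜 w x = DirectSum.lof 𝕜 ι (fun n => weightPart 𝕜 w n) n ⟨x, hx⟩ := by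
  induction hx using Submodule.span_induction with
  | zero => rw [map_zero]; exact (map_zero _).symm
  | add a b ha hb iha ihb => rw [map_add, iha, ihb, ← map_add]; rfl
  | smul c a ha iha => rw [map_smul, iha, ← map_smul]; rfl
  | mem a ha =>
    obtain ⟨i, j, p, rfl, rfl⟩ := ha
    exact weightDecompose_ofPath w p

/-- The algebra grading of the path algebra by the weight of paths. -/
@[reducible]
noncomputable def weightGrading (𝕜 : Type*) [Field 𝕜] [Fintype V] {ι : Type*} [AddMonoid ι]
    [DecidableEq ι] (w : ∀ i j : V, (i ⟶ j) → ι) : GradedAlgebra (weightPart 𝕜 w) where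
  one_mem := by
    rw [one_def]
    exact sum_mem fun i _ => ofPath_mem w (Quiver.Path.nil : Quiver.Path i i)
  mul_mem := fun {m n x y} hx hy => weightPart_mul_mem w m n x y hx hy
  toDecomposition := DirectSum.Decomposition.ofLinearMap (weightPart 𝕜 w) (weightDecompose 𝕜 w)
    (hom_ext 𝕜 fun i j p => by simp [weightDecompose_ofPath])
    (by
      ext n x : 2
      simp [weightDecompose_coe w n x.1 x.2])

/-- The value on a path of the derivation of the path algebra that vanishes on the idempotents at
the vertices and takes prescribed values `δ` on arrows. Its sign rule is determined by the first
component of the weight. -/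
noncomputable def pathDeriv (w : ∀ i j : V, (i ⟶ j) → ℤ × ℤ)
    (δ : ∀ i j : V, (i ⟶ j) → PathAlgebra 𝕜 V) {i : V} :
    ∀ {j : V}, Quiver.Path i j → PathAlgebra 𝕜 V
  | _, .nil => 0
  | _, .cons p a =>
    pathDeriv w δ p * ofArrow 𝕜 a + (-1 : 𝕜) ^ (pathWeight w p).1 • (ofPath 𝕜 p * δ _ _ a)

/-- The graded derivation of the path algebra that vanishes on the idempotents at the vertices and
takes prescribed values `δ` on arrows. -/
noncomputable def deriv (w : ∀ i j : V, (i ⟶ j) → ℤ × ℤ)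
    (δ : ∀ i j : V, (i ⟶ j) → PathAlgebra 𝕜 V) : PathAlgebra 𝕜 V →ₗ[𝕜] PathAlgebra 𝕜 V :=
  (basis 𝕜).constr 𝕜 fun x => pathDeriv w δ x.2.2

theorem deriv_ofPath (w : ∀ i j : V, (i ⟶ j) → ℤ × ℤ) (δ : ∀ i j : V, (i ⟶ j) → PathAlgebra 𝕜 V)
    {i j : V} (p : Quiver.Path i j) : deriv w δ (ofPath 𝕜 p) = pathDeriv w δ p := by
  simp [deriv, ofPath]

theorem idem_mul_pathDeriv (w : ∀ i j : V, (i ⟶ j) → ℤ × ℤ)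
    (δ : ∀ i j : V, (i ⟶ j) → PathAlgebra 𝕜 V) {i j : V} (p : Quiver.Path i j) :
    idem 𝕜 i * pathDeriv w δ p = pathDeriv w δ p := by
  induction p with
  | nil => exact mul_zero' _
  | cons p a ih =>
    simp only [pathDeriv, mul_add', mul_smul', ← mul_assoc', ih, idem_mul_ofPath]

theorem pathDeriv_mul_idem (w : ∀ i j : V, (i ⟶ j) → ℤ × ℤ)
    (δ : ∀ i j : V, (i ⟶ j) → PathAlgebra 𝕜 V) {i j : V} (p : Quiver.Path i j)
    (hr : ∀ (i j : V) (a : i ⟶ j), δ i j a * idem 𝕜 j = δ i j a) :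
    pathDeriv w δ p * idem 𝕜 j = pathDeriv w δ p := by
  cases p with
  | nil => exact zero_mul' _
  | cons p a =>
    simp only [pathDeriv, add_mul', smul_mul', mul_assoc', hr, ofArrow, ofPath_mul_idem]

theorem idem_mul_idem_of_ne {i j : V} (h : i ≠ j) :
    (idem 𝕜 i * idem 𝕜 j : PathAlgebra 𝕜 V) = 0 := ofPath_mul_ofPath_of_ne 𝕜 h _ _

theorem pathDeriv_comp (w : ∀ i j : V, (i ⟶ j) → ℤ × ℤ)
    (δ : ∀ i j : V, (i ⟶ j) → PathAlgebra 𝕜 V) {i j k : V} (p : Quiver.Path i j)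
    (q : Quiver.Path j k) (hr : ∀ (i j : V) (a : i ⟶ j), δ i j a * idem 𝕜 j = δ i j a) :
    pathDeriv w δ (p.comp q) = pathDeriv w δ p * ofPath 𝕜 q +
      (-1 : 𝕜) ^ (pathWeight w p).1 • (ofPath 𝕜 p * pathDeriv w δ q) := by
  induction q with
  | nil =>
    have h := pathDeriv_mul_idem w δ p hr
    simp only [idem] at h
    simp only [Quiver.Path.comp_nil, pathDeriv, h, mul_zero', smul_zero, add_zero]
  | cons q a ih =>
    have h : ofPath 𝕜 (q.cons a) = ofPath 𝕜 q * ofArrow 𝕜 a :=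
      (ofPath_mul_ofPath 𝕜 q a.toPath).symm
    simp only [Quiver.Path.comp_cons, pathDeriv, ih, h, pathWeight_comp, add_mul', mul_add',
      smul_mul', mul_smul', smul_add, Prod.fst_add, smul_smul, ← ofPath_mul_ofPath, mul_assoc',
      zpow_add₀ (neg_ne_zero.mpr (one_ne_zero (α := 𝕜))), add_assoc]

theorem idem_mul_idem (i : V) :
    (idem 𝕜 i * idem 𝕜 i : PathAlgebra 𝕜 V) = idem 𝕜 i := idem_mul_ofPath _

theorem idem_mem {ι : Type*} [AddMonoid ι] (w : ∀ i j : V, (i ⟶ j) → ι)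
    (i : V) : idem 𝕜 i ∈ weightPart 𝕜 w 0 :=
  ofPath_mem w (Quiver.Path.nil : Quiver.Path i i)

theorem deriv_idem (w : ∀ i j : V, (i ⟶ j) → ℤ × ℤ)
    (δ : ∀ i j : V, (i ⟶ j) → PathAlgebra 𝕜 V) (i : V) : deriv w δ (idem 𝕜 i) = 0 :=
  deriv_ofPath w δ _

theorem deriv_ofArrow (w : ∀ i j : V, (i ⟶ j) → ℤ × ℤ)
    (δ : ∀ i j : V, (i ⟶ j) → PathAlgebra 𝕜 V)
    (hl : ∀ (i j : V) (a : i ⟶ j), idem 𝕜 i * δ i j a = δ i j a) {i j : V} (a : i ⟶ j) :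
    deriv w δ (ofArrow 𝕜 a) = δ i j a := by
  rw [ofArrow, deriv_ofPath]
  simp only [Quiver.Hom.toPath, pathDeriv, pathWeight, zero_mul', zero_add, Prod.fst_zero,
    zpow_zero, one_smul]
  exact hl _ _ a

/-- The graded Leibniz rule. -/
theorem deriv_mul (w : ∀ i j : V, (i ⟶ j) → ℤ × ℤ)
    (δ : ∀ i j : V, (i ⟶ j) → PathAlgebra 𝕜 V)
    (hr : ∀ (i j : V) (a : i ⟶ j), δ i j a * idem 𝕜 j = δ i j a) (n : ℤ × ℤ)
    (x y : PathAlgebra 𝕜 V) (hx : x ∈ weightPart 𝕜 w n) :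
    deriv w δ (x * y) = deriv w δ x * y + (-1 : 𝕜) ^ n.1 • (x * deriv w δ y) := by
  induction hx using Submodule.span_induction with
  | zero => simp only [zero_mul', map_zero, smul_zero, add_zero]
  | add a b _ _ ha hb =>
    simp only [add_mul', map_add, ha, hb, smul_add]
    abel
  | smul c a _ ha => simp only [smul_mul', map_smul, ha, smul_add, smul_comm c]
  | mem a ha =>
    obtain ⟨i, j, p, rfl, rfl⟩ := ha
    refine induction 𝕜 (P := fun y => deriv w δ (ofPath 𝕜 p * y) = deriv w δ (ofPath 𝕜 p) * y +
      (-1 : 𝕜) ^ (pathWeight w p).1 • (ofPath 𝕜 p * deriv w δ y)) y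
      (by simp only [mul_zero', map_zero, smul_zero, add_zero]) (fun a b ha hb => ?_)
      fun c k l q => ?_
    · simp only [mul_add', map_add, ha, hb, smul_add]
      abel
    · simp only [mul_smul', map_smul, smul_comm _ c, ← smul_add, deriv_ofPath]
      congr 1
      by_cases h : j = k
      · subst h
        rw [ofPath_mul_ofPath, deriv_ofPath, pathDeriv_comp w δ p q hr]
      · rw [ofPath_mul_ofPath_of_ne 𝕜 h, map_zero, ← pathDeriv_mul_idem w δ p hr,
          ← idem_mul_pathDeriv w δ q, ← idem_mul_ofPath q, ← ofPath_mul_idem p,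
          mul_assoc', mul_assoc', ← mul_assoc' (idem 𝕜 j), ← mul_assoc' (idem 𝕜 j),
          idem_mul_idem_of_ne h]
        simp only [zero_mul', mul_zero', smul_zero, add_zero]

theorem deriv_mem (w : ∀ i j : V, (i ⟶ j) → ℤ × ℤ)
    (δ : ∀ i j : V, (i ⟶ j) → PathAlgebra 𝕜 V)
    (hδ : ∀ (i j : V) (a : i ⟶ j), δ i j a ∈ weightPart 𝕜 w (w i j a + (1, 0))) (n : ℤ × ℤ)
    (x : PathAlgebra 𝕜 V) (hx : x ∈ weightPart 𝕜 w n) :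
    deriv w δ x ∈ weightPart 𝕜 w (n + (1, 0)) := by
  induction hx using Submodule.span_induction with
  | zero => rw [map_zero]; exact zero_mem _
  | add a b _ _ ha hb => rw [map_add]; exact add_mem ha hb
  | smul c a _ ha => rw [map_smul]; exact Submodule.smul_mem _ _ ha
  | mem a ha =>
    obtain ⟨i, j, p, rfl, rfl⟩ := ha
    rw [deriv_ofPath]
    induction p with
    | nil => exact zero_mem _
    | cons p a ih =>
      refine add_mem ?_ (Submodule.smul_mem _ _ ?_)
      · have := weightPart_mul_mem w _ _ _ _ ih (ofArrow_mem w a)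
        rwa [add_right_comm] at this
      · have := weightPart_mul_mem w _ _ _ _ (ofPath_mem (𝕜 := 𝕜) w p) (hδ _ _ a)
        rwa [← add_assoc] at this

theorem deriv_deriv (w : ∀ i j : V, (i ⟶ j) → ℤ × ℤ)
    (δ : ∀ i j : V, (i ⟶ j) → PathAlgebra 𝕜 V)
    (hl : ∀ (i j : V) (a : i ⟶ j), idem 𝕜 i * δ i j a = δ i j a)
    (hr : ∀ (i j : V) (a : i ⟶ j), δ i j a * idem 𝕜 j = δ i j a)
    (hδ : ∀ (i j : V) (a : i ⟶ j), δ i j a ∈ weightPart 𝕜 w (w i j a + (1, 0)))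
    (hd : ∀ (i j : V) (a : i ⟶ j), deriv w δ (δ i j a) = 0) (x : PathAlgebra 𝕜 V) :
    deriv w δ (deriv w δ x) = 0 := by
  refine induction 𝕜 (P := fun x => deriv w δ (deriv w δ x) = 0) x (by simp only [map_zero])
    (fun a b ha hb => by simp only [map_add, ha, hb, add_zero]) fun c i j p => ?_
  rw [map_smul, map_smul]
  suffices h : deriv w δ (deriv w δ (ofPath 𝕜 p)) = 0 by rw [h, smul_zero]
  rw [deriv_ofPath]
  induction p with
  | nil => exact map_zero _
  | cons p a ih =>
    have h1 : pathDeriv w δ p ∈ weightPart 𝕜 w (pathWeight w p + (1, 0)) := by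
      rw [← deriv_ofPath]
      exact deriv_mem w δ hδ _ _ (ofPath_mem w p)
    have h2 : deriv w δ (ofArrow 𝕜 a) = δ _ _ a := deriv_ofArrow w δ hl a
    rw [pathDeriv, map_add, map_smul, deriv_mul w δ hr _ _ _ h1,
      deriv_mul w δ hr _ _ _ (ofPath_mem w p), ih, h2, hd, deriv_ofPath]
    simp only [zero_mul', mul_zero', smul_zero, add_zero, zero_add, Prod.fst_add,
      zpow_add₀ (neg_ne_zero.mpr (one_ne_zero (α := 𝕜))), zpow_one, mul_neg, mul_one, neg_smul,
      neg_add_cancel]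

end PathAlgebra

/-! ### The 2-Ginzburg dg algebra and the preprojective algebra -/

/-- A type synonym for the vertices of the quiver obtained from the double quiver of `V` by adding
a loop at each vertex. -/
def GinzburgQuiver (V : Type*) : Type _ := V

/-- The arrows of the double quiver of `V` with an additional loop at each vertex: the arrows `α`
of `V`, their reversals `α*`, and the loops `tᵢ`. -/
inductive GinzburgArrow {V : Type*} [Quiver V] : V → V → Type _
  | arrow {i j : V} (α : i ⟶ j) : GinzburgArrow i j
  | star {i j : V} (α : i ⟶ j) : GinzburgArrow j i
  | loop (i : V) : GinzburgArrow i i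

instance (V : Type*) [Quiver V] : Quiver (GinzburgQuiver V) :=
  ⟨fun i j : V => GinzburgArrow i j⟩

instance (V : Type*) [Fintype V] : Fintype (GinzburgQuiver V) := inferInstanceAs (Fintype V)

instance (V : Type*) [Fintype V] : Fintype (Quiver.Symmetrify V) := inferInstanceAs (Fintype V)

/-- The bidegrees of the arrows: `(0, 1)` for the arrows of the double quiver and `(-1, 2)` for the
loops. -/
def GinzburgArrow.bidegree {V : Type*} [Quiver V] {i j : V} : GinzburgArrow i j → ℤ × ℤ
  | .arrow _ => (0, 1)
  | .star _ => (0, 1)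
  | .loop _ => (-1, 2)

namespace Ginzburg

open PathAlgebra

variable (𝕜 : Type*) [Field 𝕜] (V : Type*) [Quiver V]

/-- The bidegrees of the arrows, as a weight function. -/
def weight : ∀ i j : GinzburgQuiver V, (i ⟶ j) → ℤ × ℤ := fun _ _ a => GinzburgArrow.bidegree a

variable {V} in
/-- The idempotent `eᵢ` as an element of the underlying algebra of the Ginzburg dg algebra. -/
noncomputable def vertex (i : V) : PathAlgebra 𝕜 (GinzburgQuiver V) :=
  idem 𝕜 (V := GinzburgQuiver V) i

variable {V} in
/-- The arrow `α` as an element of the underlying algebra of the Ginzburg dg algebra. -/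
noncomputable def arrow {i j : V} (α : i ⟶ j) : PathAlgebra 𝕜 (GinzburgQuiver V) :=
  ofArrow 𝕜 (V := GinzburgQuiver V) (GinzburgArrow.arrow α)

variable {V} in
/-- The arrow `α*` as an element of the underlying algebra of the Ginzburg dg algebra. -/
noncomputable def star {i j : V} (α : i ⟶ j) : PathAlgebra 𝕜 (GinzburgQuiver V) :=
  ofArrow 𝕜 (V := GinzburgQuiver V) (GinzburgArrow.star α)

theorem arrow_mem {i j : V} (α : i ⟶ j) : arrow 𝕜 α ∈ weightPart 𝕜 (weight V) (0, 1) :=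
  ofArrow_mem (V := GinzburgQuiver V) (weight V) (GinzburgArrow.arrow α)

theorem star_mem {i j : V} (α : i ⟶ j) : star 𝕜 α ∈ weightPart 𝕜 (weight V) (0, 1) :=
  ofArrow_mem (V := GinzburgQuiver V) (weight V) (GinzburgArrow.star α)

variable {V} in
theorem vertex_mem (i : V) : vertex 𝕜 i ∈ weightPart 𝕜 (weight V) 0 :=
  idem_mem (V := GinzburgQuiver V) (weight V) i

variable {V} in
theorem vertex_mul_vertex (i : V) : vertex 𝕜 i * vertex 𝕜 i = vertex 𝕜 i :=
  idem_mul_idem (V := GinzburgQuiver V) i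

variable [Fintype V] [∀ i j : V, Fintype (i ⟶ j)]

/-- The sum of the commutators `[α, α*]` over all arrows `α` of `V`. -/
noncomputable def rho : PathAlgebra 𝕜 (GinzburgQuiver V) :=
  ∑ i : V, ∑ j : V, ∑ α : i ⟶ j, (arrow 𝕜 α * star 𝕜 α - star 𝕜 α * arrow 𝕜 α)

/-- The differential on arrows: `d α = d α* = 0` and `d tᵢ = eᵢ (∑ [α, α*]) eᵢ`. -/
noncomputable def arrowD :
    ∀ i j : GinzburgQuiver V, (i ⟶ j) → PathAlgebra 𝕜 (GinzburgQuiver V)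
  | _, _, .arrow _ => 0
  | _, _, .star _ => 0
  | _, _, .loop i => vertex 𝕜 i * rho 𝕜 V * vertex 𝕜 i

theorem idem_mul_arrowD (i j : GinzburgQuiver V) (a : i ⟶ j) :
    idem 𝕜 i * arrowD 𝕜 V i j a = arrowD 𝕜 V i j a := by
  match i, j, a with
  | _, _, .arrow _ => exact mul_zero' _
  | _, _, .star _ => exact mul_zero' _
  | _, _, .loop i =>
    change vertex 𝕜 i * (vertex 𝕜 i * rho 𝕜 V * vertex 𝕜 i) = vertex 𝕜 i * rho 𝕜 V * vertex 𝕜 i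
    rw [← mul_assoc', ← mul_assoc', vertex_mul_vertex]

theorem arrowD_mul_idem (i j : GinzburgQuiver V) (a : i ⟶ j) :
    arrowD 𝕜 V i j a * idem 𝕜 j = arrowD 𝕜 V i j a := by
  match i, j, a with
  | _, _, .arrow _ => exact zero_mul' _
  | _, _, .star _ => exact zero_mul' _
  | _, _, .loop i =>
    change vertex 𝕜 i * rho 𝕜 V * vertex 𝕜 i * vertex 𝕜 i = vertex 𝕜 i * rho 𝕜 V * vertex 𝕜 i
    rw [mul_assoc', vertex_mul_vertex]

theorem rho_mem : rho 𝕜 V ∈ weightPart 𝕜 (weight V) (0, 2) := by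
  rw [show ((0, 2) : ℤ × ℤ) = (0, 1) + (0, 1) from rfl, rho]
  exact sum_mem fun _ _ => sum_mem fun _ _ => sum_mem fun α _ => sub_mem
    (weightPart_mul_mem _ _ _ _ _ (arrow_mem 𝕜 V α) (star_mem 𝕜 V α))
    (weightPart_mul_mem _ _ _ _ _ (star_mem 𝕜 V α) (arrow_mem 𝕜 V α))

theorem arrowD_mem (i j : GinzburgQuiver V) (a : i ⟶ j) :
    arrowD 𝕜 V i j a ∈ weightPart 𝕜 (weight V) (weight V i j a + (1, 0)) := by
  match i, j, a with
  | _, _, .arrow _ => exact zero_mem _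
  | _, _, .star _ => exact zero_mem _
  | _, _, .loop i =>
    have h := weightPart_mul_mem (weight V) _ _ _ _
      (weightPart_mul_mem (weight V) _ _ _ _ (vertex_mem 𝕜 i) (rho_mem 𝕜 V))
      (vertex_mem 𝕜 i)
    rwa [zero_add, add_zero] at h

theorem deriv_rho : deriv (weight V) (arrowD 𝕜 V) (rho 𝕜 V) = 0 := by
  have h1 : ∀ {i j : V} (α : i ⟶ j), deriv (weight V) (arrowD 𝕜 V) (arrow 𝕜 α) = 0 :=
    fun α => deriv_ofArrow (weight V) (arrowD 𝕜 V) (idem_mul_arrowD 𝕜 V) _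
  have h2 : ∀ {i j : V} (α : i ⟶ j), deriv (weight V) (arrowD 𝕜 V) (star 𝕜 α) = 0 :=
    fun α => deriv_ofArrow (weight V) (arrowD 𝕜 V) (idem_mul_arrowD 𝕜 V) _
  have hm := deriv_mul (weight V) (arrowD 𝕜 V) (arrowD_mul_idem 𝕜 V)
  simp only [rho, map_sum, map_sub, hm _ _ _ (arrow_mem 𝕜 V _), hm _ _ _ (star_mem 𝕜 V _), h1, h2,
    zero_mul', mul_zero', smul_zero, add_zero, sub_zero, Finset.sum_const_zero]

theorem deriv_arrowD (i j : GinzburgQuiver V) (a : i ⟶ j) :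
    deriv (weight V) (arrowD 𝕜 V) (arrowD 𝕜 V i j a) = 0 := by
  match i, j, a with
  | _, _, .arrow _ => exact map_zero _
  | _, _, .star _ => exact map_zero _
  | _, _, .loop i =>
    have hm := deriv_mul (weight V) (arrowD 𝕜 V) (arrowD_mul_idem 𝕜 V)
    have hi := vertex_mem 𝕜 i
    have hv : deriv (weight V) (arrowD 𝕜 V) (vertex 𝕜 i) = 0 :=
      deriv_idem (V := GinzburgQuiver V) (weight V) (arrowD 𝕜 V) i
    simp only [arrowD, hm _ _ _ (weightPart_mul_mem _ _ _ _ _ hi (rho_mem 𝕜 V)), hm _ _ _ hi,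
      deriv_rho, hv, zero_mul', mul_zero', smul_zero, add_zero]

/-- The 2-Ginzburg dg algebra `Π₂(Q)` of a finite quiver `Q` (with set of vertices `V`), with its
bigrading: the path algebra of the double quiver with a loop `tᵢ` added at each vertex, where the
arrows of the double quiver have bidegree `(0, 1)` and the loops have bidegree `(-1, 2)`, with the
differential such that `d α = d α* = 0` and `d (∑ᵢ tᵢ) = ∑ [α, α*]`. -/
noncomputable def dgAlgebra : DiffBigradedAlgebra 𝕜 (PathAlgebra 𝕜 (GinzburgQuiver V)) where
  gr := weightPart 𝕜 (weight V)
  graded := weightGrading 𝕜 (weight V)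
  d := deriv (weight V) (arrowD 𝕜 V)
  d_mem p q a ha := by
    have h := deriv_mem (weight V) (arrowD 𝕜 V) (arrowD_mem 𝕜 V) (p, q) a ha
    rwa [Prod.mk_add_mk, add_zero] at h
  d_d := deriv_deriv (weight V) (arrowD 𝕜 V) (idem_mul_arrowD 𝕜 V) (arrowD_mul_idem 𝕜 V)
    (arrowD_mem 𝕜 V) (deriv_arrowD 𝕜 V)
  leibniz p q a b ha := deriv_mul (weight V) (arrowD 𝕜 V) (arrowD_mul_idem 𝕜 V) (p, q) a b ha

end Ginzburg

namespace Preprojective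

open PathAlgebra

variable (𝕜 : Type*) [Field 𝕜] (V : Type*) [Quiver V] [Fintype V] [∀ i j : V, Fintype (i ⟶ j)]

/-- The sum of the commutators `[α, α*]`, in the path algebra of the double quiver. -/
noncomputable def rho : PathAlgebra 𝕜 (Quiver.Symmetrify V) :=
  ∑ i : V, ∑ j : V, ∑ α : i ⟶ j,
    (ofArrow 𝕜 (V := Quiver.Symmetrify V) α.toPos * ofArrow 𝕜 (V := Quiver.Symmetrify V) α.toNeg -
      ofArrow 𝕜 (V := Quiver.Symmetrify V) α.toNeg * ofArrow 𝕜 (V := Quiver.Symmetrify V) α.toPos)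

/-- The preprojective algebra `Λ_Q`: the quotient of the path algebra of the double quiver by the
two-sided ideal generated by `∑ [α, α*]`. -/
abbrev PreprojectiveAlgebra : Type _ :=
  RingQuot fun x y : PathAlgebra 𝕜 (Quiver.Symmetrify V) => x = rho 𝕜 V ∧ y = 0

/-- The subspace `[Λ_Q, Λ_Q]` spanned by the commutators. -/
noncomputable def commutators : Submodule 𝕜 (PreprojectiveAlgebra 𝕜 V) :=
  Submodule.span 𝕜 {z | ∃ x y : PreprojectiveAlgebra 𝕜 V, z = x * y - y * x}

/-- The projection from the path algebra of the double quiver onto `Λ_Q / [Λ_Q, Λ_Q]`. -/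
noncomputable def proj :
    PathAlgebra 𝕜 (Quiver.Symmetrify V) →ₗ[𝕜] PreprojectiveAlgebra 𝕜 V ⧸ commutators 𝕜 V :=
  (commutators 𝕜 V).mkQ ∘ₗ (RingQuot.mkAlgHom 𝕜 _).toLinearMap

/-- The component of degree `n` of `Λ_Q / [Λ_Q, Λ_Q]`, for the grading by path length: the image of
the span of the paths of length `n` in the double quiver. -/
noncomputable def cyclicPart (n : ℤ) : Submodule 𝕜 (PreprojectiveAlgebra 𝕜 V ⧸ commutators 𝕜 V) :=
  (weightPart 𝕜 (fun (i j : Quiver.Symmetrify V) (_ : i ⟶ j) => (1 : ℤ)) n).map (proj 𝕜 V)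

end Preprojective

/-!
Let `B` be the Ginzburg dg algebra and `Λ` the preprojective algebra. As an algebra, `B` is a path
algebra, hence has a bimodule resolution of length one; on the level of cocycles this means that
every Hochschild cocycle of degree two is cohomologous to a derivation. Only the loops `tᵢ` have
nonzero cohomological degree, which leaves the odd derivations `D_y : tᵢ ↦ eᵢ y eᵢ` with `y` of
bidegree `(0, q + 2)`, i.e. with `y` in the path algebra of the double quiver, and `D_y` depends
only on the diagonal blocks of `y`. The theorem says that `D_y` is a coboundary if and only if `y`
vanishes in `Λ / [Λ, Λ]`.

*Reduction to derivations.* Instead of comparing resolutions, the cocycle is modified explicitly. A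
Hochschild cochain `f` is studied through the cochains `insertLeft x f = f (x, …)`. If `f` is a
cocycle of degree two, the formula `cocycle_insertLeft` says that, up to the differential, `f (x v,
…)` is determined by `f (x, v, …)` and `x f (v, …)`. Hence the first argument can be made to avoid
first the idempotents (`exists_insertLeft_idempotent_eq_zero`), then the arrows of the double
quiver, and finally the loops, whose differentials involve only arrows already treated
(`exists_insertLeft_ofArrow_eq_zero`). A cocycle that vanishes with at least two arguments whenever
the first one is an arrow or an idempotent has at most one argument, and is an odd derivation
(`exists_add_hochschildDiff_eq_ofLinear_loopDeriv`).

*Derivations that are coboundaries.* An even derivation `E` is a cochain of degree one, with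
differential `[d, E]`, and `[d, E] tᵢ = d (E tᵢ) - eᵢ (E ρ) eᵢ` where `ρ = ∑ [α, α*]`. If `E` maps
`α*` to a block of `u` and all other arrows to zero, this gives the commutator `[u, α]`, and
similarly for `α` and `α*` exchanged; if `E tᵢ = eᵢ w tᵢ`, it gives `w ρ`. Together with the
commutators with idempotents, which have no diagonal blocks, these elements generate the kernel of
the projection onto `Λ / [Λ, Λ]` (`mem_coboundaries_of_proj_eq_zero`). Conversely, the composition
of the homomorphism `B → Λ` that annihilates the loops with `Λ → Λ / [Λ, Λ]` is a trace that
vanishes on boundaries, and it annihilates `y` if `D_y` is a coboundary (`trace_eq_zero`).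
-/

/-! ### Inserting a first argument into Hochschild cochains -/

namespace HochschildFamily

variable {𝕜 : Type*} [Field 𝕜] {A : Type*} [Ring A] [Algebra 𝕜 A]

@[simp] theorem sub_apply (f g : HochschildFamily 𝕜 A) (n : ℕ) : (f - g) n = f n - g n := rfl

@[simp] theorem neg_apply (f : HochschildFamily 𝕜 A) (n : ℕ) : (-f) n = -f n := rfl

theorem ext' {f g : HochschildFamily 𝕜 A} (h : ∀ n b, f n b = g n b) : f = g :=
  funext fun n => MultilinearMap.ext (h n)

/-- Insertion of a first argument: `insertLeft x f` is the family `b ↦ f (x, b)`. -/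
noncomputable def insertLeft : A →ₗ[𝕜] HochschildFamily 𝕜 A →ₗ[𝕜] HochschildFamily 𝕜 A :=
  LinearMap.mk₂ 𝕜 (fun x f n => (f (n + 1)).curryLeft x)
    (fun x y f => ext' fun n b => (f (n + 1)).cons_add b x y)
    (fun c x f => ext' fun n b => (f (n + 1)).cons_smul b c x)
    (fun _ _ _ => rfl)
    (fun _ _ _ => rfl)

@[simp] theorem insertLeft_apply (x : A) (f : HochschildFamily 𝕜 A) (n : ℕ) (b : Fin n → A) :
    insertLeft x f n b = f (n + 1) (Fin.cons x b) := rfl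

/-- Left multiplication of the values: `lmul x f` is the family `b ↦ x * f b`. -/
noncomputable def lmul : A →ₗ[𝕜] HochschildFamily 𝕜 A →ₗ[𝕜] HochschildFamily 𝕜 A :=
  LinearMap.mk₂ 𝕜 (fun x f n => (LinearMap.mulLeft 𝕜 x).compMultilinearMap (f n))
    (fun x y f => ext' fun n b => add_mul x y (f n b))
    (fun c x f => ext' fun n b => smul_mul_assoc c x (f n b))
    (fun x f g => ext' fun n b => mul_add x (f n b) (g n b))
    (fun c x f => ext' fun n b => mul_smul_comm c x (f n b))

@[simp] theorem lmul_apply (x : A) (f : HochschildFamily 𝕜 A) (n : ℕ) (b : Fin n → A) :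
    lmul x f n b = x * f n b := rfl

theorem lmul_lmul (x y : A) (f : HochschildFamily 𝕜 A) :
    lmul x (lmul y f) = lmul (x * y) f :=
  ext' fun _ _ => by simp [mul_assoc]

theorem one_lmul (f : HochschildFamily 𝕜 A) : lmul 1 f = f :=
  ext' fun _ _ => by simp

theorem insertLeft_lmul (x y : A) (f : HochschildFamily 𝕜 A) :
    insertLeft x (lmul y f) = lmul y (insertLeft x f) := rfl

/-- The family, vanishing without arguments, whose first argument is inserted through a given
linear map: the inverse of currying the first argument. -/
noncomputable def uncurry (φ : A →ₗ[𝕜] HochschildFamily 𝕜 A) : HochschildFamily 𝕜 A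
  | 0 => 0
  | n + 1 => LinearMap.uncurryLeft
      ((LinearMap.proj (φ := fun n : ℕ => MultilinearMap 𝕜 (fun _ : Fin n => A) A) n) ∘ₗ φ)

@[simp] theorem insertLeft_uncurry (φ : A →ₗ[𝕜] HochschildFamily 𝕜 A) (x : A) :
    insertLeft x (uncurry φ) = φ x := by
  refine ext' fun n b => ?_
  change φ ((Fin.cons x b : Fin (n + 1) → A) 0) n (Fin.tail (Fin.cons x b : Fin (n + 1) → A)) = _
  rw [Fin.cons_zero, Fin.tail_cons]

end HochschildFamily

namespace DiffBigradedAlgebra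

open HochschildFamily

variable {𝕜 : Type*} [Field 𝕜] {A : Type*} [Ring A] [Algebra 𝕜 A] (S : DiffBigradedAlgebra 𝕜 A)

/-- The part of the Hochschild differential in which the first argument multiplies the value from
the left. -/
noncomputable def leftPart (p : ℤ) : HochschildFamily 𝕜 A →ₗ[𝕜] HochschildFamily 𝕜 A where
  toFun f
    | 0 => 0
    | n + 1 => S.leftMul p (f n)
  map_add' f g := by
    refine ext' fun n b => ?_
    cases n with
    | zero => exact (add_zero (0 : A)).symm
    | succ n => exact mul_add (S.twist p (b 0)) _ _
  map_smul' c f := by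
    refine ext' fun n b => ?_
    cases n with
    | zero => exact (smul_zero c : c • (0 : A) = 0).symm
    | succ n => exact mul_smul_comm c (S.twist p (b 0)) _

/-- The Hochschild differential without `leftPart`. Its remaining terms treat the first
argument like the others, so that insertions of a first argument can be described recursively. -/
noncomputable def reducedD (p : ℤ) : HochschildFamily 𝕜 A →ₗ[𝕜] HochschildFamily 𝕜 A :=
  S.hochschildDiff p - S.leftPart p

theorem hochschildDiff_eq (p : ℤ) (f : HochschildFamily 𝕜 A) :
    S.hochschildDiff p f = S.reducedD p f + S.leftPart p f := by
  simp [reducedD]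

theorem insertLeft_leftPart {p r s : ℤ} {x : A} (hx : x ∈ S.gr (r, s)) (f : HochschildFamily 𝕜 A) :
    insertLeft x (S.leftPart p f) = (-1 : 𝕜) ^ (p * (r - 1)) • lmul x f := by
  refine ext' fun n b => ?_
  change S.twist p ((Fin.cons x b : Fin (n + 1) → A) 0) * _ = _
  simp [S.twist_apply p (r, s) x hx]

theorem reducedD_apply_zero (p : ℤ) (f : HochschildFamily 𝕜 A) (b : Fin 0 → A) :
    S.reducedD p f 0 b = S.d (f 0 b) := by
  change (S.hochschildD p f 0 - 0) b = _
  simp [hochschildD, outerD]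

theorem reducedD_apply_succ (p : ℤ) (f : HochschildFamily 𝕜 A) (n : ℕ) (b : Fin (n + 1) → A) :
    S.reducedD p f (n + 1) b = S.d (f (n + 1) b) +
      (-1 : 𝕜) ^ p • (∑ i, S.innerD i (f (n + 1)) b + ∑ i, f n (S.contractArg i b) -
        S.rightMul (f n) b) := by
  change (S.hochschildD p f (n + 1) - S.leftMul p (f n)) b = _
  simp [hochschildD, outerD, smul_add, smul_sub, contract]
  abel

theorem innerD_zero_cons {n : ℕ} (g : MultilinearMap 𝕜 (fun _ : Fin (n + 1) => A) A) (x : A)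
    (b : Fin n → A) : S.innerD 0 g (Fin.cons x b) = g (Fin.cons (S.d x) b) := by
  simp only [innerD, MultilinearMap.compLinearMap_apply]
  congr 1
  funext j
  refine Fin.cases ?_ (fun j => ?_) j <;> simp

theorem cons_smul {n : ℕ} (g : MultilinearMap 𝕜 (fun _ : Fin (n + 1) => A) A) (c : 𝕜) (x : A)
    (b : Fin n → A) : g (Fin.cons (c • x) b) = c • g (Fin.cons x b) :=
  g.cons_smul b c x

theorem innerD_succ_cons {n : ℕ} (i : Fin n) (f : HochschildFamily 𝕜 A) {r s : ℤ} {x : A}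
    (hx : x ∈ S.gr (r, s)) (b : Fin n → A) :
    S.innerD i.succ (f (n + 1)) (Fin.cons x b) =
      (-1 : 𝕜) ^ (r - 1) • S.innerD i (insertLeft x f n) b := by
  have h := S.twist_apply 1 (r, s) x hx
  rw [one_mul] at h
  simp only [innerD, MultilinearMap.compLinearMap_apply, insertLeft_apply]
  rw [← cons_smul]
  congr 1
  funext j
  refine Fin.cases ?_ (fun j => ?_) j
  · simp [h]
  · simp [Fin.succ_inj]

theorem contractArg_zero_cons {n : ℕ} {r s : ℤ} {x : A} (hx : x ∈ S.gr (r, s)) (v : A)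
    (b : Fin n → A) : S.contractArg 0 (Fin.cons x (Fin.cons v b : Fin (n + 1) → A)) =
      Fin.cons ((-1 : 𝕜) ^ (r - 1) • (x * v)) b := by
  have h := S.twist_apply 1 (r, s) x hx
  rw [one_mul] at h
  funext j
  refine Fin.cases ?_ (fun j => ?_) j
  · simp [contractArg, h]
  · simp [contractArg]

theorem contractArg_succ_cons {n : ℕ} (i : Fin n) {r s : ℤ} {x : A} (hx : x ∈ S.gr (r, s))
    (b : Fin (n + 1) → A) : S.contractArg i.succ (Fin.cons x b) =
      Fin.cons ((-1 : 𝕜) ^ (r - 1) • x) (S.contractArg i b) := by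
  have h := S.twist_apply 1 (r, s) x hx
  rw [one_mul] at h
  funext j
  refine Fin.cases ?_ (fun j => ?_) j
  · simp [contractArg, h]
  · simp [contractArg]

theorem rightMul_cons {n : ℕ} (f : HochschildFamily 𝕜 A) {r s : ℤ} {x : A}
    (hx : x ∈ S.gr (r, s)) (b : Fin (n + 1) → A) :
    S.rightMul (f (n + 1)) (Fin.cons x b) =
      (-1 : 𝕜) ^ (r - 1) • S.rightMul (insertLeft x f n) b := by
  have h := S.twist_apply 1 (r, s) x hx
  rw [one_mul] at h
  rw [rightMul_apply, rightMul_apply, insertLeft_apply, ← smul_mul_assoc, ← cons_smul]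
  refine congrArg₂ (· * ·) (congrArg _ (funext fun j => ?_)) rfl
  refine Fin.cases ?_ (fun j => ?_) j
  · simpa using h
  · simp

/-- How the reduced Hochschild differential interacts with the insertion of a first argument `x`.
The second argument `v` is inserted in order to separate the term in which `x` is multiplied with
the next argument. -/
theorem insertLeft_insertLeft_reducedD {p r s : ℤ} {x : A} (hx : x ∈ S.gr (r, s)) (v : A)
    (f : HochschildFamily 𝕜 A) :
    insertLeft v (insertLeft x (S.reducedD p f)) =
      insertLeft v (S.reducedD (p + r - 1) (insertLeft x f)) +
      (-1 : 𝕜) ^ p • insertLeft v (insertLeft (S.d x) f) +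
      (-1 : 𝕜) ^ (p + r - 1) • insertLeft (x * v) f := by
  refine ext' fun n b => ?_
  have hs : (-1 : 𝕜) ^ (p + r - 1) = (-1 : 𝕜) ^ p * (-1 : 𝕜) ^ (r - 1) := by
    rw [add_sub_assoc, zpow_add₀ (neg_ne_zero.mpr one_ne_zero)]
  simp only [insertLeft_apply, HochschildFamily.add_apply, HochschildFamily.smul_apply,
    _root_.add_apply, _root_.smul_apply, reducedD_apply_succ, hs]
  rw [Fin.sum_univ_succ (fun i => S.innerD i (f (n + 1 + 1)) (Fin.cons x _)),
    Fin.sum_univ_succ (fun i => f (n + 1) (S.contractArg i (Fin.cons x _))), innerD_zero_cons,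
    contractArg_zero_cons S hx, rightMul_cons S f hx, cons_smul]
  simp only [innerD_succ_cons S _ f hx, contractArg_succ_cons S _ hx, cons_smul,
    ← Finset.smul_sum, smul_add, smul_sub, mul_smul]
  abel

/-- The reduced differential is linear over cocycles of degree zero, since it does not multiply
values from the left. -/
theorem reducedD_lmul {p s : ℤ} {e : A} (he : e ∈ S.gr (0, s)) (hd : S.d e = 0)
    (f : HochschildFamily 𝕜 A) :
    S.reducedD p (lmul e f) = lmul e (S.reducedD p f) := by
  have h : ∀ y, S.d (e * y) = e * S.d y := fun y => by simp [S.leibniz 0 s e y he, hd]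
  refine ext' fun n b => ?_
  cases n with
  | zero => simp [reducedD_apply_zero, h]
  | succ n =>
    simp only [lmul_apply, reducedD_apply_succ, h, rightMul_apply, innerD,
      MultilinearMap.compLinearMap_apply, mul_add, mul_sub, mul_smul_comm, Finset.mul_sum, mul_assoc]

/-! ### Degrees of cochains -/

variable {S}

theorem insertLeft_mem {p q r s : ℤ} {x : A} (hx : x ∈ S.gr (r, s)) {f : HochschildFamily 𝕜 A}
    (hf : f ∈ S.cochains p q) :
    insertLeft x f ∈ S.cochains (p + r - 1) (q + s) := by
  intro n e a ha
  have h := hf (n + 1) (Fin.cons (r, s) e) (Fin.cons x a) (fun k => by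
    refine Fin.cases ?_ (fun j => ?_) k
    · simpa using hx
    · simpa using ha j)
  rw [Fin.sum_univ_succ] at h
  rw [insertLeft_apply]
  convert h using 2
  simp only [Fin.cons_zero, Fin.cons_succ]
  ext <;> simp <;> ring

theorem lmul_mem {p q r s : ℤ} {x : A} (hx : x ∈ S.gr (r, s)) {f : HochschildFamily 𝕜 A}
    (hf : f ∈ S.cochains p q) : lmul x f ∈ S.cochains (p + r) (q + s) := by
  intro n e a ha
  have h := SetLike.mul_mem_graded hx (hf n e a ha)
  rw [lmul_apply]
  convert h using 2
  ext <;> simp <;> ring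

theorem uncurry_mem {p q : ℤ} {φ : A →ₗ[𝕜] HochschildFamily 𝕜 A}
    (h : ∀ r s x, x ∈ S.gr (r, s) → φ x ∈ S.cochains (p + r - 1) (q + s)) :
    uncurry φ ∈ S.cochains p q := by
  intro n e a ha
  cases n with
  | zero => exact zero_mem _
  | succ n =>
    have h1 := h _ _ _ (ha 0) n (fun k => e k.succ) (fun k => a k.succ) (fun k => ha k.succ)
    rw [← insertLeft_uncurry φ (a 0), insertLeft_apply] at h1
    change uncurry φ (n + 1) (Fin.cons (a 0) (Fin.tail a)) ∈ _ at h1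
    rw [Fin.cons_self_tail] at h1
    convert h1 using 2
    rw [Fin.sum_univ_succ]
    ext <;> simp <;> ring

/-! ### Cocycles of degree two -/

/-- The cocycle condition in degree two, for families with at least two arguments, the first two of
which are `x` and `v`. -/
theorem cocycle_insertLeft {f : HochschildFamily 𝕜 A} (hf : S.hochschildDiff 2 f = 0) {r s : ℤ}
    {x : A} (hx : x ∈ S.gr (r, s)) (v : A) :
    insertLeft v (S.reducedD (r + 1) (insertLeft x f)) +
      insertLeft v (insertLeft (S.d x) f) +
      lmul x (insertLeft v f) -
      (-1 : 𝕜) ^ r • insertLeft (x * v) f = 0 := by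
  have h := congrArg (fun f => insertLeft v (insertLeft x f)) hf
  simp only [hochschildDiff_eq, map_add, insertLeft_leftPart S hx,
    insertLeft_insertLeft_reducedD S hx, map_zero, map_smul, insertLeft_lmul] at h
  rw [show (2 : ℤ) + r - 1 = r + 1 by ring, Even.neg_one_zpow (even_two_mul _),
    Even.neg_one_zpow even_two, zpow_add_one₀ (neg_ne_zero.mpr one_ne_zero), one_smul, one_smul,
    mul_neg_one, neg_smul] at h
  rw [← h]
  abel

/-- The differential of a cochain of degree one, with at least two arguments, the first two of
which are `x` and `v`. -/
theorem insertLeft_hochschildDiff_one (g : HochschildFamily 𝕜 A) {r s : ℤ}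
    {x : A} (hx : x ∈ S.gr (r, s)) (v : A) :
    insertLeft v (insertLeft x (S.hochschildDiff 1 g)) =
    insertLeft v (S.reducedD r (insertLeft x g)) -
      insertLeft v (insertLeft (S.d x) g) +
      (-1 : 𝕜) ^ r • (insertLeft (x * v) g -
        lmul x (insertLeft v g)) := by
  simp only [hochschildDiff_eq, map_add, insertLeft_leftPart S hx,
    insertLeft_insertLeft_reducedD S hx, map_smul, insertLeft_lmul]
  rw [show (1 : ℤ) + r - 1 = r by ring, one_mul, zpow_sub_one₀ (neg_ne_zero.mpr one_ne_zero)]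
  simp only [zpow_one, smul_sub, neg_smul, one_smul, inv_neg, inv_one, mul_neg_one]
  abel

/-- A cocycle of degree two is cohomologous to one that vanishes if the first argument belongs to a
given complete family of orthogonal idempotents. -/
theorem exists_insertLeft_idempotent_eq_zero {I : Type*} [Fintype I] [DecidableEq I] {e : I → A}
    (he : ∀ i, e i ∈ S.gr 0) (hd : ∀ i, S.d (e i) = 0)
    (hm : ∀ i j, e i * e j = if i = j then e j else 0) (h1 : ∑ i, e i = 1)
    {q : ℤ} {f : HochschildFamily 𝕜 A} (hf : f ∈ S.cochains 2 q) (hc : S.hochschildDiff 2 f = 0) :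
    ∃ g ∈ S.cochains 1 q, ∀ i, insertLeft (e i) (f + S.hochschildDiff 1 g) = 0 := by
  -- the bounding cochain is `∑ᵢ eᵢ f (eᵢ, …)`, evaluation at the separability idempotent `∑ eᵢ ⊗ eᵢ`
  refine ⟨∑ i, lmul (e i) (insertLeft (e i) f), sum_mem fun i _ => ?_,
    fun j => ?_⟩
  · simpa using lmul_mem (he i) (insertLeft_mem (he i) hf)
  · have h2 : ∀ i, lmul (e i)
        (insertLeft (e j) (S.reducedD 1 (insertLeft (e i) f))) =
        -lmul (e i) (insertLeft (e j) f) +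
        if i = j then lmul (e j) (insertLeft (e j) f) else 0 := fun i => by
      have h := cocycle_insertLeft hc (he i) (e j)
      simp only [zero_add, hd, map_zero, add_zero, zpow_zero, one_smul, hm, LinearMap.zero_apply] at h
      rw [sub_eq_zero, ← eq_sub_iff_add_eq] at h
      rw [h, map_sub, lmul_lmul, hm, if_pos rfl, sub_eq_neg_add]
      congr 1
      split_ifs with hij <;> simp [hij]
    have h3 : ∑ i, lmul (e i) (insertLeft (e j) f) =
        insertLeft (e j) f := by
      rw [← LinearMap.sum_apply, ← map_sum, h1, one_lmul]
    have h4 : ∀ i, lmul (e j) (lmul (e i) (insertLeft (e i) f)) =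
        if j = i then lmul (e j) (insertLeft (e j) f) else 0 := fun i => by
      rw [lmul_lmul, hm]
      split_ifs with hij <;> simp [hij]
    simp only [hochschildDiff_eq, map_add, insertLeft_leftPart S (he j), map_sum,
      reducedD_lmul S (he _) (hd _), insertLeft_lmul, h2, h4, Finset.sum_add_distrib,
      Finset.sum_neg_distrib, h3]
    simp

end DiffBigradedAlgebra

/-! ### Cochains with at most one argument -/

namespace HochschildFamily

variable {𝕜 : Type*} [Field 𝕜] {A : Type*} [Ring A] [Algebra 𝕜 A]

/-- An element of the algebra, as a family concentrated in zero arguments. -/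
noncomputable def const : A →ₗ[𝕜] HochschildFamily 𝕜 A where
  toFun y
    | 0 => MultilinearMap.constOfIsEmpty 𝕜 _ y
    | _ + 1 => 0
  map_add' x y := ext' fun n b => by
    cases n with
    | zero => rfl
    | succ n => exact (add_zero (0 : A)).symm
  map_smul' c x := ext' fun n b => by
    cases n with
    | zero => rfl
    | succ n => exact (smul_zero c : c • (0 : A) = 0).symm

@[simp] theorem const_apply_zero (y : A) (b : Fin 0 → A) : const (𝕜 := 𝕜) y 0 b = y := rfl

@[simp] theorem const_apply_succ (y : A) (n : ℕ) : const (𝕜 := 𝕜) y (n + 1) = 0 := rfl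

@[simp] theorem insertLeft_const (x y : A) : insertLeft x (const (𝕜 := 𝕜) y) = 0 := rfl

theorem lmul_const (x y : A) : lmul x (const (𝕜 := 𝕜) y) = const (x * y) := by
  refine ext' fun n b => ?_
  cases n with
  | zero => rfl
  | succ n => exact mul_zero x

/-- A linear endomorphism, as a family concentrated in one argument. -/
noncomputable def ofLinear (D : A →ₗ[𝕜] A) : HochschildFamily 𝕜 A := uncurry (const ∘ₗ D)

@[simp] theorem insertLeft_ofLinear (D : A →ₗ[𝕜] A) (x : A) :
    insertLeft x (ofLinear D) = const (D x) := by
  simp [ofLinear]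

theorem ofLinear_add (D E : A →ₗ[𝕜] A) : ofLinear (D + E) = ofLinear D + ofLinear E := by
  refine ext' fun n b => ?_
  cases n with
  | zero => exact (add_zero (0 : A)).symm
  | succ n =>
    have h := insertLeft_ofLinear (D + E) (b 0)
    rw [LinearMap.add_apply, map_add, ← insertLeft_ofLinear, ← insertLeft_ofLinear, ← map_add] at h
    have h1 := congrArg (fun f : HochschildFamily 𝕜 A => f n (Fin.tail b)) h
    simpa only [insertLeft_apply, Fin.cons_self_tail] using h1

theorem ofLinear_smul (c : 𝕜) (D : A →ₗ[𝕜] A) : ofLinear (c • D) = c • ofLinear D := by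
  refine ext' fun n b => ?_
  cases n with
  | zero => exact (smul_zero c : c • (0 : A) = 0).symm
  | succ n =>
    have h := insertLeft_ofLinear (c • D) (b 0)
    rw [LinearMap.smul_apply, map_smul, ← insertLeft_ofLinear, ← map_smul] at h
    have h1 := congrArg (fun f : HochschildFamily 𝕜 A => f n (Fin.tail b)) h
    simpa only [insertLeft_apply, Fin.cons_self_tail] using h1

theorem ext_insertLeft {f g : HochschildFamily 𝕜 A} (h0 : ∀ b, f 0 b = g 0 b)
    (h1 : ∀ x b, insertLeft x f 0 b = insertLeft x g 0 b)
    (h2 : ∀ x v, insertLeft v (insertLeft x f) = insertLeft v (insertLeft x g)) : f = g := by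
  refine ext' fun n b => ?_
  match n with
  | 0 => exact h0 b
  | 1 =>
    have := h1 (b 0) (Fin.tail b)
    simpa only [insertLeft_apply, Fin.cons_self_tail] using this
  | n + 2 =>
    have := congrArg (fun f : HochschildFamily 𝕜 A => f n (Fin.tail (Fin.tail b)))
      (h2 (b 0) (Fin.tail b 0))
    simpa only [insertLeft_apply, Fin.cons_self_tail] using this

theorem exists_eq_ofLinear {f : HochschildFamily 𝕜 A} (h0 : ∀ b, f 0 b = 0)
    (h2 : ∀ x v, insertLeft v (insertLeft x f) = 0) :
    ∃ D : A →ₗ[𝕜] A, f = ofLinear D ∧ ∀ x, D x = f 1 (Fin.cons x Fin.elim0) := by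
  refine ⟨{ toFun := fun x => f 1 (Fin.cons x Fin.elim0)
            map_add' := (f 1).cons_add _
            map_smul' := (f 1).cons_smul _ }, ?_, fun x => rfl⟩
  refine ext_insertLeft h0 (fun x b => ?_) fun x v => ?_
  · rw [insertLeft_ofLinear, insertLeft_apply, Subsingleton.elim b Fin.elim0]
    rfl
  · rw [h2, insertLeft_ofLinear, insertLeft_const]

theorem const_injective : Function.Injective (const (𝕜 := 𝕜) (A := A)) := fun _ _ h =>
  congrArg (fun f : HochschildFamily 𝕜 A => f 0 Fin.elim0) h

end HochschildFamily

namespace DiffBigradedAlgebra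

open HochschildFamily

variable {𝕜 : Type*} [Field 𝕜] {A : Type*} [Ring A] [Algebra 𝕜 A] {S : DiffBigradedAlgebra 𝕜 A}

theorem neg_one_zpow_smul_smul {M : Type*} [AddCommGroup M] [Module 𝕜 M] (r : ℤ) (x : M) :
    (-1 : 𝕜) ^ r • (-1 : 𝕜) ^ r • x = x := by
  rw [smul_smul, ← zpow_add₀ (neg_ne_zero.mpr one_ne_zero), Even.neg_one_zpow (Even.add_self r),
    one_smul]

theorem homogeneous_induction (S : DiffBigradedAlgebra 𝕜 A) {P : A → Prop} (zero : P 0)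
    (add : ∀ x y, P x → P y → P (x + y)) (mem : ∀ r s x, x ∈ S.gr (r, s) → P x) (x : A) : P x :=
  DirectSum.Decomposition.inductionOn S.gr zero (fun {i} m => mem i.1 i.2 m m.2)
    (fun x y => add x y) x

/-- Without `leftPart`, the only term with arguments is right multiplication by the argument. -/
theorem insertLeft_reducedD_const (p : ℤ) (y v : A) :
    insertLeft v (S.reducedD p (const y)) = -(-1 : 𝕜) ^ p • const (𝕜 := 𝕜) (y * v) := by
  refine ext' fun n b => ?_
  rw [insertLeft_apply, reducedD_apply_succ]
  cases n with
  | zero =>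
    simp [innerD, rightMul_apply]
  | succ n =>
    simp [innerD, rightMul_apply]

/-- The part with two arguments of the differential of a family concentrated in one argument. -/
theorem insertLeft_insertLeft_hochschildDiff_ofLinear (p : ℤ) (D : A →ₗ[𝕜] A) {r s : ℤ} {x : A}
    (hx : x ∈ S.gr (r, s)) (v : A) :
    insertLeft v (insertLeft x (S.hochschildDiff p (ofLinear D))) =
      const ((-1 : 𝕜) ^ (p + r - 1) • (D (x * v) - D x * v) +
        (-1 : 𝕜) ^ (p * (r - 1)) • (x * D v)) := by
  simp only [hochschildDiff_eq, map_add, insertLeft_leftPart S hx,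
    insertLeft_insertLeft_reducedD S hx, map_smul, insertLeft_lmul, insertLeft_ofLinear,
    insertLeft_const, smul_zero, add_zero, insertLeft_reducedD_const, lmul_const, map_sub, smul_sub,
    neg_smul]
  abel

/-- The part with one argument of the differential of a family that vanishes without arguments. -/
theorem insertLeft_hochschildDiff_apply_zero (p : ℤ) {f : HochschildFamily 𝕜 A}
    (h0 : ∀ b, f 0 b = 0) {r s : ℤ} {x : A} (hx : x ∈ S.gr (r, s)) (b : Fin 0 → A) :
    insertLeft x (S.hochschildDiff p f) 0 b =
      S.d (insertLeft x f 0 b) + (-1 : 𝕜) ^ p • insertLeft (S.d x) f 0 b := by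
  rw [hochschildDiff_eq, map_add, insertLeft_leftPart S hx]
  simp only [HochschildFamily.add_apply, HochschildFamily.smul_apply, _root_.add_apply,
    _root_.smul_apply, insertLeft_apply, lmul_apply, reducedD_apply_succ]
  simp only [Fin.sum_univ_succ, innerD_zero_cons, rightMul_apply, h0, Finset.univ_eq_empty,
    Finset.sum_empty, mul_zero, zero_mul, smul_zero, add_zero, sub_zero]

theorem insertLeft_hochschildDiff_ofLinear_apply_zero (p : ℤ) (D : A →ₗ[𝕜] A) {r s : ℤ} {x : A}
    (hx : x ∈ S.gr (r, s)) (b : Fin 0 → A) :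
    insertLeft x (S.hochschildDiff p (ofLinear D)) 0 b =
      S.d (D x) + (-1 : 𝕜) ^ p • D (S.d x) := by
  rw [insertLeft_hochschildDiff_apply_zero p (fun _ => rfl) hx, insertLeft_ofLinear,
    insertLeft_ofLinear, const_apply_zero, const_apply_zero]

/-- The Hochschild differential of an even derivation is its commutator with the differential of the
algebra. -/
theorem hochschildDiff_one_ofLinear {D : A →ₗ[𝕜] A} (hD : ∀ x y, D (x * y) = D x * y + x * D y) :
    S.hochschildDiff 1 (ofLinear D) = ofLinear (S.d ∘ₗ D - D ∘ₗ S.d) := by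
  refine ext_insertLeft (fun b => ?_) (fun x b => ?_) fun x v => ?_
  · rw [hochschildDiff_eq]
    change S.reducedD 1 (ofLinear D) 0 b + 0 = 0
    rw [reducedD_apply_zero, add_zero]
    exact map_zero _
  · rw [insertLeft_ofLinear, const_apply_zero]
    induction x using S.homogeneous_induction with
    | zero => simp
    | add x y hx hy =>
      rw [map_add, LinearMap.add_apply, HochschildFamily.add_apply, _root_.add_apply, hx, hy,
        map_add]
    | mem r s x hx => simp [insertLeft_hochschildDiff_ofLinear_apply_zero _ _ hx, sub_eq_add_neg]
  · rw [insertLeft_ofLinear, insertLeft_const]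
    induction x using S.homogeneous_induction with
    | zero => simp
    | add x y hx hy => simp [hx, hy]
    | mem r s x hx =>
      rw [insertLeft_insertLeft_hochschildDiff_ofLinear _ _ hx, hD, add_sub_cancel_left, one_mul,
        add_sub_cancel_left, zpow_sub_one₀ (neg_ne_zero.mpr one_ne_zero)]
      simp

/-- An odd derivation that anticommutes with the differential is a cocycle of degree two. -/
theorem hochschildDiff_two_ofLinear {D : A →ₗ[𝕜] A}
    (hD : ∀ r s x y, x ∈ S.gr (r, s) → D (x * y) = D x * y + (-1 : 𝕜) ^ r • (x * D y))
    (hd : ∀ x, S.d (D x) + D (S.d x) = 0) :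
    S.hochschildDiff 2 (ofLinear D) = 0 := by
  refine ext_insertLeft (fun b => ?_) (fun x b => ?_) fun x v => ?_
  · rw [hochschildDiff_eq]
    change S.reducedD 2 (ofLinear D) 0 b + 0 = 0
    rw [reducedD_apply_zero, add_zero]
    exact map_zero _
  · rw [map_zero]
    induction x using S.homogeneous_induction with
    | zero => simp
    | add x y hx hy =>
      rw [map_add, LinearMap.add_apply, HochschildFamily.add_apply, _root_.add_apply, hx, hy]
      exact add_zero _
    | mem r s x hx =>
      simp [insertLeft_hochschildDiff_ofLinear_apply_zero _ _ hx, Even.neg_one_zpow even_two, hd]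
  · rw [map_zero, map_zero]
    induction x using S.homogeneous_induction with
    | zero => simp
    | add x y hx hy => simp [hx, hy]
    | mem r s x hx =>
      rw [insertLeft_insertLeft_hochschildDiff_ofLinear _ _ hx, hD r s x v hx, add_sub_cancel_left,
        show (2 : ℤ) + r - 1 = r + 1 by ring, zpow_add_one₀ (neg_ne_zero.mpr one_ne_zero),
        Even.neg_one_zpow (even_two_mul _), mul_neg_one, neg_smul, neg_one_zpow_smul_smul]
      simp

/-- A cocycle of degree two concentrated in one argument is an odd derivation. -/
theorem map_mul_of_hochschildDiff_two_ofLinear {D : A →ₗ[𝕜] A}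
    (h : S.hochschildDiff 2 (ofLinear D) = 0) {r s : ℤ} {x : A} (hx : x ∈ S.gr (r, s)) (y : A) :
    D (x * y) = D x * y + (-1 : 𝕜) ^ r • (x * D y) := by
  have h1 := insertLeft_insertLeft_hochschildDiff_ofLinear 2 D hx y
  rw [h, map_zero, map_zero, ← map_zero const] at h1
  have h2 := const_injective h1
  rw [show (2 : ℤ) + r - 1 = r + 1 by ring, zpow_add_one₀ (neg_ne_zero.mpr one_ne_zero),
    Even.neg_one_zpow (even_two_mul _), mul_neg_one, one_smul] at h2
  have h4 : D (x * y) - D x * y = (-1 : 𝕜) ^ r • (x * D y) := by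
    rw [neg_smul, eq_comm, neg_add_eq_zero] at h2
    rw [← h2, neg_one_zpow_smul_smul]
  rw [← h4]
  abel

theorem ofLinear_mem {p q : ℤ} {D : A →ₗ[𝕜] A}
    (hD : ∀ r s x, x ∈ S.gr (r, s) → D x ∈ S.gr (p + r - 1, q + s)) :
    ofLinear D ∈ S.cochains p q := by
  refine uncurry_mem fun r s x hx n e a _ => ?_
  cases n with
  | zero =>
    have := hD r s x hx
    simpa [const_apply_zero] using this
  | succ n => exact zero_mem _

/-- If a cochain is concentrated in zero arguments, its reduced differential has at most one
argument. -/
theorem insertLeft_insertLeft_reducedD_eq_zero {f : HochschildFamily 𝕜 A}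
    (hf : ∀ v, insertLeft v f = 0) (p : ℤ) (x v : A) :
    insertLeft v (insertLeft x (S.reducedD p f)) = 0 := by
  induction x using S.homogeneous_induction with
  | zero => simp
  | add x y hx hy => simp [hx, hy]
  | mem r s x hx => simp [insertLeft_insertLeft_reducedD S hx, hf]

end DiffBigradedAlgebra

/-! ### The square of the Hochschild differential -/

namespace HochschildFamily

variable {𝕜 : Type*} [Field 𝕜] {A : Type*} [Ring A] [Algebra 𝕜 A]

theorem apply_succ_eq_insertLeft (f : HochschildFamily 𝕜 A) (n : ℕ) (b : Fin (n + 1) → A) :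
    f (n + 1) b = insertLeft (b 0) f n (Fin.tail b) := by
  rw [insertLeft_apply, Fin.cons_self_tail]

end HochschildFamily

namespace DiffBigradedAlgebra

open HochschildFamily

variable {𝕜 : Type*} [Field 𝕜] {A : Type*} [Ring A] [Algebra 𝕜 A] {S : DiffBigradedAlgebra 𝕜 A}

theorem ext_homogeneous {f g : HochschildFamily 𝕜 A} (h0 : ∀ b, f 0 b = g 0 b)
    (h1 : ∀ r s x, x ∈ S.gr (r, s) → insertLeft x f = insertLeft x g) : f = g := by
  refine ext' fun n b => ?_
  cases n with
  | zero => exact h0 b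
  | succ n =>
    rw [apply_succ_eq_insertLeft, apply_succ_eq_insertLeft g]
    suffices h : insertLeft (b 0) f = insertLeft (b 0) g by rw [h]
    induction b 0 using S.homogeneous_induction with
    | zero => rw [map_zero, LinearMap.zero_apply, LinearMap.zero_apply]
    | add x y hx hy => rw [map_add, LinearMap.add_apply, LinearMap.add_apply, hx, hy]
    | mem r s x hx => exact h1 r s x hx

variable (S)

/-- Multiplication of the first argument by `x` from the left, or, if there is no argument,
multiplication of the value by `x` from the right, with a sign. -/
noncomputable def firstMul (x : A) (f : HochschildFamily 𝕜 A) : HochschildFamily 𝕜 A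
  | 0 => MultilinearMap.constOfIsEmpty 𝕜 _ (-(f 0 Fin.elim0 * S.twist 1 x))
  | n + 1 => uncurry ((insertLeft (𝕜 := 𝕜)).flip f ∘ₗ LinearMap.mulLeft 𝕜 x) (n + 1)

variable {S}

theorem firstMul_apply_zero {r s : ℤ} {x : A} (hx : x ∈ S.gr (r, s)) (f : HochschildFamily 𝕜 A)
    (b : Fin 0 → A) : S.firstMul x f 0 b = (-1 : 𝕜) ^ r • (f 0 b * x) := by
  rw [Subsingleton.elim b Fin.elim0]
  change -(f 0 Fin.elim0 * S.twist 1 x) = _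
  rw [S.twist_apply 1 (r, s) x hx, one_mul, zpow_sub_one₀ (neg_ne_zero.mpr one_ne_zero)]
  simp

@[simp] theorem insertLeft_firstMul (x v : A) (f : HochschildFamily 𝕜 A) :
    insertLeft v (S.firstMul x f) = insertLeft (x * v) f :=
  insertLeft_uncurry ((insertLeft (𝕜 := 𝕜)).flip f ∘ₗ LinearMap.mulLeft 𝕜 x) v

theorem insertLeft_reducedD_apply_zero (p : ℤ) (f : HochschildFamily 𝕜 A) (x : A)
    (b : Fin 0 → A) : insertLeft x (S.reducedD p f) 0 b =
      S.d (insertLeft x f 0 b) + (-1 : 𝕜) ^ p • (insertLeft (S.d x) f 0 b - f 0 b * x) := by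
  rw [insertLeft_apply, reducedD_apply_succ]
  simp only [Fin.sum_univ_succ, innerD_zero_cons, rightMul_apply, Finset.univ_eq_empty,
    Finset.sum_empty, add_zero, insertLeft_apply]
  congr 4
  exact congrArg _ (Subsingleton.elim _ _)

/-- The insertion of a first argument into the reduced differential. This refines
`insertLeft_insertLeft_reducedD` by the term in which the inserted argument is also the last one. -/
theorem insertLeft_reducedD {p r s : ℤ} {x : A} (hx : x ∈ S.gr (r, s))
    (f : HochschildFamily 𝕜 A) :
    insertLeft x (S.reducedD p f) = S.reducedD (p + r - 1) (insertLeft x f) +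
      (-1 : 𝕜) ^ p • insertLeft (S.d x) f + (-1 : 𝕜) ^ (p + r - 1) • S.firstMul x f := by
  refine ext_homogeneous (S := S) (fun b => ?_) fun _ _ v _ => ?_
  · simp only [insertLeft_reducedD_apply_zero, HochschildFamily.add_apply,
      HochschildFamily.smul_apply, _root_.add_apply, _root_.smul_apply, reducedD_apply_zero,
      firstMul_apply_zero hx]
    rw [smul_smul, ← zpow_add₀ (neg_ne_zero.mpr one_ne_zero),
      show p + r - 1 + r = p + (r + r) - 1 by ring, zpow_sub_one₀ (neg_ne_zero.mpr one_ne_zero),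
      zpow_add₀ (neg_ne_zero.mpr one_ne_zero), Even.neg_one_zpow (Even.add_self r)]
    simp only [smul_sub, mul_one, inv_neg, inv_one, mul_neg, neg_smul]
    abel
  · rw [insertLeft_insertLeft_reducedD S hx, map_add, map_add, map_smul, map_smul,
      insertLeft_firstMul]

theorem reducedD_firstMul {p q r s : ℤ} {x : A} (hx : x ∈ S.gr (r, s))
    {f : HochschildFamily 𝕜 A} (hf : f ∈ S.cochains p q) :
    S.reducedD (p + r) (S.firstMul x f) =
      S.firstMul x (S.reducedD p f) - (-1 : 𝕜) ^ p • S.firstMul (S.d x) f := by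
  refine ext_homogeneous (S := S) (fun b => ?_) fun r' s' v hv => ?_
  · have h0 : f 0 b ∈ S.gr (p, q) := by
      have := hf 0 Fin.elim0 b (fun k => k.elim0)
      simpa using this
    simp only [HochschildFamily.sub_apply, _root_.sub_apply, HochschildFamily.smul_apply,
      _root_.smul_apply, reducedD_apply_zero, firstMul_apply_zero hx,
      firstMul_apply_zero (S.d_mem r s x hx), map_smul, S.leibniz p q _ _ h0, smul_add]
    rw [zpow_add_one₀ (neg_ne_zero.mpr one_ne_zero), mul_neg_one, neg_smul, smul_neg, sub_neg_eq_add,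
      smul_comm ((-1 : 𝕜) ^ p)]
  · have h : x * v ∈ S.gr (r + r', s + s') := SetLike.mul_mem_graded hx hv
    have h2 : S.firstMul v (S.firstMul x f) = S.firstMul (x * v) f := by
      refine ext_homogeneous (S := S) (fun b => ?_) fun _ _ u _ => ?_
      · rw [firstMul_apply_zero hv, firstMul_apply_zero hx, firstMul_apply_zero h, smul_mul_assoc,
          smul_smul, ← zpow_add₀ (neg_ne_zero.mpr one_ne_zero), mul_assoc, add_comm]
      · rw [insertLeft_firstMul, insertLeft_firstMul, insertLeft_firstMul, mul_assoc]
    rw [insertLeft_reducedD hv, map_sub, map_smul, insertLeft_firstMul, insertLeft_firstMul,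
      insertLeft_firstMul, insertLeft_firstMul, insertLeft_reducedD h, S.leibniz r s x v hx, h2,
      map_add, map_smul, LinearMap.add_apply, LinearMap.smul_apply, smul_add, smul_smul,
      ← zpow_add₀ (neg_ne_zero.mpr one_ne_zero), add_assoc p]
    abel

/-- The reduced differential squares to zero, by induction on the number of arguments: inserting a
first argument leads to the same statement for one argument less. -/
theorem reducedD_reducedD_apply (n : ℕ) : ∀ {p q : ℤ} {f : HochschildFamily 𝕜 A},
    f ∈ S.cochains p q → ∀ b, S.reducedD (p + 1) (S.reducedD p f) n b = 0 := by
  induction n with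
  | zero => intro p q f hf b; rw [reducedD_apply_zero, reducedD_apply_zero, S.d_d]
  | succ n ih =>
    intro p q f hf b
    rw [apply_succ_eq_insertLeft]
    induction b 0 using S.homogeneous_induction with
    | zero => rw [map_zero]; rfl
    | add x y hx hy =>
      rw [map_add, LinearMap.add_apply, HochschildFamily.add_apply, _root_.add_apply, hx, hy,
        add_zero]
    | mem r s x hx =>
      have h1 := ih (insertLeft_mem hx hf) (Fin.tail b)
      rw [sub_add_cancel] at h1
      rw [insertLeft_reducedD hx, insertLeft_reducedD hx, insertLeft_reducedD (S.d_mem r s x hx),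
        show p + 1 + r - 1 = p + r by ring, map_add, map_add, map_smul, map_smul,
        reducedD_firstMul hx hf, S.d_d, show p + (r + 1) - 1 = p + r by ring,
        zpow_add_one₀ (neg_ne_zero.mpr one_ne_zero), zpow_sub_one₀ (neg_ne_zero.mpr one_ne_zero)]
      have h2 : (-1 : 𝕜) ^ (p + r) = (-1 : 𝕜) ^ p * (-1 : 𝕜) ^ r :=
        zpow_add₀ (neg_ne_zero.mpr one_ne_zero) p r
      simp only [HochschildFamily.add_apply, _root_.add_apply, h1, h2, map_zero,
        LinearMap.zero_apply, smul_zero, add_zero, zero_add, smul_add, smul_sub, mul_neg_one,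
        neg_smul, inv_neg, inv_one, HochschildFamily.smul_apply, _root_.smul_apply,
        HochschildFamily.sub_apply, _root_.sub_apply, HochschildFamily.neg_apply,
        _root_.neg_apply, mul_smul, smul_comm ((-1 : 𝕜) ^ r) ((-1 : 𝕜) ^ p)]
      rw [neg_one_zpow_smul_smul]
      abel

theorem reducedD_lmul_of_mem {p r s : ℤ} {x : A} (hx : x ∈ S.gr (r, s))
    (f : HochschildFamily 𝕜 A) :
    S.reducedD (p + r) (lmul x f) = lmul (S.d x) f + (-1 : 𝕜) ^ r • lmul x (S.reducedD p f) := by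
  refine ext' fun n b => ?_
  cases n with
  | zero => simp [reducedD_apply_zero, S.leibniz r s x _ hx]
  | succ n =>
    simp only [HochschildFamily.add_apply, _root_.add_apply, HochschildFamily.smul_apply,
      _root_.smul_apply, lmul_apply, reducedD_apply_succ, S.leibniz r s x _ hx, rightMul_apply,
      innerD, MultilinearMap.compLinearMap_apply, mul_add, mul_sub, mul_smul_comm, Finset.mul_sum,
      mul_assoc, smul_add, smul_sub, Finset.smul_sum,
      zpow_add₀ (neg_ne_zero.mpr one_ne_zero : (-1 : 𝕜) ≠ 0), mul_smul, smul_comm ((-1 : 𝕜) ^ p)]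
    abel

/-- The Hochschild differential squares to zero. -/
theorem hochschildDiff_hochschildDiff {p q : ℤ} {f : HochschildFamily 𝕜 A}
    (hf : f ∈ S.cochains p q) : S.hochschildDiff (p + 1) (S.hochschildDiff p f) = 0 := by
  have h0 : S.reducedD (p + 1) (S.reducedD p f) = 0 :=
    ext' fun n b => reducedD_reducedD_apply n hf b
  rw [hochschildDiff_eq, hochschildDiff_eq, map_add, map_add, h0, zero_add]
  refine ext_homogeneous (S := S) (fun b => ?_) fun r s x hx => ?_
  · change S.reducedD (p + 1) (S.leftPart p f) 0 b + (0 + 0) = 0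
    rw [reducedD_apply_zero, add_zero, add_zero]
    exact map_zero _
  · have h1 : S.firstMul x (S.leftPart p f) =
        (-1 : 𝕜) ^ (p * r) • lmul x (S.leftPart p f) := by
      refine ext_homogeneous (S := S) (fun b => ?_) fun r' s' v hv => ?_
      · rw [firstMul_apply_zero hx]
        change (-1 : 𝕜) ^ r • (0 * x) = (-1 : 𝕜) ^ (p * r) • (x * 0)
        rw [zero_mul, mul_zero, smul_zero, smul_zero]
      · have h : x * v ∈ S.gr (r + r', s + s') := SetLike.mul_mem_graded hx hv
        rw [insertLeft_firstMul, map_smul, insertLeft_lmul, insertLeft_leftPart S h,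
          insertLeft_leftPart S hv, map_smul, lmul_lmul, smul_smul,
          ← zpow_add₀ (neg_ne_zero.mpr one_ne_zero)]
        congr 2
        ring
    rw [map_add, map_add, insertLeft_reducedD hx, insertLeft_leftPart S hx,
      insertLeft_leftPart S hx, insertLeft_leftPart S hx, insertLeft_leftPart S (S.d_mem r s x hx),
      h1, map_smul, show p + 1 + r - 1 = p + r by ring, reducedD_lmul_of_mem hx, map_zero]
    have e : ∀ a b : ℤ, (-1 : 𝕜) ^ (a + b) = (-1 : 𝕜) ^ a * (-1 : 𝕜) ^ b := fun a b =>
      zpow_add₀ (neg_ne_zero.mpr one_ne_zero) a b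
    have e1 : (-1 : 𝕜) ^ (-p) = (-1 : 𝕜) ^ p := by
      rw [zpow_neg, ← inv_zpow, inv_neg, inv_one]
    rw [show p * (r - 1) = p * r + -p by ring, show p * (r + 1 - 1) = p * r by ring,
      show (p + 1) * (r - 1) = p * r + r + -p + -1 by ring, e, e, e, e, e, e, e1]
    simp only [smul_add, smul_smul, zpow_neg, zpow_one, inv_neg, inv_one, mul_neg_one, neg_smul,
      neg_mul]
    module

end DiffBigradedAlgebra

/-! ### Crossed derivations of path algebras -/

namespace PathAlgebra

open HochschildFamily DiffBigradedAlgebra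

section crossed

variable {𝕜 : Type*} [Field 𝕜] {V : Type*} [Quiver V]

theorem ofPath_cons {i j k : V} (p : Quiver.Path i j) (a : j ⟶ k) :
    ofPath 𝕜 (p.cons a) = ofPath 𝕜 p * ofArrow 𝕜 a := (ofPath_mul_ofPath 𝕜 p a.toPath).symm

theorem idem_mul_ofArrow {i j : V} (a : i ⟶ j) : idem 𝕜 i * ofArrow 𝕜 a = ofArrow 𝕜 a :=
  idem_mul_ofPath _

theorem ofArrow_mul_idem {i j : V} (a : i ⟶ j) : ofArrow 𝕜 a * idem 𝕜 j = ofArrow 𝕜 a :=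
  ofPath_mul_idem _

theorem idem_mul_ofArrow_of_ne {i j k : V} (h : k ≠ i) (a : i ⟶ j) :
    idem 𝕜 k * ofArrow 𝕜 a = 0 := ofPath_mul_ofPath_of_ne 𝕜 h _ _

theorem ofArrow_mul_idem_of_ne {i j k : V} (h : j ≠ k) (a : i ⟶ j) :
    ofArrow 𝕜 a * idem 𝕜 k = 0 := ofPath_mul_ofPath_of_ne 𝕜 h _ _

variable [Fintype V]

/-- The values on paths of a crossed derivation from the path algebra to linear maps from the path
algebra to families, with values `F` on arrows: `crossed F (p q) v = crossed F p (q v) +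
p (crossed F q v)`. -/
noncomputable def crossed
    (F : ∀ i j : V, (i ⟶ j) → PathAlgebra 𝕜 V →ₗ[𝕜] HochschildFamily 𝕜 (PathAlgebra 𝕜 V)) {i : V} :
    ∀ {j : V}, Quiver.Path i j → PathAlgebra 𝕜 V →ₗ[𝕜] HochschildFamily 𝕜 (PathAlgebra 𝕜 V)
  | _, .nil => 0
  | _, .cons p a => crossed F p ∘ₗ LinearMap.mulLeft 𝕜 (ofArrow 𝕜 a) + lmul (ofPath 𝕜 p) ∘ₗ F _ _ a

/-- The linear map `x ↦ crossed F x 1`. -/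
noncomputable def crossedOne
    (F : ∀ i j : V, (i ⟶ j) → PathAlgebra 𝕜 V →ₗ[𝕜] HochschildFamily 𝕜 (PathAlgebra 𝕜 V)) :
    PathAlgebra 𝕜 V →ₗ[𝕜] HochschildFamily 𝕜 (PathAlgebra 𝕜 V) :=
  (basis 𝕜).constr 𝕜 fun x => crossed F x.2.2 1

variable {F : ∀ i j : V, (i ⟶ j) → PathAlgebra 𝕜 V →ₗ[𝕜] HochschildFamily 𝕜 (PathAlgebra 𝕜 V)}

theorem crossedOne_ofPath {i j : V} (p : Quiver.Path i j) :
    crossedOne F (ofPath 𝕜 p) = crossed F p 1 := by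
  simp [crossedOne, ofPath]

theorem crossed_idem_mul (hr : ∀ i j (a : i ⟶ j) v, F i j a (idem 𝕜 j * v) = F i j a v) {i j : V}
    (p : Quiver.Path i j) (v : PathAlgebra 𝕜 V) :
    crossed F p (idem 𝕜 j * v) = crossed F p v := by
  cases p with
  | nil => rfl
  | cons p a =>
    simp only [crossed, LinearMap.add_apply, LinearMap.comp_apply, LinearMap.mulLeft_apply, hr]
    rw [← mul_assoc, ofArrow_mul_idem]

theorem lmul_idem_crossed {i j : V} (p : Quiver.Path i j) (v : PathAlgebra 𝕜 V) :
    lmul (idem 𝕜 i) (crossed F p v) = crossed F p v := by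
  induction p generalizing v with
  | nil => exact map_zero _
  | cons p a ih =>
    simp only [crossed, LinearMap.add_apply, LinearMap.comp_apply, LinearMap.mulLeft_apply, map_add,
      ih, lmul_lmul, idem_mul_ofPath]

theorem crossed_comp (hr : ∀ i j (a : i ⟶ j) v, F i j a (idem 𝕜 j * v) = F i j a v) {i j k : V}
    (p : Quiver.Path i j) (q : Quiver.Path j k) (v : PathAlgebra 𝕜 V) :
    crossed F (p.comp q) v = crossed F p (ofPath 𝕜 q * v) + lmul (ofPath 𝕜 p) (crossed F q v) := by
  induction q generalizing v with
  | nil =>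
    have h := crossed_idem_mul hr p v
    rw [idem] at h
    simp [crossed, h]
  | cons q a ih =>
    simp only [Quiver.Path.comp_cons, crossed, LinearMap.add_apply, LinearMap.comp_apply,
      LinearMap.mulLeft_apply, map_add, ih, lmul_lmul, ofPath_mul_ofPath, ofPath_cons, mul_assoc,
      add_assoc]

theorem crossed_toPath (hl : ∀ i j (a : i ⟶ j) v, lmul (idem 𝕜 i) (F i j a v) = F i j a v)
    {i j : V} (a : i ⟶ j) (v : PathAlgebra 𝕜 V) : crossed F a.toPath v = F i j a v := by
  have := hl i j a v
  rw [idem] at this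
  simp [Quiver.Hom.toPath, crossed, this]

/-- The crossed derivation measures the failure of `crossedOne F` to be left linear. -/
theorem crossedOne_ofPath_mul
    (hr : ∀ i j (a : i ⟶ j) v, F i j a (idem 𝕜 j * v) = F i j a v) {i j : V}
    (p : Quiver.Path i j) (v : PathAlgebra 𝕜 V) :
    crossedOne F (ofPath 𝕜 p * v) = crossed F p v + lmul (ofPath 𝕜 p) (crossedOne F v) := by
  refine induction 𝕜 (P := fun v => crossedOne F (ofPath 𝕜 p * v) =
    crossed F p v + lmul (ofPath 𝕜 p) (crossedOne F v)) v (by simp)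
    (fun x y hx hy => ?_) fun c k l q => ?_
  · simp only [mul_add, map_add, hx, hy]
    abel
  · simp only [mul_smul_comm, map_smul, ← smul_add]
    congr 1
    rw [crossedOne_ofPath]
    by_cases h : j = k
    · subst h
      rw [ofPath_mul_ofPath, crossedOne_ofPath, crossed_comp hr, mul_one]
    · rw [ofPath_mul_ofPath_of_ne 𝕜 h, map_zero, ← lmul_idem_crossed q, lmul_lmul,
        ← crossed_idem_mul hr, idem, ofPath_mul_ofPath_of_ne 𝕜 h, idem, ofPath_mul_ofPath_of_ne 𝕜 h,
        map_zero, map_zero, LinearMap.zero_apply, add_zero]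

theorem crossedOne_ofArrow_mul (hl : ∀ i j (a : i ⟶ j) v, lmul (idem 𝕜 i) (F i j a v) = F i j a v)
    (hr : ∀ i j (a : i ⟶ j) v, F i j a (idem 𝕜 j * v) = F i j a v) {i j : V}
    (a : i ⟶ j) (v : PathAlgebra 𝕜 V) :
    crossedOne F (ofArrow 𝕜 a * v) = F i j a v + lmul (ofArrow 𝕜 a) (crossedOne F v) := by
  rw [ofArrow, crossedOne_ofPath_mul hr, crossed_toPath hl]

theorem crossedOne_ofArrow (hl : ∀ i j (a : i ⟶ j) v, lmul (idem 𝕜 i) (F i j a v) = F i j a v)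
    {i j : V} (a : i ⟶ j) : crossedOne F (ofArrow 𝕜 a) = F i j a 1 := by
  rw [ofArrow, crossedOne_ofPath, crossed_toPath hl]

theorem crossedOne_idem_mul
    (hr : ∀ i j (a : i ⟶ j) v, F i j a (idem 𝕜 j * v) = F i j a v) (i : V) (v : PathAlgebra 𝕜 V) :
    crossedOne F (idem 𝕜 i * v) = lmul (idem 𝕜 i) (crossedOne F v) := by
  rw [idem, crossedOne_ofPath_mul hr]
  exact zero_add _

theorem crossedOne_idem (i : V) : crossedOne F (idem 𝕜 i) = 0 :=
  crossedOne_ofPath _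

theorem crossed_mem {S : DiffBigradedAlgebra 𝕜 (PathAlgebra 𝕜 V)} {w : ∀ i j : V, (i ⟶ j) → ℤ × ℤ}
    (hS : S.gr = weightPart 𝕜 w) {q : ℤ}
    (hF : ∀ i j (a : i ⟶ j) r s v, v ∈ S.gr (r, s) →
      F i j a v ∈ S.cochains ((w i j a).1 + r) (q + (w i j a).2 + s))
    {i j : V} (p : Quiver.Path i j) (r s : ℤ) (v : PathAlgebra 𝕜 V) (hv : v ∈ S.gr (r, s)) :
    crossed F p v ∈ S.cochains ((pathWeight w p).1 + r) (q + (pathWeight w p).2 + s) := by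
  induction p generalizing r s v with
  | nil => exact zero_mem _
  | cons p a ih =>
    refine add_mem ?_ ?_
    · have ha : ofArrow 𝕜 a ∈ S.gr (w _ _ a) := hS ▸ ofArrow_mem w a
      have h : crossed F p (ofArrow 𝕜 a * v) ∈ _ :=
        ih ((w _ _ a).1 + r) ((w _ _ a).2 + s) _ (SetLike.mul_mem_graded ha hv)
      rwa [← add_assoc, ← add_assoc, add_assoc q] at h
    · have hp : ofPath 𝕜 p ∈ S.gr (pathWeight w p) := hS ▸ ofPath_mem w p
      have h : lmul (ofPath 𝕜 p) (F _ _ a v) ∈ _ := lmul_mem hp (hF _ _ a r s v hv)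
      rwa [add_comm _ (pathWeight w p).1, add_comm _ (pathWeight w p).2, add_assoc q,
        add_left_comm _ q, ← add_assoc (pathWeight w p).1, ← add_assoc (pathWeight w p).2,
        ← add_assoc q] at h

theorem crossedOne_mem {S : DiffBigradedAlgebra 𝕜 (PathAlgebra 𝕜 V)}
    {w : ∀ i j : V, (i ⟶ j) → ℤ × ℤ} (hS : S.gr = weightPart 𝕜 w) {q : ℤ}
    (hF : ∀ i j (a : i ⟶ j) r s v, v ∈ S.gr (r, s) →
      F i j a v ∈ S.cochains ((w i j a).1 + r) (q + (w i j a).2 + s))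
    (r s : ℤ) (x : PathAlgebra 𝕜 V) (hx : x ∈ S.gr (r, s)) :
    crossedOne F x ∈ S.cochains r (q + s) := by
  rw [hS] at hx
  induction hx using Submodule.span_induction with
  | zero => rw [map_zero]; exact zero_mem _
  | add a b _ _ ha hb => rw [map_add]; exact add_mem ha hb
  | smul c a _ ha => rw [map_smul]; exact Submodule.smul_mem _ _ ha
  | mem a ha =>
    obtain ⟨i, j, p, hp, rfl⟩ := ha
    rw [crossedOne_ofPath]
    have := crossed_mem hS hF p 0 0 1 SetLike.GradedOne.one_mem
    rwa [hp, add_zero, add_zero] at this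

end crossed

end PathAlgebra

/-! ### Homotopies that remove arrows from the first argument -/

namespace Ginzburg

open PathAlgebra HochschildFamily DiffBigradedAlgebra

variable {𝕜 : Type*} [Field 𝕜] {V : Type*} [Quiver V] [Fintype V]

section homotopyValue

variable {f : HochschildFamily 𝕜 (PathAlgebra 𝕜 (GinzburgQuiver V))}
  {P : ∀ i j : GinzburgQuiver V, (i ⟶ j) → Prop}

open Classical in
/-- The values on arrows of a crossed derivation from which a homotopy is constructed that makes a
cocycle vanish whenever the first argument is an arrow satisfying `P`. -/
noncomputable def homotopyValue (f : HochschildFamily 𝕜 (PathAlgebra 𝕜 (GinzburgQuiver V)))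
    (P : ∀ i j : GinzburgQuiver V, (i ⟶ j) → Prop) (i j : GinzburgQuiver V) (a : i ⟶ j) :
    PathAlgebra 𝕜 (GinzburgQuiver V) →ₗ[𝕜]
      HochschildFamily 𝕜 (PathAlgebra 𝕜 (GinzburgQuiver V)) :=
  if P i j a then (-1 : 𝕜) ^ (weight V i j a).1 •
    ((insertLeft (𝕜 := 𝕜)).flip (insertLeft (ofArrow 𝕜 a) f) ∘ₗ LinearMap.mulLeft 𝕜 (idem 𝕜 j))
  else 0

theorem homotopyValue_of_pos {i j : GinzburgQuiver V} {a : i ⟶ j}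
    (ha : P i j a) (v : PathAlgebra 𝕜 (GinzburgQuiver V)) :
    homotopyValue f P i j a v = (-1 : 𝕜) ^ (weight V i j a).1 •
      insertLeft (idem 𝕜 j * v) (insertLeft (ofArrow 𝕜 a) f) := by
  simp [homotopyValue, ha]

theorem homotopyValue_of_neg {i j : GinzburgQuiver V} {a : i ⟶ j}
    (ha : ¬ P i j a) : homotopyValue f P i j a = 0 := by
  simp [homotopyValue, ha]

theorem homotopyValue_idem_mul (i j : GinzburgQuiver V) (a : i ⟶ j)
    (v : PathAlgebra 𝕜 (GinzburgQuiver V)) :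
    homotopyValue f P i j a (idem 𝕜 j * v) = homotopyValue f P i j a v := by
  by_cases ha : P i j a
  · rw [homotopyValue_of_pos ha, homotopyValue_of_pos ha, ← mul_assoc, idem_mul_idem]
  · rw [homotopyValue_of_neg ha]
    rfl

theorem homotopyValue_eq_zero {i j : GinzburgQuiver V} {a : i ⟶ j}
    (ha : ∀ v, insertLeft v (insertLeft (ofArrow 𝕜 a) f) = 0)
    (v : PathAlgebra 𝕜 (GinzburgQuiver V)) : homotopyValue f P i j a v = 0 := by
  by_cases h : P i j a
  · rw [homotopyValue_of_pos h, ha, smul_zero]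
  · rw [homotopyValue_of_neg h]
    rfl

end homotopyValue

variable [∀ i j : V, Fintype (i ⟶ j)]

theorem d_ofArrow {i j : GinzburgQuiver V} (a : i ⟶ j) :
    (dgAlgebra 𝕜 V).d (ofArrow 𝕜 a) = arrowD 𝕜 V i j a :=
  deriv_ofArrow (weight V) (arrowD 𝕜 V) (idem_mul_arrowD 𝕜 V) a

theorem d_idem (i : GinzburgQuiver V) : (dgAlgebra 𝕜 V).d (idem 𝕜 i) = 0 :=
  deriv_idem (weight V) (arrowD 𝕜 V) i

theorem gr_idem (i : GinzburgQuiver V) : idem 𝕜 i ∈ (dgAlgebra 𝕜 V).gr (0, 0) :=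
  idem_mem (weight V) i

theorem gr_ofArrow {i j : GinzburgQuiver V} (a : i ⟶ j) :
    ofArrow 𝕜 a ∈ (dgAlgebra 𝕜 V).gr ((weight V i j a).1, (weight V i j a).2) :=
  ofArrow_mem (weight V) a

/-- The span of the products `a b` of arrows, where `a` is a cocycle of cohomological degree zero, such
that the family `f` vanishes, with at least two arguments, if the first one is `a` or `b`. -/
noncomputable def vanishingProducts (f : HochschildFamily 𝕜 (PathAlgebra 𝕜 (GinzburgQuiver V))) :
    Submodule 𝕜 (PathAlgebra 𝕜 (GinzburgQuiver V)) :=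
  Submodule.span 𝕜 {x | ∃ (i j k l : GinzburgQuiver V) (a : i ⟶ j) (b : k ⟶ l),
    (weight V i j a).1 = 0 ∧ (dgAlgebra 𝕜 V).d (ofArrow 𝕜 a) = 0 ∧
    (∀ v, insertLeft v (insertLeft (ofArrow 𝕜 a) f) = 0) ∧
    (∀ v, insertLeft v (insertLeft (ofArrow 𝕜 b) f) = 0) ∧ x = ofArrow 𝕜 a * ofArrow 𝕜 b}

/-- By the cocycle condition, `f (a b, …)` is determined by `f (a, b, …)` and `a f (b, …)`. -/
theorem insertLeft_insertLeft_of_mem_vanishingProducts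
    {f : HochschildFamily 𝕜 (PathAlgebra 𝕜 (GinzburgQuiver V))}
    (hc : (dgAlgebra 𝕜 V).hochschildDiff 2 f = 0) {x : PathAlgebra 𝕜 (GinzburgQuiver V)}
    (hx : x ∈ vanishingProducts f) (v : PathAlgebra 𝕜 (GinzburgQuiver V)) :
    insertLeft v (insertLeft x f) = 0 := by
  induction hx using Submodule.span_induction with
  | zero => simp
  | add a b _ _ ha hb => simp [ha, hb]
  | smul c a _ ha => simp [ha]
  | mem x hx =>
    obtain ⟨i, j, k, l, a, b, hw, hd, ha, hb, rfl⟩ := hx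
    have h := congrArg (insertLeft v) (cocycle_insertLeft hc (gr_ofArrow a) (ofArrow 𝕜 b))
    simpa [hw, hd, insertLeft_lmul, hb, insertLeft_insertLeft_reducedD_eq_zero ha] using h

/-- A cocycle of degree two that vanishes if its first argument is an idempotent is linear in the
first argument over the span of the idempotents. -/
theorem insertLeft_idem_mul {f : HochschildFamily 𝕜 (PathAlgebra 𝕜 (GinzburgQuiver V))}
    (hc : (dgAlgebra 𝕜 V).hochschildDiff 2 f = 0)
    (h1 : ∀ i, insertLeft (idem 𝕜 i) f = 0) (i : GinzburgQuiver V)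
    (v : PathAlgebra 𝕜 (GinzburgQuiver V)) :
    insertLeft (idem 𝕜 i * v) f = lmul (idem 𝕜 i) (insertLeft v f) := by
  have h := cocycle_insertLeft hc (gr_idem i) v
  simp only [d_idem, h1, map_zero, zpow_zero, one_smul, LinearMap.zero_apply, zero_add,
    sub_eq_zero] at h
  exact h.symm

theorem lmul_idem_homotopyValue {f : HochschildFamily 𝕜 (PathAlgebra 𝕜 (GinzburgQuiver V))}
    (hc : (dgAlgebra 𝕜 V).hochschildDiff 2 f = 0) (h1 : ∀ i, insertLeft (idem 𝕜 i) f = 0)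
    (P : ∀ i j : GinzburgQuiver V, (i ⟶ j) → Prop) (i j : GinzburgQuiver V) (a : i ⟶ j)
    (v : PathAlgebra 𝕜 (GinzburgQuiver V)) :
    lmul (idem 𝕜 i) (homotopyValue f P i j a v) = homotopyValue f P i j a v := by
  by_cases ha : P i j a
  · rw [homotopyValue_of_pos ha, map_smul, ← insertLeft_lmul, ← insertLeft_idem_mul hc h1,
      idem_mul_ofArrow]
  · rw [homotopyValue_of_neg ha]
    exact map_zero _

theorem homotopyValue_mem {q : ℤ} {f : HochschildFamily 𝕜 (PathAlgebra 𝕜 (GinzburgQuiver V))}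
    (hf : f ∈ (dgAlgebra 𝕜 V).cochains 2 q)
    (P : ∀ i j : GinzburgQuiver V, (i ⟶ j) → Prop) (i j : GinzburgQuiver V) (a : i ⟶ j) (r s : ℤ)
    (v : PathAlgebra 𝕜 (GinzburgQuiver V)) (hv : v ∈ (dgAlgebra 𝕜 V).gr (r, s)) :
    homotopyValue f P i j a v ∈
      (dgAlgebra 𝕜 V).cochains ((weight V i j a).1 + r) (q + (weight V i j a).2 + s) := by
  by_cases ha : P i j a
  · rw [homotopyValue_of_pos ha]
    refine Submodule.smul_mem _ _ ?_
    have hv' := weightPart_mul_mem (weight V) 0 (r, s) _ _ (idem_mem (weight V) j) hv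
    rw [zero_add] at hv'
    have h := insertLeft_mem (S := dgAlgebra 𝕜 V) hv' (insertLeft_mem (gr_ofArrow a) hf)
    rwa [show 2 + (weight V i j a).1 - 1 + r - 1 = (weight V i j a).1 + r by ring] at h
  · rw [homotopyValue_of_neg ha]
    exact zero_mem _

/-- A cocycle of degree two that vanishes if its first argument is an idempotent is cohomologous to
one that also vanishes if it has at least two arguments and the first one is an arrow satisfying
`P`, provided that the differentials of these arrows only involve arrows for which this already
holds. -/
theorem exists_insertLeft_ofArrow_eq_zero {q : ℤ}
    {f : HochschildFamily 𝕜 (PathAlgebra 𝕜 (GinzburgQuiver V))}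
    (hf : f ∈ (dgAlgebra 𝕜 V).cochains 2 q) (hc : (dgAlgebra 𝕜 V).hochschildDiff 2 f = 0)
    (h1 : ∀ i, insertLeft (idem 𝕜 i) f = 0) (P : ∀ i j : GinzburgQuiver V, (i ⟶ j) → Prop)
    (hP : ∀ i j (a : i ⟶ j), P i j a → arrowD 𝕜 V i j a ∈ vanishingProducts f) :
    ∃ g ∈ (dgAlgebra 𝕜 V).cochains 1 q,
      (∀ i, insertLeft (idem 𝕜 i) (f - (dgAlgebra 𝕜 V).hochschildDiff 1 g) = 0) ∧
      ∀ i j (a : i ⟶ j), P i j a → ∀ v, insertLeft v (insertLeft (ofArrow 𝕜 a)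
        (f - (dgAlgebra 𝕜 V).hochschildDiff 1 g)) = 0 := by
  have hl := lmul_idem_homotopyValue hc h1 P
  have hr := homotopyValue_idem_mul (f := f) (P := P)
  -- The bounding cochain `g` has `g (x v, …) = ± f (x, v, …) + x g (v, …)` for the arrows `x` that
  -- satisfy `P`, which makes its differential agree with `f` there.
  refine ⟨uncurry (crossedOne (homotopyValue f P)), uncurry_mem fun r s x hx => ?_, fun i => ?_,
    fun i j a ha v => ?_⟩
  · rw [add_sub_cancel_left]
    exact crossedOne_mem rfl (homotopyValue_mem hf P) r s x hx
  · have h0 : insertLeft (idem 𝕜 i) (uncurry (crossedOne (homotopyValue f P))) = 0 := by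
      rw [insertLeft_uncurry, crossedOne_idem]
    have h2 : insertLeft (idem 𝕜 i) ((dgAlgebra 𝕜 V).hochschildDiff 1
        (uncurry (crossedOne (homotopyValue f P)))) = 0 := by
      refine ext' fun n b => ?_
      cases n with
      | zero =>
        rw [insertLeft_hochschildDiff_apply_zero 1 (fun _ => rfl) (gr_idem i), h0, d_idem, map_zero]
        simp
      | succ n =>
        have h3 := congrArg (fun f : HochschildFamily 𝕜 _ => f n (Fin.tail b))
          (insertLeft_hochschildDiff_one (uncurry (crossedOne (homotopyValue f P))) (gr_idem i)
            (b 0))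
        simp only [h0, d_idem, insertLeft_uncurry, crossedOne_idem_mul hr, sub_self, map_zero,
          smul_zero, add_zero, LinearMap.zero_apply] at h3
        rw [insertLeft_apply, Fin.cons_self_tail] at h3
        exact h3
    rw [map_sub, h1, h2, sub_zero]
  · have hg : ∀ x ∈ vanishingProducts f, crossedOne (homotopyValue f P) x = 0 := fun x hx => by
      induction hx using Submodule.span_induction with
      | zero => simp
      | add a b _ _ ha hb => simp [ha, hb]
      | smul c a _ ha => simp [ha]
      | mem x hx =>
        obtain ⟨i, j, k, l, a, b, -, -, ha, hb, rfl⟩ := hx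
        rw [crossedOne_ofArrow_mul hl hr, crossedOne_ofArrow hl, homotopyValue_eq_zero ha,
          homotopyValue_eq_zero hb]
        simp
    have h2 := congrArg (insertLeft v) (cocycle_insertLeft hc (gr_ofArrow a) (idem 𝕜 j))
    rw [d_ofArrow, insertLeft_insertLeft_of_mem_vanishingProducts hc (hP i j a ha), h1, map_zero,
      add_zero, add_zero, ofArrow_mul_idem, map_sub, map_smul, map_zero,
      insertLeft_insertLeft_reducedD _ (gr_idem j), d_idem, map_zero, LinearMap.zero_apply,
      map_zero, smul_zero, add_zero, sub_eq_zero, add_zero, add_sub_cancel_right] at h2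
    rw [map_sub, map_sub, insertLeft_hochschildDiff_one _ (gr_ofArrow a), insertLeft_uncurry,
      insertLeft_uncurry, insertLeft_uncurry, insertLeft_uncurry, crossedOne_ofArrow_mul hl hr,
      crossedOne_ofArrow hl, add_sub_cancel_right, d_ofArrow, hg _ (hP i j a ha),
      homotopyValue_of_pos ha, homotopyValue_of_pos ha, mul_one, map_smul, map_smul, map_zero,
      sub_zero, ← smul_add, h2, neg_one_zpow_smul_smul, sub_self]

end Ginzburg

/-! ### Hochschild coboundaries are cocycles -/

namespace DiffBigradedAlgebra

open HochschildFamily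

variable {𝕜 : Type*} [Field 𝕜] {A : Type*} [Ring A] [Algebra 𝕜 A] {S : DiffBigradedAlgebra 𝕜 A}

theorem firstMul_mem {p q r s : ℤ} {x : A} (hx : x ∈ S.gr (r, s)) {f : HochschildFamily 𝕜 A}
    (hf : f ∈ S.cochains p q) : S.firstMul x f ∈ S.cochains (p + r) (q + s) := by
  intro n e a ha
  cases n with
  | zero =>
    rw [firstMul_apply_zero hx]
    refine Submodule.smul_mem _ _ ?_
    convert SetLike.mul_mem_graded (hf 0 e a ha) hx using 2
    ext <;> simp
  | succ n =>
    have h : x * a 0 ∈ S.gr (r + (e 0).1, s + (e 0).2) := SetLike.mul_mem_graded hx (ha 0)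
    rw [apply_succ_eq_insertLeft, insertLeft_firstMul]
    convert insertLeft_mem h hf n (Fin.tail e) (Fin.tail a) (fun k => ha k.succ) using 2
    rw [Fin.sum_univ_succ]
    ext <;> simp [Fin.tail] <;> ring

theorem reducedD_mem (n : ℕ) : ∀ {p q : ℤ} {f : HochschildFamily 𝕜 A}, f ∈ S.cochains p q →
    ∀ (e : Fin n → ℤ × ℤ) (a : Fin n → A), (∀ k, a k ∈ S.gr (e k)) →
      S.reducedD p f n a ∈ S.gr ((∑ k, e k) + (p + 1 - n, q)) := by
  induction n with
  | zero =>
    intro p q f hf e a ha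
    have h := S.d_mem _ _ _ (hf 0 e a ha)
    rw [reducedD_apply_zero]
    convert h using 2
    ext <;> simp
  | succ n ih =>
    intro p q f hf e a ha
    rw [apply_succ_eq_insertLeft, insertLeft_reducedD (ha 0)]
    refine add_mem (add_mem ?_ (Submodule.smul_mem _ _ ?_)) (Submodule.smul_mem _ _ ?_)
    · convert ih (insertLeft_mem (ha 0) hf) (Fin.tail e) (Fin.tail a) (fun k => ha k.succ) using 2
      rw [Fin.sum_univ_succ]
      ext <;> simp [Fin.tail] <;> ring
    · convert insertLeft_mem (S.d_mem _ _ _ (ha 0)) hf n (Fin.tail e) (Fin.tail a)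
        (fun k => ha k.succ) using 2
      rw [Fin.sum_univ_succ]
      ext <;> simp [Fin.tail] <;> ring
    · convert firstMul_mem (ha 0) hf n (Fin.tail e) (Fin.tail a) (fun k => ha k.succ) using 2
      rw [Fin.sum_univ_succ]
      ext <;> simp [Fin.tail] <;> ring

theorem hochschildDiff_mem {p q : ℤ} {f : HochschildFamily 𝕜 A} (hf : f ∈ S.cochains p q) :
    S.hochschildDiff p f ∈ S.cochains (p + 1) q := by
  rw [hochschildDiff_eq]
  refine add_mem (fun n e a ha => reducedD_mem n hf e a ha) fun n e a ha => ?_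
  cases n with
  | zero => exact zero_mem _
  | succ n =>
    rw [apply_succ_eq_insertLeft, insertLeft_leftPart S (ha 0)]
    refine Submodule.smul_mem _ _ ?_
    convert lmul_mem (ha 0) hf n (Fin.tail e) (Fin.tail a) (fun k => ha k.succ) using 2
    rw [Fin.sum_univ_succ]
    ext <;> simp [Fin.tail] <;> ring

theorem hochschildDiff_mem_cocycles {p q : ℤ} {f : HochschildFamily 𝕜 A}
    (hf : f ∈ S.cochains p q) : S.hochschildDiff p f ∈ S.cocycles (p + 1) q :=
  ⟨hochschildDiff_mem hf, hochschildDiff_hochschildDiff hf⟩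

theorem add_hochschildDiff_mem_cocycles {q : ℤ} {f g : HochschildFamily 𝕜 A}
    (hf : f ∈ S.cocycles 2 q) (hg : g ∈ S.cochains 1 q) :
    f + S.hochschildDiff 1 g ∈ S.cocycles 2 q := by
  have h := hochschildDiff_mem_cocycles hg
  rw [one_add_one_eq_two] at h
  exact add_mem hf h

end DiffBigradedAlgebra

/-! ### Graded derivations of path algebras -/

namespace PathAlgebra

variable {𝕜 : Type*} [Field 𝕜] {V : Type*} [Quiver V]

/-- A derivation of a path algebra shifts weights by `m` if its values on arrows do. -/
theorem deriv_mem_add {ι : Type*} [AddCommMonoid ι] (w : ∀ i j : V, (i ⟶ j) → ℤ × ℤ)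
    (w' : ∀ i j : V, (i ⟶ j) → ι) {δ : ∀ i j : V, (i ⟶ j) → PathAlgebra 𝕜 V} {m : ι}
    (hδ : ∀ (i j : V) (a : i ⟶ j), δ i j a ∈ weightPart 𝕜 w' (w' i j a + m)) {n : ι}
    {x : PathAlgebra 𝕜 V} (hx : x ∈ weightPart 𝕜 w' n) :
    deriv w δ x ∈ weightPart 𝕜 w' (n + m) := by
  induction hx using Submodule.span_induction with
  | zero => rw [map_zero]; exact zero_mem _
  | add a b _ _ ha hb => rw [map_add]; exact add_mem ha hb
  | smul c a _ ha => rw [map_smul]; exact Submodule.smul_mem _ _ ha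
  | mem a ha =>
    obtain ⟨i, j, p, rfl, rfl⟩ := ha
    rw [deriv_ofPath]
    induction p with
    | nil => exact zero_mem _
    | cons p a ih =>
      refine add_mem ?_ (Submodule.smul_mem _ _ ?_)
      · have := weightPart_mul_mem w' _ _ _ _ ih (ofArrow_mem w' a)
        rwa [add_right_comm] at this
      · have := weightPart_mul_mem w' _ _ _ _ (ofPath_mem (𝕜 := 𝕜) w' p) (hδ _ _ a)
        rwa [← add_assoc] at this

/-- A linear map that satisfies the graded Leibniz rule is determined by its values on idempotents
and arrows. -/
theorem eq_deriv (w : ∀ i j : V, (i ⟶ j) → ℤ × ℤ) (δ : ∀ i j : V, (i ⟶ j) → PathAlgebra 𝕜 V)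
    (D : PathAlgebra 𝕜 V →ₗ[𝕜] PathAlgebra 𝕜 V)
    (hD : ∀ {i j k : V} (p : Quiver.Path i j) (a : j ⟶ k), D (ofPath 𝕜 p * ofArrow 𝕜 a) =
      D (ofPath 𝕜 p) * ofArrow 𝕜 a + (-1 : 𝕜) ^ (pathWeight w p).1 • (ofPath 𝕜 p * D (ofArrow 𝕜 a)))
    (h0 : ∀ i : V, D (idem 𝕜 i) = 0) (h1 : ∀ {i j : V} (a : i ⟶ j), D (ofArrow 𝕜 a) = δ i j a) :
    D = deriv w δ := by
  refine hom_ext 𝕜 fun i j p => ?_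
  rw [deriv_ofPath]
  induction p with
  | nil => exact h0 _
  | cons p a ih => rw [ofPath_cons, hD, ih, h1, pathDeriv]

/-- An ungraded derivation of a path algebra. -/
theorem deriv_zero_mul [Fintype V] {δ : ∀ i j : V, (i ⟶ j) → PathAlgebra 𝕜 V}
    (hr : ∀ (i j : V) (a : i ⟶ j), δ i j a * idem 𝕜 j = δ i j a) (x y : PathAlgebra 𝕜 V) :
    deriv 0 δ (x * y) = deriv 0 δ x * y + x * deriv 0 δ y := by
  have h : ∀ {i j : V} (p : Quiver.Path i j),
      pathWeight (0 : ∀ i j : V, (i ⟶ j) → ℤ × ℤ) p = 0 := fun p => by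
    induction p with
    | nil => rfl
    | cons p a ih => simp [pathWeight, ih]
  have hx : x ∈ weightPart 𝕜 (0 : ∀ i j : V, (i ⟶ j) → ℤ × ℤ) 0 := by
    refine induction 𝕜 (P := fun x => x ∈ weightPart 𝕜 (0 : ∀ i j : V, (i ⟶ j) → ℤ × ℤ) 0) x
      (zero_mem _) (fun _ _ => add_mem) fun c i j p => Submodule.smul_mem _ _ ?_
    exact h p ▸ ofPath_mem _ p
  simpa using deriv_mul 0 δ hr 0 x y hx

end PathAlgebra

/-! ### Odd derivations supported on the loops -/

namespace Ginzburg

open PathAlgebra HochschildFamily DiffBigradedAlgebra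

variable {𝕜 : Type*} [Field 𝕜] {V : Type*} [Quiver V]

theorem pathWeight_fst_nonpos {i j : GinzburgQuiver V} (p : Quiver.Path i j) :
    (pathWeight (weight V) p).1 ≤ 0 := by
  induction p with
  | nil => exact le_rfl
  | cons p a ih =>
    have : (weight V _ _ a).1 ≤ 0 := by
      match a with
      | .arrow _ => exact le_rfl
      | .star _ => exact le_rfl
      | .loop _ => exact (by decide : (-1 : ℤ) ≤ 0)
    exact add_nonpos ih this

/-- The Ginzburg dg algebra is concentrated in nonpositive cohomological degrees. -/
theorem eq_zero_of_mem_weightPart {r s : ℤ} (hr : 0 < r) {x : PathAlgebra 𝕜 (GinzburgQuiver V)}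
    (hx : x ∈ weightPart 𝕜 (weight V) (r, s)) : x = 0 := by
  induction hx using Submodule.span_induction with
  | zero => rfl
  | add a b _ _ ha hb => rw [ha, hb, add_zero]
  | smul c a _ ha => rw [ha, smul_zero]
  | mem a ha =>
    obtain ⟨i, j, p, hp, rfl⟩ := ha
    have := pathWeight_fst_nonpos p
    rw [hp] at this
    exact absurd hr this.not_gt

/-- The values on arrows of the derivation that vanishes on the arrows of the double quiver and maps
`tᵢ` to `eᵢ y eᵢ`. -/
noncomputable def loopValue [Fintype V] (y : PathAlgebra 𝕜 (GinzburgQuiver V)) :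
    ∀ i j : GinzburgQuiver V, (i ⟶ j) → PathAlgebra 𝕜 (GinzburgQuiver V)
  | _, _, .arrow _ => 0
  | _, _, .star _ => 0
  | _, _, .loop i => vertex 𝕜 i * y * vertex 𝕜 i

variable [Fintype V]

theorem loopValue_mul_idem (y : PathAlgebra 𝕜 (GinzburgQuiver V)) (i j : GinzburgQuiver V)
    (a : i ⟶ j) : loopValue y i j a * idem 𝕜 j = loopValue y i j a := by
  match i, j, a with
  | _, _, .arrow _ => exact zero_mul _
  | _, _, .star _ => exact zero_mul _
  | _, _, .loop i =>
    change vertex 𝕜 i * y * vertex 𝕜 i * vertex 𝕜 i = vertex 𝕜 i * y * vertex 𝕜 i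
    rw [mul_assoc, vertex_mul_vertex]

theorem idem_mul_loopValue (y : PathAlgebra 𝕜 (GinzburgQuiver V)) (i j : GinzburgQuiver V)
    (a : i ⟶ j) : idem 𝕜 i * loopValue y i j a = loopValue y i j a := by
  match i, j, a with
  | _, _, .arrow _ => exact mul_zero _
  | _, _, .star _ => exact mul_zero _
  | _, _, .loop i =>
    change vertex 𝕜 i * (vertex 𝕜 i * y * vertex 𝕜 i) = vertex 𝕜 i * y * vertex 𝕜 i
    rw [← mul_assoc, ← mul_assoc, vertex_mul_vertex]

theorem loopValue_mem {q : ℤ} {y : PathAlgebra 𝕜 (GinzburgQuiver V)}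
    (hy : y ∈ weightPart 𝕜 (weight V) (0, q + 2)) (i j : GinzburgQuiver V) (a : i ⟶ j) :
    loopValue y i j a ∈ weightPart 𝕜 (weight V) (weight V i j a + (1, q)) := by
  match i, j, a with
  | _, _, .arrow _ => exact zero_mem _
  | _, _, .star _ => exact zero_mem _
  | _, _, .loop i =>
    have h := weightPart_mul_mem (weight V) _ _ _ _
      (weightPart_mul_mem (weight V) _ _ _ _ (vertex_mem 𝕜 i) hy) (vertex_mem 𝕜 i)
    rw [zero_add, add_zero] at h
    have e : weight V i i (GinzburgArrow.loop i) + (1, q) = (0, q + 2) := by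
      ext
      · rfl
      · exact add_comm 2 q
    rwa [← e] at h

/-- The odd derivation of the Ginzburg dg algebra that vanishes on the arrows of the double quiver
and maps `tᵢ` to `eᵢ y eᵢ`, as a linear function of `y`. -/
noncomputable def loopDeriv : PathAlgebra 𝕜 (GinzburgQuiver V) →ₗ[𝕜]
    PathAlgebra 𝕜 (GinzburgQuiver V) →ₗ[𝕜] PathAlgebra 𝕜 (GinzburgQuiver V) where
  toFun y := deriv (weight V) (loopValue y)
  map_add' x y := by
    refine hom_ext 𝕜 fun i j p => ?_
    rw [LinearMap.add_apply, deriv_ofPath, deriv_ofPath, deriv_ofPath]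
    induction p with
    | nil => exact (add_zero 0).symm
    | cons p a ih =>
      have h : loopValue (x + y) _ _ a = loopValue x _ _ a + loopValue y _ _ a := by
        match a with
        | .arrow _ => exact (add_zero 0).symm
        | .star _ => exact (add_zero 0).symm
        | .loop i => simp only [loopValue, mul_add, add_mul]
      simp only [pathDeriv, ih, h, mul_add, add_mul, smul_add]
      abel
  map_smul' c x := by
    refine hom_ext 𝕜 fun i j p => ?_
    rw [LinearMap.smul_apply, deriv_ofPath, deriv_ofPath]
    induction p with
    | nil => exact (smul_zero c).symm
    | cons p a ih =>
      have h : loopValue (c • x) _ _ a = c • loopValue x _ _ a := by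
        match a with
        | .arrow _ => exact (smul_zero c).symm
        | .star _ => exact (smul_zero c).symm
        | .loop i => simp only [loopValue, mul_smul_comm, smul_mul_assoc]
      simp only [pathDeriv, ih, h, mul_smul_comm, smul_mul_assoc, smul_add, smul_comm _ c,
        RingHom.id_apply]

theorem loopDeriv_ofArrow (y : PathAlgebra 𝕜 (GinzburgQuiver V)) {i j : GinzburgQuiver V}
    (a : i ⟶ j) : loopDeriv y (ofArrow 𝕜 a) = loopValue y i j a :=
  deriv_ofArrow _ _ (idem_mul_loopValue y) a

theorem loopDeriv_idem (y : PathAlgebra 𝕜 (GinzburgQuiver V)) (i : GinzburgQuiver V) :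
    loopDeriv y (idem 𝕜 i) = 0 :=
  deriv_idem _ _ i

theorem loopDeriv_mul (y : PathAlgebra 𝕜 (GinzburgQuiver V)) {n : ℤ × ℤ}
    {x : PathAlgebra 𝕜 (GinzburgQuiver V)} (hx : x ∈ weightPart 𝕜 (weight V) n)
    (z : PathAlgebra 𝕜 (GinzburgQuiver V)) :
    loopDeriv y (x * z) = loopDeriv y x * z + (-1 : 𝕜) ^ n.1 • (x * loopDeriv y z) :=
  deriv_mul _ _ (loopValue_mul_idem y) n x z hx

theorem loopDeriv_mem {q : ℤ} {y : PathAlgebra 𝕜 (GinzburgQuiver V)}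
    (hy : y ∈ weightPart 𝕜 (weight V) (0, q + 2)) {n : ℤ × ℤ}
    {x : PathAlgebra 𝕜 (GinzburgQuiver V)} (hx : x ∈ weightPart 𝕜 (weight V) n) :
    loopDeriv y x ∈ weightPart 𝕜 (weight V) (n + (1, q)) :=
  deriv_mem_add _ _ (loopValue_mem hy) hx

/-- Elements of cohomological degree zero do not involve the loops, hence are annihilated by
`loopDeriv y`. -/
theorem loopDeriv_eq_zero (y : PathAlgebra 𝕜 (GinzburgQuiver V)) {s : ℤ}
    {x : PathAlgebra 𝕜 (GinzburgQuiver V)} (hx : x ∈ weightPart 𝕜 (weight V) (0, s)) :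
    loopDeriv y x = 0 := by
  have h : ∀ {i j : GinzburgQuiver V} (p : Quiver.Path i j), (pathWeight (weight V) p).1 = 0 →
      loopDeriv y (ofPath 𝕜 p) = 0 := fun p hp => by
    induction p with
    | nil => exact loopDeriv_idem y _
    | cons p a ih =>
      have h1 := pathWeight_fst_nonpos p
      have h2 := pathWeight_fst_nonpos a.toPath
      have h3 : (pathWeight (weight V) a.toPath) = weight V _ _ a := zero_add _
      have h4 : (pathWeight (weight V) (p.cons a)).1 =
        (pathWeight (weight V) p).1 + (weight V _ _ a).1 := rfl
      rw [h3] at h2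
      have h5 : loopValue y _ _ a = 0 := by
        match a with
        | .arrow _ => rfl
        | .star _ => rfl
        | .loop i =>
          change (_ : ℤ) = _ + -1 at h4
          omega
      rw [ofPath_cons, loopDeriv_mul y (ofPath_mem _ p), ih (by omega), loopDeriv_ofArrow, h5,
        zero_mul, mul_zero, smul_zero, add_zero]
  induction hx using Submodule.span_induction with
  | zero => exact map_zero _
  | add a b _ _ ha hb => rw [map_add, ha, hb, add_zero]
  | smul c a _ ha => rw [map_smul, ha, smul_zero]
  | mem a ha =>
    obtain ⟨i, j, p, hp, rfl⟩ := ha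
    exact h p (by rw [hp])

variable [∀ i j : V, Fintype (i ⟶ j)]

theorem d_eq_loopDeriv : (dgAlgebra 𝕜 V).d = loopDeriv (rho 𝕜 V) := by
  refine eq_deriv _ _ _ (fun p a => (dgAlgebra 𝕜 V).leibniz _ (pathWeight (weight V) p).2 _ _
    (ofPath_mem (weight V) p)) d_idem fun a => ?_
  rw [d_ofArrow]
  match a with
  | .arrow _ => rfl
  | .star _ => rfl
  | .loop i => rfl

/-- For `y` of cohomological degree zero, `loopDeriv y` anticommutes with the differential. -/
theorem d_loopDeriv_add {s : ℤ} {y : PathAlgebra 𝕜 (GinzburgQuiver V)}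
    (hy : y ∈ weightPart 𝕜 (weight V) (0, s + 2)) (x : PathAlgebra 𝕜 (GinzburgQuiver V)) :
    (dgAlgebra 𝕜 V).d (loopDeriv y x) + loopDeriv y ((dgAlgebra 𝕜 V).d x) = 0 := by
  have hr : rho 𝕜 V ∈ weightPart 𝕜 (weight V) (0, 0 + 2) := rho_mem 𝕜 V
  have h0 : ∀ {y z : PathAlgebra 𝕜 (GinzburgQuiver V)} {t : ℤ},
      y ∈ weightPart 𝕜 (weight V) (0, t + 2) → ∀ {i j : GinzburgQuiver V} (a : i ⟶ j),
      loopDeriv z (loopValue y i j a) = 0 := fun {y z t} hy i j a => by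
    match i, j, a with
    | _, _, .arrow _ => exact map_zero _
    | _, _, .star _ => exact map_zero _
    | _, _, .loop i =>
      have h := loopValue_mem hy i i (GinzburgArrow.loop i)
      exact loopDeriv_eq_zero (s := 2 + t) z h
  rw [d_eq_loopDeriv]
  suffices h : loopDeriv (rho 𝕜 V) ∘ₗ loopDeriv y + loopDeriv y ∘ₗ loopDeriv (rho 𝕜 V) = 0 from
    LinearMap.congr_fun h x
  refine hom_ext 𝕜 fun i j p => ?_
  simp only [LinearMap.add_apply, LinearMap.comp_apply, LinearMap.zero_apply]
  induction p with
  | nil =>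
    have h := fun y => loopDeriv_idem (𝕜 := 𝕜) (V := V) y i
    simp only [idem] at h
    rw [h, h, map_zero, map_zero, add_zero]
  | cons p a ih =>
    have hp := ofPath_mem (𝕜 := 𝕜) (weight V) p
    rw [ofPath_cons, loopDeriv_mul _ hp, loopDeriv_mul _ hp, map_add, map_add, map_smul, map_smul,
      loopDeriv_mul _ (loopDeriv_mem hr hp), loopDeriv_mul _ (loopDeriv_mem hy hp),
      loopDeriv_mul _ hp, loopDeriv_mul _ hp, loopDeriv_ofArrow, loopDeriv_ofArrow, h0 hy, h0 hr,
      eq_neg_of_add_eq_zero_left ih]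
    simp only [Prod.fst_add, zpow_add₀ (neg_ne_zero.mpr (one_ne_zero (α := 𝕜))), zpow_one,
      mul_neg_one, neg_smul, mul_zero, smul_zero, add_zero, neg_mul]
    abel

theorem ofLinear_loopDeriv_mem {q : ℤ} {y : PathAlgebra 𝕜 (GinzburgQuiver V)}
    (hy : y ∈ weightPart 𝕜 (weight V) (0, q + 2)) :
    ofLinear (loopDeriv y) ∈ (dgAlgebra 𝕜 V).cocycles 2 q := by
  refine ⟨ofLinear_mem fun r s x hx => ?_, hochschildDiff_two_ofLinear (fun r s x z hx => ?_)
    (d_loopDeriv_add hy)⟩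
  · have h := loopDeriv_mem (n := (r, s)) hy hx
    rwa [Prod.mk_add_mk, show r + 1 = 2 + r - 1 by ring, add_comm s] at h
  · exact loopDeriv_mul y hx z

/-! ### The normal form of cocycles of degree two -/

/-- The differentials of the loops are sums of products `α α*` and `α* α`. -/
theorem arrowD_mem_vanishingProducts {f : HochschildFamily 𝕜 (PathAlgebra 𝕜 (GinzburgQuiver V))}
    (hf : ∀ i j (a : i ⟶ j), (weight V i j a).1 = 0 →
      ∀ v, insertLeft v (insertLeft (ofArrow 𝕜 a) f) = 0) (i j : GinzburgQuiver V) (a : i ⟶ j) :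
    arrowD 𝕜 V i j a ∈ vanishingProducts f := by
  match i, j, a with
  | _, _, .arrow _ => exact zero_mem _
  | _, _, .star _ => exact zero_mem _
  | _, _, .loop k =>
    have h : ∀ {i j l m : GinzburgQuiver V} (a : i ⟶ j) (b : l ⟶ m), (weight V _ _ a).1 = 0 →
        (weight V _ _ b).1 = 0 → arrowD 𝕜 V _ _ a = 0 →
        vertex 𝕜 k * (ofArrow 𝕜 a * ofArrow 𝕜 b) * vertex 𝕜 k ∈ vanishingProducts f :=
      fun {i j l m} a b ha hb hd => by
        by_cases hi : k = i
        · by_cases hj : m = k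
          · have ha' : vertex 𝕜 k * ofArrow 𝕜 a = ofArrow 𝕜 a := by
              rw [hi]
              exact idem_mul_ofArrow a
            have hb' : ofArrow 𝕜 b * vertex 𝕜 k = ofArrow 𝕜 b := by
              rw [← hj]
              exact ofArrow_mul_idem b
            rw [mul_assoc, mul_assoc, hb', ← mul_assoc, ha']
            exact Submodule.subset_span ⟨_, _, _, _, a, b, ha, (d_ofArrow a).trans hd,
              hf _ _ a ha, hf _ _ b hb, rfl⟩
          · have h0 : ofArrow 𝕜 b * vertex 𝕜 k = 0 :=
              ofArrow_mul_idem_of_ne (V := GinzburgQuiver V) hj b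
            rw [mul_assoc, mul_assoc, h0, mul_zero, mul_zero]
            exact zero_mem _
        · have h0 : vertex 𝕜 k * ofArrow 𝕜 a = 0 :=
            idem_mul_ofArrow_of_ne (V := GinzburgQuiver V) hi a
          rw [← mul_assoc, h0, zero_mul, zero_mul]
          exact zero_mem _
    simp only [arrowD, rho, Finset.mul_sum, Finset.sum_mul, mul_sub, sub_mul]
    refine sum_mem fun i _ => sum_mem fun j _ => sum_mem fun α _ => sub_mem ?_ ?_
    · exact h (GinzburgArrow.arrow α) (GinzburgArrow.star α) rfl rfl rfl
    · exact h (GinzburgArrow.star α) (GinzburgArrow.arrow α) rfl rfl rfl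

/-- If a cocycle of degree two vanishes whenever the first argument is an idempotent, and whenever
there are at least two arguments the first of which is an arrow, then it is concentrated in at most
one argument. -/
theorem insertLeft_insertLeft_eq_zero {f : HochschildFamily 𝕜 (PathAlgebra 𝕜 (GinzburgQuiver V))}
    (hc : (dgAlgebra 𝕜 V).hochschildDiff 2 f = 0) (h1 : ∀ i, insertLeft (idem 𝕜 i) f = 0)
    (hf : ∀ i j (a : i ⟶ j) v, insertLeft v (insertLeft (ofArrow 𝕜 a) f) = 0)
    (x v : PathAlgebra 𝕜 (GinzburgQuiver V)) : insertLeft v (insertLeft x f) = 0 := by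
  have h2 : ∀ {i j : GinzburgQuiver V} (a : i ⟶ j) (x v : PathAlgebra 𝕜 (GinzburgQuiver V)),
      insertLeft v (insertLeft (ofArrow 𝕜 a * x) f) =
        (-1 : 𝕜) ^ (weight V i j a).1 • lmul (ofArrow 𝕜 a) (insertLeft v (insertLeft x f)) :=
    fun {i j} a x v => by
      have h := congrArg (insertLeft v) (cocycle_insertLeft hc (gr_ofArrow a) x)
      rw [d_ofArrow, map_sub, map_add, map_add,
        insertLeft_insertLeft_reducedD_eq_zero (hf i j a),
        insertLeft_insertLeft_of_mem_vanishingProducts hc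
          (arrowD_mem_vanishingProducts (fun i j a _ => hf i j a) i j a), map_zero, zero_add,
        zero_add, map_smul, sub_eq_zero, insertLeft_lmul] at h
      rw [h, neg_one_zpow_smul_smul]
  have h3 : ∀ {i j : GinzburgQuiver V} (p : Quiver.Path i j)
      (x : PathAlgebra 𝕜 (GinzburgQuiver V)), (∀ v, insertLeft v (insertLeft x f) = 0) →
      ∀ v, insertLeft v (insertLeft (ofPath 𝕜 p * x) f) = 0 := fun p => by
    induction p with
    | nil =>
      intro x hx v
      change insertLeft v (insertLeft (idem 𝕜 _ * x) f) = 0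
      rw [insertLeft_idem_mul hc h1, insertLeft_lmul, hx, map_zero]
    | cons p a ih =>
      intro x hx v
      rw [ofPath_cons, mul_assoc]
      exact ih _ (fun v => by rw [h2, hx, map_zero, smul_zero]) v
  refine induction 𝕜 (P := fun x => insertLeft v (insertLeft x f) = 0) x (by simp)
    (fun x y hx hy => by simp [hx, hy]) fun c i j p => ?_
  rw [← ofPath_mul_idem p, map_smul, LinearMap.smul_apply, map_smul, h3 p _ (fun v => by simp [h1]),
    smul_zero]

/-- Every cocycle of degree two is cohomologous to one with at most one argument. -/
theorem exists_insertLeft_insertLeft_eq_zero {q : ℤ}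
    {f : HochschildFamily 𝕜 (PathAlgebra 𝕜 (GinzburgQuiver V))}
    (hf : f ∈ (dgAlgebra 𝕜 V).cocycles 2 q) :
    ∃ g ∈ (dgAlgebra 𝕜 V).cochains 1 q,
      ∀ x v, insertLeft v (insertLeft x (f + (dgAlgebra 𝕜 V).hochschildDiff 1 g)) = 0 := by
  classical
  -- first remove the idempotents from the first argument
  obtain ⟨g₁, hg₁, h₁⟩ := exists_insertLeft_idempotent_eq_zero
    (S := dgAlgebra 𝕜 V) (e := fun i : GinzburgQuiver V => idem 𝕜 i) gr_idem d_idem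
    (fun i j => by
      split_ifs with h
      · rw [h, idem_mul_idem]
      · exact idem_mul_idem_of_ne h) rfl hf.1 hf.2
  have hf₁ := add_hochschildDiff_mem_cocycles hf hg₁
  -- then the arrows of the double quiver, whose differentials vanish
  obtain ⟨g₂, hg₂, h₂, h₂'⟩ := exists_insertLeft_ofArrow_eq_zero hf₁.1 hf₁.2 h₁
    (fun i j a => (weight V i j a).1 = 0) (fun i j a ha => by
      match i, j, a with
      | _, _, .arrow _ => exact zero_mem _
      | _, _, .star _ => exact zero_mem _
      | _, _, .loop _ => exact absurd ha (by decide : (-1 : ℤ) ≠ 0))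
  rw [sub_eq_add_neg, ← map_neg, add_assoc, ← map_add] at h₂ h₂'
  have hg₂' := add_mem hg₁ (neg_mem hg₂)
  have hf₂ := add_hochschildDiff_mem_cocycles hf hg₂'
  -- then all arrows, as the differentials of the loops only involve the double quiver
  obtain ⟨g₃, hg₃, h₃, h₃'⟩ := exists_insertLeft_ofArrow_eq_zero hf₂.1 hf₂.2 h₂
    (fun _ _ _ => True) (fun i j a _ => arrowD_mem_vanishingProducts h₂' i j a)
  rw [sub_eq_add_neg, ← map_neg, add_assoc, ← map_add] at h₃ h₃'
  have hg₃' := add_mem hg₂' (neg_mem hg₃)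
  have hf₃ := add_hochschildDiff_mem_cocycles hf hg₃'
  exact ⟨_, hg₃', insertLeft_insertLeft_eq_zero hf₃.2 h₃ fun i j a => h₃' i j a trivial⟩

/-- Every cocycle of degree two is cohomologous to the derivation `loopDeriv y` for some `y`. -/
theorem exists_add_hochschildDiff_eq_ofLinear_loopDeriv {q : ℤ}
    {f : HochschildFamily 𝕜 (PathAlgebra 𝕜 (GinzburgQuiver V))}
    (hf : f ∈ (dgAlgebra 𝕜 V).cocycles 2 q) :
    ∃ g ∈ (dgAlgebra 𝕜 V).cochains 1 q, ∃ y ∈ weightPart 𝕜 (weight V) (0, q + 2),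
      f + (dgAlgebra 𝕜 V).hochschildDiff 1 g = ofLinear (loopDeriv y) := by
  obtain ⟨g, hg, h⟩ := exists_insertLeft_insertLeft_eq_zero hf
  refine ⟨g, hg, ?_⟩
  have hf' := add_hochschildDiff_mem_cocycles hf hg
  generalize f + (dgAlgebra 𝕜 V).hochschildDiff 1 g = f' at h hf' ⊢
  have h0 : ∀ b, f' 0 b = 0 := fun b => by
    have h2 : f' 0 b ∈ (dgAlgebra 𝕜 V).gr (2, q) := by
      simpa using hf'.1 0 Fin.elim0 b (fun k => k.elim0)
    exact eq_zero_of_mem_weightPart (r := 2) (s := q) two_pos h2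
  obtain ⟨D, rfl, hD⟩ := exists_eq_ofLinear h0 h
  have hD1 : ∀ r s x, x ∈ weightPart 𝕜 (weight V) (r, s) →
      D x ∈ weightPart 𝕜 (weight V) (r + 1, s + q) := fun r s x hx => by
    have h2 := hf'.1 1 (fun _ => (r, s)) (Fin.cons x Fin.elim0) (fun k => by
      rw [Subsingleton.elim k 0]
      exact hx)
    rw [← hD] at h2
    have h3 : D x ∈ (dgAlgebra 𝕜 V).gr (r + 1, s + q) := by
      convert h2 using 2
      ext <;> simp
    exact h3
  have hm : ∀ r s x, x ∈ weightPart 𝕜 (weight V) (r, s) → ∀ z,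
      D (x * z) = D x * z + (-1 : 𝕜) ^ r • (x * D z) := fun r s x hx z =>
    map_mul_of_hochschildDiff_two_ofLinear hf'.2 hx z
  have hi : ∀ i : GinzburgQuiver V, D (idem 𝕜 i) = 0 := fun i =>
    eq_zero_of_mem_weightPart (r := 0 + 1) (s := 0 + q) one_pos (hD1 0 0 _ (gr_idem i))
  have ht : ∀ {i j : GinzburgQuiver V} (a : i ⟶ j),
      idem 𝕜 i * D (ofArrow 𝕜 a) * idem 𝕜 j = D (ofArrow 𝕜 a) := fun {i j} a => by
    have h1 := hm 0 0 _ (gr_idem i) (ofArrow 𝕜 a)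
    have h2 := hm _ _ _ (gr_ofArrow a) (idem 𝕜 j)
    rw [idem_mul_ofArrow, hi, zero_mul, zero_add, zpow_zero, one_smul] at h1
    rw [ofArrow_mul_idem, hi, mul_zero, smul_zero, add_zero] at h2
    rw [← h1, ← h2]
  -- `D tᵢ` lies in the block of `eᵢ`, so that the values on loops can be combined into one element
  refine ⟨∑ i : V, D (ofArrow 𝕜 (V := GinzburgQuiver V) (GinzburgArrow.loop i)),
    sum_mem fun i _ => ?_, congrArg ofLinear (eq_deriv _ _ D (fun p a =>
      hm _ (pathWeight (weight V) p).2 _ (ofPath_mem (weight V) p) _) hi fun {i j} a => ?_)⟩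
  · have h2 := hD1 (-1) 2 _ (gr_ofArrow (V := V) (GinzburgArrow.loop i))
    rwa [neg_add_cancel, add_comm 2] at h2
  · match i, j, a with
    | _, _, .arrow α =>
      exact eq_zero_of_mem_weightPart (r := 0 + 1) (s := 1 + q) one_pos
        (hD1 0 1 _ (gr_ofArrow (V := V) (GinzburgArrow.arrow α)))
    | _, _, .star α =>
      exact eq_zero_of_mem_weightPart (r := 0 + 1) (s := 1 + q) one_pos
        (hD1 0 1 _ (gr_ofArrow (V := V) (GinzburgArrow.star α)))
    | _, _, .loop k =>
      change _ = vertex 𝕜 k * _ * vertex 𝕜 k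
      rw [Finset.mul_sum, Finset.sum_mul, Finset.sum_eq_single k]
      · exact (ht _).symm
      · intro i _ hik
        have h0 : vertex 𝕜 k * vertex 𝕜 i = 0 :=
          idem_mul_idem_of_ne (V := GinzburgQuiver V) hik.symm
        have h1 := ht (i := i) (j := i) (GinzburgArrow.loop i)
        refine (congrArg (fun z => vertex 𝕜 k * z * vertex 𝕜 k) h1.symm).trans ?_
        change vertex 𝕜 k * (vertex 𝕜 i * _ * _) * _ = 0
        rw [← mul_assoc, ← mul_assoc, h0, zero_mul, zero_mul, zero_mul]
      · exact fun h => absurd (Finset.mem_univ k) h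

end Ginzburg

/-! ### Homomorphisms out of path algebras -/

namespace PathAlgebra

section lift

variable {𝕜 : Type*} [Field 𝕜] {V : Type*} [Quiver V] {A : Type*} [Ring A] [Algebra 𝕜 A]

/-- The product of the images of the arrows of a path, for given images `e` of the idempotents and
`φ` of the arrows. -/
def pathLift (e : V → A) (φ : ∀ i j : V, (i ⟶ j) → A) {i : V} : ∀ {j : V}, Quiver.Path i j → A
  | _, .nil => e i
  | _, .cons p a => pathLift e φ p * φ _ _ a

variable (𝕜) in
/-- The linear map on the path algebra determined by images `e` of the idempotents and `φ` of the
arrows; it is multiplicative if these are compatible, see `lift_mul`. -/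
noncomputable def lift (e : V → A) (φ : ∀ i j : V, (i ⟶ j) → A) : PathAlgebra 𝕜 V →ₗ[𝕜] A :=
  (basis 𝕜).constr 𝕜 fun x => pathLift e φ x.2.2

variable {e : V → A} {φ : ∀ i j : V, (i ⟶ j) → A}

theorem lift_ofPath {i j : V} (p : Quiver.Path i j) :
    lift 𝕜 e φ (ofPath 𝕜 p) = pathLift e φ p := by
  simp [lift, ofPath]

theorem lift_idem (i : V) : lift 𝕜 e φ (idem 𝕜 i) = e i := lift_ofPath _

theorem lift_ofArrow (hl : ∀ i j a, e i * φ i j a = φ i j a) {i j : V} (a : i ⟶ j) :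
    lift 𝕜 e φ (ofArrow 𝕜 a) = φ i j a := (lift_ofPath _).trans (hl _ _ a)

theorem mul_pathLift (he : ∀ i, e i * e i = e i) {i j : V} (p : Quiver.Path i j) :
    e i * pathLift e φ p = pathLift e φ p := by
  induction p with
  | nil => exact he i
  | cons p a ih => rw [pathLift, ← mul_assoc, ih]

theorem pathLift_mul (he : ∀ i, e i * e i = e i) (hr : ∀ i j a, φ i j a * e j = φ i j a) {i j : V}
    (p : Quiver.Path i j) : pathLift e φ p * e j = pathLift e φ p := by
  cases p with
  | nil => exact he i
  | cons p a => rw [pathLift, mul_assoc, hr]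

theorem pathLift_comp (he : ∀ i, e i * e i = e i) (hr : ∀ i j a, φ i j a * e j = φ i j a)
    {i j k : V} (p : Quiver.Path i j) (q : Quiver.Path j k) :
    pathLift e φ (p.comp q) = pathLift e φ p * pathLift e φ q := by
  induction q with
  | nil => exact (pathLift_mul he hr p).symm
  | cons q a ih => simp only [Quiver.Path.comp_cons, pathLift, ih, mul_assoc]

theorem lift_mul [Fintype V] (he : ∀ i, e i * e i = e i) (hne : ∀ i j, i ≠ j → e i * e j = 0)
    (hr : ∀ i j a, φ i j a * e j = φ i j a) (x y : PathAlgebra 𝕜 V) :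
    lift 𝕜 e φ (x * y) = lift 𝕜 e φ x * lift 𝕜 e φ y := by
  refine induction 𝕜 (P := fun x => lift 𝕜 e φ (x * y) = lift 𝕜 e φ x * lift 𝕜 e φ y) x (by simp)
    (fun a b ha hb => by simp only [add_mul, map_add, ha, hb]) fun c i j p => ?_
  simp only [smul_mul_assoc, map_smul]
  congr 1
  refine induction 𝕜 (P := fun y => lift 𝕜 e φ (ofPath 𝕜 p * y) =
    lift 𝕜 e φ (ofPath 𝕜 p) * lift 𝕜 e φ y) y (by simp)
    (fun a b ha hb => by simp only [mul_add, map_add, ha, hb]) fun c k l q => ?_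
  simp only [mul_smul_comm, map_smul]
  congr 1
  simp only [lift_ofPath]
  by_cases h : j = k
  · subst h
    rw [ofPath_mul_ofPath, lift_ofPath, pathLift_comp he hr]
  · rw [ofPath_mul_ofPath_of_ne 𝕜 h, map_zero, ← pathLift_mul he hr p, ← mul_pathLift he q,
      mul_assoc, ← mul_assoc (e j), hne _ _ h, zero_mul, mul_zero]

theorem lift_mem {V' : Type*} [Quiver V'] [Fintype V'] {ι κ : Type*} [AddMonoid ι] [AddMonoid κ]
    (w : ∀ i j : V, (i ⟶ j) → ι) (w' : ∀ i j : V', (i ⟶ j) → κ) (h : ι →+ κ)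
    {e : V → PathAlgebra 𝕜 V'} {φ : ∀ i j : V, (i ⟶ j) → PathAlgebra 𝕜 V'}
    (he : ∀ i, e i ∈ weightPart 𝕜 w' 0) (hφ : ∀ i j a, φ i j a ∈ weightPart 𝕜 w' (h (w i j a)))
    {n : ι} {x : PathAlgebra 𝕜 V} (hx : x ∈ weightPart 𝕜 w n) :
    lift 𝕜 e φ x ∈ weightPart 𝕜 w' (h n) := by
  induction hx using Submodule.span_induction with
  | zero => rw [map_zero]; exact zero_mem _
  | add a b _ _ ha hb => rw [map_add]; exact add_mem ha hb
  | smul c a _ ha => rw [map_smul]; exact Submodule.smul_mem _ _ ha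
  | mem a ha =>
    obtain ⟨i, j, p, rfl, rfl⟩ := ha
    rw [lift_ofPath]
    induction p with
    | nil => exact (map_zero h).symm ▸ he _
    | cons p a ih =>
      rw [pathWeight, map_add]
      exact weightPart_mul_mem _ _ _ _ _ ih (hφ _ _ a)

end lift

section component

variable {𝕜 : Type*} [Field 𝕜] {V : Type*} [Quiver V] {ι : Type*} [AddMonoid ι] [DecidableEq ι]

/-- The projection of the path algebra onto the span of the paths of weight `n`. -/
noncomputable def component (w : ∀ i j : V, (i ⟶ j) → ι) (n : ι) :
    PathAlgebra 𝕜 V →ₗ[𝕜] PathAlgebra 𝕜 V :=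
  (basis 𝕜).constr 𝕜 fun x => if pathWeight w x.2.2 = n then ofPath 𝕜 x.2.2 else 0

theorem component_of_mem (w : ∀ i j : V, (i ⟶ j) → ι) {m n : ι} {x : PathAlgebra 𝕜 V}
    (hx : x ∈ weightPart 𝕜 w m) : component w n x = if m = n then x else 0 := by
  induction hx using Submodule.span_induction with
  | zero => simp
  | add a b _ _ ha hb => rw [map_add, ha, hb]; split_ifs <;> simp
  | smul c a _ ha => rw [map_smul, ha]; split_ifs <;> simp
  | mem a ha =>
    obtain ⟨i, j, p, rfl, rfl⟩ := ha
    simp [component, ofPath]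

end component

end PathAlgebra

/-! ### The double quiver inside the quiver of the Ginzburg dg algebra -/

namespace Ginzburg

open PathAlgebra

variable {𝕜 : Type*} [Field 𝕜] {V : Type*} [Quiver V]

theorem vertex_mul_vertex_of_ne {i j : V} (h : i ≠ j) : vertex 𝕜 i * vertex 𝕜 j = 0 :=
  idem_mul_idem_of_ne (V := GinzburgQuiver V) h

theorem vertex_mul_arrow {i j : V} (α : i ⟶ j) : vertex 𝕜 i * arrow 𝕜 α = arrow 𝕜 α :=
  idem_mul_ofArrow (V := GinzburgQuiver V) (GinzburgArrow.arrow α)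

theorem arrow_mul_vertex {i j : V} (α : i ⟶ j) : arrow 𝕜 α * vertex 𝕜 j = arrow 𝕜 α :=
  ofArrow_mul_idem (V := GinzburgQuiver V) (GinzburgArrow.arrow α)

theorem vertex_mul_star {i j : V} (α : i ⟶ j) : vertex 𝕜 j * star 𝕜 α = star 𝕜 α :=
  idem_mul_ofArrow (V := GinzburgQuiver V) (GinzburgArrow.star α)

theorem star_mul_vertex {i j : V} (α : i ⟶ j) : star 𝕜 α * vertex 𝕜 i = star 𝕜 α :=
  ofArrow_mul_idem (V := GinzburgQuiver V) (GinzburgArrow.star α)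

/-- The images of the arrows of the double quiver. -/
noncomputable def inclArrow : ∀ i j : Quiver.Symmetrify V, (i ⟶ j) →
    PathAlgebra 𝕜 (GinzburgQuiver V)
  | _, _, .inl α => arrow 𝕜 α
  | _, _, .inr α => star 𝕜 α

theorem vertex_mul_inclArrow (i j : Quiver.Symmetrify V) (a : i ⟶ j) :
    vertex 𝕜 (V := V) i * inclArrow i j a = inclArrow i j a := by
  match i, j, a with
  | _, _, .inl α => exact vertex_mul_arrow α
  | _, _, .inr α => exact vertex_mul_star α

theorem inclArrow_mul_vertex (i j : Quiver.Symmetrify V) (a : i ⟶ j) :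
    inclArrow i j a * vertex 𝕜 (V := V) j = inclArrow i j a := by
  match i, j, a with
  | _, _, .inl α => exact arrow_mul_vertex α
  | _, _, .inr α => exact star_mul_vertex α

variable [Fintype V]

variable (𝕜 V) in
/-- The inclusion of the path algebra of the double quiver into the Ginzburg dg algebra. -/
noncomputable def incl : PathAlgebra 𝕜 (Quiver.Symmetrify V) →ₗ[𝕜]
    PathAlgebra 𝕜 (GinzburgQuiver V) :=
  lift 𝕜 (fun i : V => vertex 𝕜 i) inclArrow

/-- The images of the arrows in the path algebra of the double quiver. -/
noncomputable def retractArrow : ∀ i j : GinzburgQuiver V, (i ⟶ j) →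
    PathAlgebra 𝕜 (Quiver.Symmetrify V)
  | _, _, .arrow α => ofArrow 𝕜 (V := Quiver.Symmetrify V) α.toPos
  | _, _, .star α => ofArrow 𝕜 (V := Quiver.Symmetrify V) α.toNeg
  | _, _, .loop _ => 0

variable (𝕜 V) in
/-- The projection of the Ginzburg dg algebra onto the path algebra of the double quiver that
annihilates the loops. -/
noncomputable def retract : PathAlgebra 𝕜 (GinzburgQuiver V) →ₗ[𝕜]
    PathAlgebra 𝕜 (Quiver.Symmetrify V) :=
  lift 𝕜 (fun i : V => idem 𝕜 (V := Quiver.Symmetrify V) i) retractArrow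

theorem incl_mul (x y : PathAlgebra 𝕜 (Quiver.Symmetrify V)) :
    incl 𝕜 V (x * y) = incl 𝕜 V x * incl 𝕜 V y :=
  lift_mul (V := Quiver.Symmetrify V) (fun i => vertex_mul_vertex 𝕜 (V := V) i)
    (fun _ _ h => vertex_mul_vertex_of_ne (V := V) h) inclArrow_mul_vertex x y

theorem incl_ofArrow {i j : Quiver.Symmetrify V} (a : i ⟶ j) :
    incl 𝕜 V (ofArrow 𝕜 a) = inclArrow i j a := lift_ofArrow vertex_mul_inclArrow a

theorem incl_idem (i : Quiver.Symmetrify V) : incl 𝕜 V (idem 𝕜 i) = vertex 𝕜 (V := V) i :=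
  lift_idem i

theorem incl_mem {n : ℤ} {x : PathAlgebra 𝕜 (Quiver.Symmetrify V)}
    (hx : x ∈ weightPart 𝕜 (fun (i j : Quiver.Symmetrify V) (_ : i ⟶ j) => (1 : ℤ)) n) :
    incl 𝕜 V x ∈ weightPart 𝕜 (weight V) (0, n) :=
  lift_mem (fun (i j : Quiver.Symmetrify V) (_ : i ⟶ j) => (1 : ℤ)) (weight V)
    (AddMonoidHom.inr ℤ ℤ) (fun i => vertex_mem 𝕜 (V := V) i) (fun i j a => by
      match i, j, a with
      | _, _, .inl α => exact arrow_mem 𝕜 V α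
      | _, _, .inr α => exact star_mem 𝕜 V α) hx

theorem idem_mul_retractArrow (i j : GinzburgQuiver V) (a : i ⟶ j) :
    idem 𝕜 (V := Quiver.Symmetrify V) i * retractArrow i j a = retractArrow i j a := by
  match i, j, a with
  | _, _, .arrow α => exact idem_mul_ofArrow (V := Quiver.Symmetrify V) α.toPos
  | _, _, .star α => exact idem_mul_ofArrow (V := Quiver.Symmetrify V) α.toNeg
  | _, _, .loop _ => exact mul_zero _

theorem retractArrow_mul_idem (i j : GinzburgQuiver V) (a : i ⟶ j) :
    retractArrow i j a * idem 𝕜 (V := Quiver.Symmetrify V) j = retractArrow i j a := by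
  match i, j, a with
  | _, _, .arrow α => exact ofArrow_mul_idem (V := Quiver.Symmetrify V) α.toPos
  | _, _, .star α => exact ofArrow_mul_idem (V := Quiver.Symmetrify V) α.toNeg
  | _, _, .loop _ => exact zero_mul _

theorem retract_mul (x y : PathAlgebra 𝕜 (GinzburgQuiver V)) :
    retract 𝕜 V (x * y) = retract 𝕜 V x * retract 𝕜 V y :=
  lift_mul (V := GinzburgQuiver V) (fun i => idem_mul_idem (V := Quiver.Symmetrify V) i)
    (fun _ _ h => idem_mul_idem_of_ne (V := Quiver.Symmetrify V) h) retractArrow_mul_idem x y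

theorem retract_ofArrow {i j : GinzburgQuiver V} (a : i ⟶ j) :
    retract 𝕜 V (ofArrow 𝕜 a) = retractArrow i j a := lift_ofArrow idem_mul_retractArrow a

theorem retract_incl (x : PathAlgebra 𝕜 (Quiver.Symmetrify V)) :
    retract 𝕜 V (incl 𝕜 V x) = x := by
  suffices h : retract 𝕜 V ∘ₗ incl 𝕜 V = LinearMap.id from LinearMap.congr_fun h x
  refine hom_ext 𝕜 fun i j p => ?_
  induction p with
  | nil =>
    change retract 𝕜 V (incl 𝕜 V (idem 𝕜 i)) = idem 𝕜 i
    rw [incl_idem]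
    exact lift_idem (V := GinzburgQuiver V) _
  | cons p a ih =>
    simp only [LinearMap.comp_apply, LinearMap.id_apply] at ih ⊢
    rw [ofPath_cons, incl_mul, retract_mul, ih, incl_ofArrow]
    congr 1
    match a with
    | .inl α => exact retract_ofArrow (V := V) (GinzburgArrow.arrow α)
    | .inr α => exact retract_ofArrow (V := V) (GinzburgArrow.star α)

/-- Elements of cohomological degree zero do not involve the loops. -/
theorem incl_retract {n : ℤ} {y : PathAlgebra 𝕜 (GinzburgQuiver V)}
    (hy : y ∈ weightPart 𝕜 (weight V) (0, n)) :
    incl 𝕜 V (retract 𝕜 V y) = y ∧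
      retract 𝕜 V y ∈ weightPart 𝕜 (fun (i j : Quiver.Symmetrify V) (_ : i ⟶ j) => (1 : ℤ)) n := by
  have h : ∀ {i j : GinzburgQuiver V} (p : Quiver.Path i j), (pathWeight (weight V) p).1 = 0 →
      incl 𝕜 V (retract 𝕜 V (ofPath 𝕜 p)) = ofPath 𝕜 p ∧ retract 𝕜 V (ofPath 𝕜 p) ∈
        weightPart 𝕜 (fun (i j : Quiver.Symmetrify V) (_ : i ⟶ j) => (1 : ℤ))
          (pathWeight (weight V) p).2 := fun {i j} p hp => by
    induction p with
    | nil =>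
      have h1 : retract 𝕜 V (idem 𝕜 i) = idem 𝕜 (V := Quiver.Symmetrify V) i := lift_idem _
      change incl 𝕜 V (retract 𝕜 V (idem 𝕜 i)) = idem 𝕜 i ∧ retract 𝕜 V (idem 𝕜 i) ∈ _
      rw [h1]
      exact ⟨incl_idem (V := V) _, idem_mem (V := Quiver.Symmetrify V) _ _⟩
    | cons p a ih =>
      have h1 := pathWeight_fst_nonpos p
      have h2 : (pathWeight (weight V) (p.cons a)).1 =
        (pathWeight (weight V) p).1 + (weight V _ _ a).1 := rfl
      have h3 : (weight V _ _ a).1 = 0 → incl 𝕜 V (retractArrow _ _ a) = ofArrow 𝕜 a ∧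
          retractArrow _ _ a ∈ weightPart 𝕜
            (fun (i j : Quiver.Symmetrify V) (_ : i ⟶ j) => (1 : ℤ)) (weight V _ _ a).2 := by
        intro ha
        match a with
        | .arrow α => exact ⟨incl_ofArrow (V := V) _, ofArrow_mem (V := Quiver.Symmetrify V) _ _⟩
        | .star α => exact ⟨incl_ofArrow (V := V) _, ofArrow_mem (V := Quiver.Symmetrify V) _ _⟩
        | .loop _ => exact absurd ha (by decide : (-1 : ℤ) ≠ 0)
      have h4 : (weight V _ _ a).1 ≤ 0 := by
        have := pathWeight_fst_nonpos a.toPath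
        rwa [show pathWeight (weight V) a.toPath = weight V _ _ a from zero_add _] at this
      obtain ⟨ih1, ih2⟩ := ih (by omega)
      obtain ⟨h5, h6⟩ := h3 (by omega)
      rw [ofPath_cons, retract_mul, retract_ofArrow, incl_mul, ih1, h5]
      exact ⟨rfl, weightPart_mul_mem _ _ _ _ _ ih2 h6⟩
  induction hy using Submodule.span_induction with
  | zero => simp
  | add a b _ _ ha hb =>
    simp only [map_add, ha.1, hb.1, true_and]
    exact add_mem ha.2 hb.2
  | smul c a _ ha =>
    simp only [map_smul, ha.1, true_and]
    exact Submodule.smul_mem _ _ ha.2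
  | mem a ha =>
    obtain ⟨i, j, p, hp, rfl⟩ := ha
    have := h p (by rw [hp])
    rwa [hp] at this

variable [∀ i j : V, Fintype (i ⟶ j)]

theorem incl_rho : incl 𝕜 V (Preprojective.rho 𝕜 V) = rho 𝕜 V := by
  have h1 : ∀ {i j : V} (α : i ⟶ j),
      incl 𝕜 V (ofArrow 𝕜 (V := Quiver.Symmetrify V) α.toPos) = arrow 𝕜 α := fun α =>
    incl_ofArrow (V := V) _
  have h2 : ∀ {i j : V} (α : i ⟶ j),
      incl 𝕜 V (ofArrow 𝕜 (V := Quiver.Symmetrify V) α.toNeg) = star 𝕜 α := fun α =>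
    incl_ofArrow (V := V) _
  simp only [Preprojective.rho, rho, map_sum, map_sub, incl_mul, h1, h2]

theorem retract_rho : retract 𝕜 V (rho 𝕜 V) = Preprojective.rho 𝕜 V := by
  rw [← incl_rho, retract_incl]

end Ginzburg

/-! ### Coboundaries of even derivations -/

namespace Ginzburg

open PathAlgebra HochschildFamily DiffBigradedAlgebra

variable {𝕜 : Type*} [Field 𝕜] {V : Type*} [Quiver V]

theorem vertex_mul_mul_vertex_mem {n : ℤ × ℤ} {u : PathAlgebra 𝕜 (GinzburgQuiver V)}
    (hu : u ∈ weightPart 𝕜 (weight V) n) (i j : V) :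
    vertex 𝕜 i * u * vertex 𝕜 j ∈ weightPart 𝕜 (weight V) n := by
  have h := weightPart_mul_mem (weight V) _ _ _ _
    (weightPart_mul_mem (weight V) _ _ _ _ (vertex_mem 𝕜 i) hu) (vertex_mem 𝕜 j)
  rwa [zero_add, add_zero] at h

variable [Fintype V]

theorem vertex_mul_block (u : PathAlgebra 𝕜 (GinzburgQuiver V)) (i j : V) :
    vertex 𝕜 i * (vertex 𝕜 i * u * vertex 𝕜 j) = vertex 𝕜 i * u * vertex 𝕜 j := by
  rw [← mul_assoc, ← mul_assoc, vertex_mul_vertex]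

theorem block_mul_vertex (u : PathAlgebra 𝕜 (GinzburgQuiver V)) (i j : V) :
    vertex 𝕜 i * u * vertex 𝕜 j * vertex 𝕜 j = vertex 𝕜 i * u * vertex 𝕜 j := by
  rw [mul_assoc, vertex_mul_vertex]

/-- `loopDeriv y` only depends on the diagonal blocks of `y`. -/
theorem loopDeriv_congr {y z : PathAlgebra 𝕜 (GinzburgQuiver V)}
    (h : ∀ i : V, vertex 𝕜 i * y * vertex 𝕜 i = vertex 𝕜 i * z * vertex 𝕜 i) :
    loopDeriv y = loopDeriv z := by
  have h1 : loopValue y = loopValue z := by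
    funext i j a
    match i, j, a with
    | _, _, .arrow _ => rfl
    | _, _, .star _ => rfl
    | _, _, .loop i => exact h i
  exact congrArg (PathAlgebra.deriv (weight V)) h1

/-- Cyclic elements commute with the idempotents. -/
theorem vertex_mul_comm {c : PathAlgebra 𝕜 (GinzburgQuiver V)} {i : V}
    (hl : vertex 𝕜 i * c = c) (hr : c * vertex 𝕜 i = c) (k : V) :
    vertex 𝕜 k * c = c * vertex 𝕜 k := by
  by_cases h : k = i
  · rw [h, hl, hr]
  · rw [← hl, ← mul_assoc, vertex_mul_vertex_of_ne h, zero_mul, hl, ← hr, mul_assoc,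
      vertex_mul_vertex_of_ne (Ne.symm h), mul_zero]

/-- In the presence of a right factor `a` that ends at `i`, the idempotent `eᵢ` on the left is
invisible in the diagonal blocks. -/
theorem vertex_mul_mul_vertex_left {a u : PathAlgebra 𝕜 (GinzburgQuiver V)} {i : V}
    (h : a * vertex 𝕜 i = a) (k : V) :
    vertex 𝕜 k * (vertex 𝕜 i * u * a) * vertex 𝕜 k = vertex 𝕜 k * (u * a) * vertex 𝕜 k := by
  by_cases hk : k = i
  · rw [hk, mul_assoc (vertex 𝕜 i) u, ← mul_assoc (vertex 𝕜 i) (vertex 𝕜 i), vertex_mul_vertex]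
  · have h0 : a * vertex 𝕜 k = 0 := by
      rw [← h, mul_assoc, vertex_mul_vertex_of_ne (Ne.symm hk), mul_zero]
    simp only [mul_assoc, h0, mul_zero]

theorem vertex_mul_mul_vertex_right {a u : PathAlgebra 𝕜 (GinzburgQuiver V)} {i : V}
    (h : vertex 𝕜 i * a = a) (k : V) :
    vertex 𝕜 k * (a * (u * vertex 𝕜 i)) * vertex 𝕜 k = vertex 𝕜 k * (a * u) * vertex 𝕜 k := by
  by_cases hk : k = i
  · simp only [hk, mul_assoc, vertex_mul_vertex]
  · have h0 : vertex 𝕜 k * a = 0 := by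
      rw [← h, ← mul_assoc, vertex_mul_vertex_of_ne hk, zero_mul]
    simp only [← mul_assoc, h0, zero_mul]

open Classical in
/-- The function on arrows with value `u` at the arrow `b`, and zero elsewhere. -/
noncomputable def singleArrow {k l : GinzburgQuiver V} (b : k ⟶ l)
    (u : PathAlgebra 𝕜 (GinzburgQuiver V)) (i j : GinzburgQuiver V) (a : i ⟶ j) :
    PathAlgebra 𝕜 (GinzburgQuiver V) :=
  if (⟨i, j, a⟩ : Σ i j : GinzburgQuiver V, (i ⟶ j)) = ⟨k, l, b⟩ then u else 0

theorem singleArrow_self {k l : GinzburgQuiver V} (b : k ⟶ l)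
    (u : PathAlgebra 𝕜 (GinzburgQuiver V)) : singleArrow b u k l b = u := if_pos rfl

theorem singleArrow_of_ne {k l i j : GinzburgQuiver V} {b : k ⟶ l} {a : i ⟶ j}
    (h : (⟨i, j, a⟩ : Σ i j : GinzburgQuiver V, (i ⟶ j)) ≠ ⟨k, l, b⟩)
    (u : PathAlgebra 𝕜 (GinzburgQuiver V)) : singleArrow b u i j a = 0 := if_neg h

theorem idem_mul_singleArrow {k l : GinzburgQuiver V} {b : k ⟶ l}
    {u : PathAlgebra 𝕜 (GinzburgQuiver V)} (hu : idem 𝕜 k * u = u) (i j : GinzburgQuiver V)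
    (a : i ⟶ j) : idem 𝕜 i * singleArrow b u i j a = singleArrow b u i j a := by
  by_cases h : (⟨i, j, a⟩ : Σ i j : GinzburgQuiver V, (i ⟶ j)) = ⟨k, l, b⟩
  · cases h
    rw [singleArrow_self, hu]
  · rw [singleArrow_of_ne h, mul_zero]

theorem singleArrow_mul_idem {k l : GinzburgQuiver V} {b : k ⟶ l}
    {u : PathAlgebra 𝕜 (GinzburgQuiver V)} (hu : u * idem 𝕜 l = u) (i j : GinzburgQuiver V)
    (a : i ⟶ j) : singleArrow b u i j a * idem 𝕜 j = singleArrow b u i j a := by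
  by_cases h : (⟨i, j, a⟩ : Σ i j : GinzburgQuiver V, (i ⟶ j)) = ⟨k, l, b⟩
  · cases h
    rw [singleArrow_self, hu]
  · rw [singleArrow_of_ne h, zero_mul]

theorem singleArrow_mem {k l : GinzburgQuiver V} {b : k ⟶ l}
    {u : PathAlgebra 𝕜 (GinzburgQuiver V)} {m : ℤ × ℤ}
    (hu : u ∈ weightPart 𝕜 (weight V) (weight V k l b + m)) (i j : GinzburgQuiver V)
    (a : i ⟶ j) : singleArrow b u i j a ∈ weightPart 𝕜 (weight V) (weight V i j a + m) := by
  by_cases h : (⟨i, j, a⟩ : Σ i j : GinzburgQuiver V, (i ⟶ j)) = ⟨k, l, b⟩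
  · cases h
    rwa [singleArrow_self]
  · rw [singleArrow_of_ne h]
    exact zero_mem _

/-- Commutators with idempotents have no diagonal blocks. -/
theorem loopDeriv_commutator_vertex (u : PathAlgebra 𝕜 (GinzburgQuiver V)) (i : V) :
    loopDeriv (u * vertex 𝕜 i - vertex 𝕜 i * u) = 0 := by
  rw [← map_zero loopDeriv]
  refine loopDeriv_congr fun k => ?_
  rw [mul_zero, zero_mul, mul_sub, sub_mul, sub_eq_zero]
  by_cases hk : k = i
  · rw [hk, mul_assoc, mul_assoc u, vertex_mul_vertex, ← mul_assoc, ← mul_assoc, vertex_mul_vertex]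
  · rw [mul_assoc, mul_assoc u, vertex_mul_vertex_of_ne (Ne.symm hk), ← mul_assoc (vertex 𝕜 k) (vertex 𝕜 i),
      vertex_mul_vertex_of_ne hk, mul_zero, mul_zero, zero_mul, zero_mul]

variable [∀ i j : V, Fintype (i ⟶ j)]

theorem vertex_mul_rho (k : V) : vertex 𝕜 k * rho 𝕜 V = rho 𝕜 V * vertex 𝕜 k := by
  simp only [rho, Finset.mul_sum, Finset.sum_mul, mul_sub, sub_mul]
  refine Finset.sum_congr rfl fun i _ => Finset.sum_congr rfl fun j _ =>
    Finset.sum_congr rfl fun α _ => congrArg₂ _ (vertex_mul_comm (i := i) ?_ ?_ k)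
      (vertex_mul_comm (i := j) ?_ ?_ k)
  · rw [← mul_assoc, vertex_mul_arrow]
  · rw [mul_assoc, star_mul_vertex]
  · rw [← mul_assoc, vertex_mul_star]
  · rw [mul_assoc, arrow_mul_vertex]

theorem sum_vertex_mul_rho_mul_vertex :
    ∑ i : V, vertex 𝕜 i * rho 𝕜 V * vertex 𝕜 i = rho 𝕜 V := by
  simp only [vertex_mul_rho, mul_assoc, vertex_mul_vertex, ← Finset.mul_sum]
  exact mul_one (rho 𝕜 V)

theorem rho_eq_sum_sigma : rho 𝕜 V = ∑ x : Σ i j : V, (i ⟶ j),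
    (arrow 𝕜 x.2.2 * star 𝕜 x.2.2 - star 𝕜 x.2.2 * arrow 𝕜 x.2.2) := by
  simp only [rho, Fintype.sum_sigma]

/-- The commutator of the differential with the even derivation `E` with values `δ` on arrows is
the derivation `loopDeriv z`, where the diagonal blocks of `z` are `d (δ tᵢ) - eᵢ (E ρ) eᵢ`. -/
theorem ofLinear_loopDeriv_mem_coboundaries {q : ℤ} {z : PathAlgebra 𝕜 (GinzburgQuiver V)}
    {δ : ∀ i j : GinzburgQuiver V, (i ⟶ j) → PathAlgebra 𝕜 (GinzburgQuiver V)}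
    (hl : ∀ i j a, idem 𝕜 i * δ i j a = δ i j a) (hr : ∀ i j a, δ i j a * idem 𝕜 j = δ i j a)
    (hδ : ∀ i j a, δ i j a ∈ weightPart 𝕜 (weight V) (weight V i j a + (0, q)))
    (hz : ∀ i : V, (dgAlgebra 𝕜 V).d (δ i i (GinzburgArrow.loop i)) -
      vertex 𝕜 i * deriv 0 δ (rho 𝕜 V) * vertex 𝕜 i = vertex 𝕜 i * z * vertex 𝕜 i) :
    ofLinear (loopDeriv z) ∈ (dgAlgebra 𝕜 V).coboundaries 2 q := by
  have hE := deriv_zero_mul hr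
  have hE1 : ∀ {i j : GinzburgQuiver V} (a : i ⟶ j), deriv 0 δ (ofArrow 𝕜 a) = δ i j a :=
    fun a => deriv_ofArrow 0 δ hl a
  have hE0 : ∀ i : GinzburgQuiver V, deriv 0 δ (idem 𝕜 i) = 0 := fun i => deriv_idem 0 δ i
  have hEm : ∀ r s x, x ∈ weightPart 𝕜 (weight V) (r, s) →
      deriv 0 δ x ∈ weightPart 𝕜 (weight V) ((r, s) + (0, q)) := fun r s x hx =>
    deriv_mem_add 0 (weight V) hδ hx
  have hd0 : ∀ {x : PathAlgebra 𝕜 (GinzburgQuiver V)},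
      x ∈ weightPart 𝕜 (weight V) ((0, 1) + (0, q)) → (dgAlgebra 𝕜 V).d x = 0 := fun hx =>
    eq_zero_of_mem_weightPart (r := 0 + 0 + 1) (s := 1 + q) one_pos
      ((dgAlgebra 𝕜 V).d_mem _ _ _ hx)
  refine ⟨ofLinear (deriv 0 δ), ofLinear_mem fun r s x hx => ?_, ?_⟩
  · have h := hEm r s x hx
    rw [Prod.mk_add_mk, add_zero, add_comm s] at h
    have e : r = 2 - 1 + r - 1 := by ring
    rw [e] at h
    exact h
  · change (dgAlgebra 𝕜 V).hochschildDiff 1 _ = _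
    rw [hochschildDiff_one_ofLinear hE]
    refine congrArg ofLinear (eq_deriv (weight V) (loopValue z) _ (fun p a => ?_) (fun i => ?_)
      fun {i j} a => ?_)
    · have hp : ofPath 𝕜 p ∈ (dgAlgebra 𝕜 V).gr (pathWeight (weight V) p) := ofPath_mem _ p
      have hp' : deriv 0 δ (ofPath 𝕜 p) ∈ (dgAlgebra 𝕜 V).gr
        ((pathWeight (weight V) p).1 + 0, (pathWeight (weight V) p).2 + q) := hEm _ _ _ hp
      simp only [LinearMap.sub_apply, LinearMap.comp_apply, hE, map_add, map_smul,
        (dgAlgebra 𝕜 V).leibniz _ _ _ _ hp, (dgAlgebra 𝕜 V).leibniz _ _ _ _ hp', add_zero,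
        sub_mul, mul_sub, smul_sub, smul_add]
      abel
    · simp only [LinearMap.sub_apply, LinearMap.comp_apply, hE0, d_idem, map_zero, sub_zero]
    · simp only [LinearMap.sub_apply, LinearMap.comp_apply, hE1, d_ofArrow]
      match i, j, a with
      | _, _, .arrow α =>
        rw [hd0 (hδ _ _ (GinzburgArrow.arrow α)), zero_sub]
        exact neg_eq_zero.mpr (map_zero _)
      | _, _, .star α =>
        rw [hd0 (hδ _ _ (GinzburgArrow.star α)), zero_sub]
        exact neg_eq_zero.mpr (map_zero _)
      | _, _, .loop i =>
        refine Eq.trans ?_ (hz i)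
        have hv : deriv 0 δ (vertex 𝕜 i) = 0 := hE0 i
        change _ - deriv 0 δ (vertex 𝕜 i * rho 𝕜 V * vertex 𝕜 i) = _
        rw [hE, hE, hv, mul_zero, zero_mul, zero_add, add_zero]

/-- The value on `ρ` of the even derivation with values `δ` on arrows, by the Leibniz rule. -/
theorem deriv_zero_rho
    {δ : ∀ i j : GinzburgQuiver V, (i ⟶ j) → PathAlgebra 𝕜 (GinzburgQuiver V)}
    (hl : ∀ i j a, idem 𝕜 i * δ i j a = δ i j a) (hr : ∀ i j a, δ i j a * idem 𝕜 j = δ i j a) :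
    deriv 0 δ (rho 𝕜 V) = ∑ x : Σ i j : V, (i ⟶ j),
      (δ _ _ (GinzburgArrow.arrow x.2.2) * star 𝕜 x.2.2 +
        arrow 𝕜 x.2.2 * δ _ _ (GinzburgArrow.star x.2.2) -
        (δ _ _ (GinzburgArrow.star x.2.2) * arrow 𝕜 x.2.2 +
          star 𝕜 x.2.2 * δ _ _ (GinzburgArrow.arrow x.2.2))) := by
  have h1 : ∀ {i j : V} (α : i ⟶ j), deriv 0 δ (arrow 𝕜 α) = δ _ _ (GinzburgArrow.arrow α) :=
    fun α => deriv_ofArrow 0 δ hl _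
  have h2 : ∀ {i j : V} (α : i ⟶ j), deriv 0 δ (star 𝕜 α) = δ _ _ (GinzburgArrow.star α) :=
    fun α => deriv_ofArrow 0 δ hl _
  simp only [rho_eq_sum_sigma, map_sum, map_sub, deriv_zero_mul hr, h1, h2]

theorem deriv_singleArrow_star_rho {i j : V} (α : i ⟶ j) {u : PathAlgebra 𝕜 (GinzburgQuiver V)}
    (hl : vertex 𝕜 j * u = u) (hr : u * vertex 𝕜 i = u) :
    PathAlgebra.deriv 0 (singleArrow (V := V) (GinzburgArrow.star α) u) (rho 𝕜 V) =
      arrow 𝕜 α * u - u * arrow 𝕜 α := by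
  have h1 : ∀ x : Σ i j : V, (i ⟶ j), singleArrow (V := V) (GinzburgArrow.star α) u _ _
      (GinzburgArrow.arrow x.2.2) = 0 := fun x => singleArrow_of_ne (fun h => by cases h) u
  have h2 : ∀ x : Σ i j : V, (i ⟶ j), x ≠ ⟨i, j, α⟩ → singleArrow (V := V)
      (GinzburgArrow.star α) u _ _ (GinzburgArrow.star x.2.2) = 0 := fun ⟨i', j', x⟩ hx =>
    singleArrow_of_ne (fun h => hx (by cases h; rfl)) u
  rw [deriv_zero_rho (idem_mul_singleArrow hl) (singleArrow_mul_idem hr),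
    Fintype.sum_eq_single ⟨i, j, α⟩ fun x hx => by
      rw [h1, h2 x hx, zero_mul, mul_zero, zero_mul, mul_zero, add_zero, sub_zero]]
  have h3 := singleArrow_self (V := V) (GinzburgArrow.star α) u
  rw [h1, zero_mul, mul_zero, zero_add, add_zero]
  exact congrArg (fun z => arrow 𝕜 α * z - z * arrow 𝕜 α) h3

theorem deriv_singleArrow_arrow_rho {i j : V} (α : i ⟶ j) {u : PathAlgebra 𝕜 (GinzburgQuiver V)}
    (hl : vertex 𝕜 i * u = u) (hr : u * vertex 𝕜 j = u) :
    PathAlgebra.deriv 0 (singleArrow (V := V) (GinzburgArrow.arrow α) u) (rho 𝕜 V) =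
      u * star 𝕜 α - star 𝕜 α * u := by
  have h1 : ∀ x : Σ i j : V, (i ⟶ j), singleArrow (V := V) (GinzburgArrow.arrow α) u _ _
      (GinzburgArrow.star x.2.2) = 0 := fun x => singleArrow_of_ne (fun h => by cases h) u
  have h2 : ∀ x : Σ i j : V, (i ⟶ j), x ≠ ⟨i, j, α⟩ → singleArrow (V := V)
      (GinzburgArrow.arrow α) u _ _ (GinzburgArrow.arrow x.2.2) = 0 := fun ⟨i', j', x⟩ hx =>
    singleArrow_of_ne (fun h => hx (by cases h; rfl)) u
  rw [deriv_zero_rho (idem_mul_singleArrow hl) (singleArrow_mul_idem hr),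
    Fintype.sum_eq_single ⟨i, j, α⟩ fun x hx => by
      rw [h1, h2 x hx, zero_mul, mul_zero, zero_mul, mul_zero, add_zero, sub_zero]]
  have h3 := singleArrow_self (V := V) (GinzburgArrow.arrow α) u
  rw [h1, zero_mul, mul_zero, zero_add, add_zero]
  exact congrArg (fun z => z * star 𝕜 α - star 𝕜 α * z) h3

/-- The even derivation that maps `α*` to a block of `u` has `[α, u]`, up to the choice of blocks,
as its value on `ρ`. -/
theorem commutator_arrow_mem_coboundaries {q : ℤ} {u : PathAlgebra 𝕜 (GinzburgQuiver V)}
    (hu : u ∈ weightPart 𝕜 (weight V) (0, 1 + q)) {i j : V} (α : i ⟶ j) :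
    ofLinear (loopDeriv (u * arrow 𝕜 α - arrow 𝕜 α * u)) ∈ (dgAlgebra 𝕜 V).coboundaries 2 q := by
  refine ofLinear_loopDeriv_mem_coboundaries (δ := singleArrow (V := V) (GinzburgArrow.star α)
    (vertex 𝕜 j * u * vertex 𝕜 i)) (idem_mul_singleArrow (vertex_mul_block u j i))
    (singleArrow_mul_idem (block_mul_vertex u j i))
    (singleArrow_mem (m := (0, q)) (vertex_mul_mul_vertex_mem hu j i)) fun k => ?_
  have h0 := congrArg (dgAlgebra 𝕜 V).d (singleArrow_of_ne (V := V) (b := GinzburgArrow.star α)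
    (a := GinzburgArrow.loop k) (fun h => by cases h) (vertex 𝕜 j * u * vertex 𝕜 i))
  refine (congrArg₂ (fun x y => x - vertex 𝕜 k * y * vertex 𝕜 k) h0
    (deriv_singleArrow_star_rho α (vertex_mul_block u j i) (block_mul_vertex u j i))).trans ?_
  rw [map_zero, zero_sub, mul_sub, sub_mul, mul_sub, sub_mul, neg_sub,
    mul_assoc _ (vertex 𝕜 i) (arrow 𝕜 α), vertex_mul_arrow,
    vertex_mul_mul_vertex_left (arrow_mul_vertex α), mul_assoc (vertex 𝕜 j) u,
    ← mul_assoc (arrow 𝕜 α), arrow_mul_vertex, vertex_mul_mul_vertex_right (vertex_mul_arrow α)]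

/-- The even derivation that maps `α` to a block of `-u` has `[α*, u]`, up to the choice of blocks,
as its value on `ρ`. -/
theorem commutator_star_mem_coboundaries {q : ℤ} {u : PathAlgebra 𝕜 (GinzburgQuiver V)}
    (hu : u ∈ weightPart 𝕜 (weight V) (0, 1 + q)) {i j : V} (α : i ⟶ j) :
    ofLinear (loopDeriv (u * star 𝕜 α - star 𝕜 α * u)) ∈ (dgAlgebra 𝕜 V).coboundaries 2 q := by
  have hl := vertex_mul_block (-u) i j
  have hr := block_mul_vertex (-u) i j
  refine ofLinear_loopDeriv_mem_coboundaries (δ := singleArrow (V := V) (GinzburgArrow.arrow α)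
    (vertex 𝕜 i * (-u) * vertex 𝕜 j)) (idem_mul_singleArrow hl) (singleArrow_mul_idem hr)
    (singleArrow_mem (m := (0, q)) (vertex_mul_mul_vertex_mem (neg_mem hu) i j)) fun k => ?_
  have h0 := congrArg (dgAlgebra 𝕜 V).d (singleArrow_of_ne (V := V) (b := GinzburgArrow.arrow α)
    (a := GinzburgArrow.loop k) (fun h => by cases h) (vertex 𝕜 i * (-u) * vertex 𝕜 j))
  refine (congrArg₂ (fun x y => x - vertex 𝕜 k * y * vertex 𝕜 k) h0
    (deriv_singleArrow_arrow_rho α hl hr)).trans ?_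
  rw [map_zero, zero_sub, mul_sub, sub_mul, mul_sub, sub_mul, neg_sub,
    mul_assoc _ (vertex 𝕜 j) (star 𝕜 α), vertex_mul_star,
    vertex_mul_mul_vertex_left (star_mul_vertex α), mul_assoc (vertex 𝕜 i) (-u),
    ← mul_assoc (star 𝕜 α), star_mul_vertex, vertex_mul_mul_vertex_right (vertex_mul_star α)]
  simp only [mul_neg, neg_mul]
  abel

/-- Multiples of `ρ` yield coboundaries, by means of the even derivation that vanishes on the arrows
of the double quiver and maps `tᵢ` to `eᵢ w tᵢ`. -/
theorem mul_rho_mem_coboundaries {q : ℤ} {w : PathAlgebra 𝕜 (GinzburgQuiver V)}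
    (hw : w ∈ weightPart 𝕜 (weight V) (0, q)) :
    ofLinear (loopDeriv (w * rho 𝕜 V)) ∈ (dgAlgebra 𝕜 V).coboundaries 2 q := by
  let t : V → PathAlgebra 𝕜 (GinzburgQuiver V) := fun i =>
    ofArrow 𝕜 (V := GinzburgQuiver V) (GinzburgArrow.loop i)
  have ht : ∀ i, t i ∈ weightPart 𝕜 (weight V) (-1, 2) := fun i =>
    ofArrow_mem (V := GinzburgQuiver V) (weight V) (GinzburgArrow.loop i)
  have htl : ∀ i, vertex 𝕜 i * t i = t i := fun i => idem_mul_ofArrow (V := GinzburgQuiver V) _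
  have htr : ∀ i, t i * vertex 𝕜 i = t i := fun i => ofArrow_mul_idem (V := GinzburgQuiver V) _
  let δ : ∀ i j : GinzburgQuiver V, (i ⟶ j) → PathAlgebra 𝕜 (GinzburgQuiver V) := fun i j a =>
    match i, j, a with
    | _, _, .arrow _ => 0
    | _, _, .star _ => 0
    | _, _, .loop i => vertex 𝕜 i * w * t i
  have hl : ∀ i j a, idem 𝕜 i * δ i j a = δ i j a := fun i j a => by
    match i, j, a with
    | _, _, .arrow _ => exact mul_zero _
    | _, _, .star _ => exact mul_zero _
    | _, _, .loop i =>
      change vertex 𝕜 i * (vertex 𝕜 i * w * t i) = vertex 𝕜 i * w * t i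
      rw [← mul_assoc, ← mul_assoc, vertex_mul_vertex]
  have hr : ∀ i j a, δ i j a * idem 𝕜 j = δ i j a := fun i j a => by
    match i, j, a with
    | _, _, .arrow _ => exact zero_mul _
    | _, _, .star _ => exact zero_mul _
    | _, _, .loop i =>
      change vertex 𝕜 i * w * t i * vertex 𝕜 i = vertex 𝕜 i * w * t i
      rw [mul_assoc, htr]
  refine ofLinear_loopDeriv_mem_coboundaries hl hr (fun i j a => ?_) fun i => ?_
  · match i, j, a with
    | _, _, .arrow _ => exact zero_mem _
    | _, _, .star _ => exact zero_mem _
    | _, _, .loop i =>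
      have h := weightPart_mul_mem (weight V) _ _ _ _
        (weightPart_mul_mem (weight V) _ _ _ _ (vertex_mem 𝕜 i) hw) (ht i)
      rw [zero_add, add_comm] at h
      exact h
  · have h0 : PathAlgebra.deriv 0 δ (rho 𝕜 V) = 0 := by
      rw [deriv_zero_rho hl hr]
      refine Finset.sum_eq_zero fun x _ => ?_
      change 0 * _ + _ * 0 - (0 * _ + _ * 0) = _
      simp only [zero_mul, mul_zero, add_zero, sub_zero]
    have h1 : vertex 𝕜 i * w ∈ (dgAlgebra 𝕜 V).gr (0, q) := by
      have h := weightPart_mul_mem (weight V) _ _ _ _ (vertex_mem 𝕜 i) hw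
      rwa [zero_add] at h
    have h2 : (dgAlgebra 𝕜 V).d (vertex 𝕜 i * w) = 0 :=
      eq_zero_of_mem_weightPart (r := 0 + 1) (s := q) one_pos ((dgAlgebra 𝕜 V).d_mem _ _ _ h1)
    have h3 : (dgAlgebra 𝕜 V).d (t i) = vertex 𝕜 i * rho 𝕜 V * vertex 𝕜 i :=
      d_ofArrow (V := V) (GinzburgArrow.loop i)
    change (dgAlgebra 𝕜 V).d (vertex 𝕜 i * w * t i) - _ = _
    rw [h0, (dgAlgebra 𝕜 V).leibniz _ _ _ _ h1, h2, h3, zpow_zero, one_smul, mul_zero, zero_mul,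
      zero_mul, zero_add, sub_zero, vertex_mul_rho, mul_assoc (rho 𝕜 V), vertex_mul_vertex,
      mul_assoc, mul_assoc, mul_assoc]

/-- Commutators with elements of the path algebra of the double quiver yield coboundaries. As
`[u, p a] = [u p, a] + [a u, p]`, this follows from the case of arrows. -/
theorem commutator_mem_coboundaries {q : ℤ} {i j : Quiver.Symmetrify V} (p : Quiver.Path i j) :
    ∀ {m : ℤ} {u : PathAlgebra 𝕜 (GinzburgQuiver V)}, u ∈ weightPart 𝕜 (weight V) (0, m) →
      m + pathWeight (fun (i j : Quiver.Symmetrify V) (_ : i ⟶ j) => (1 : ℤ)) p = q + 2 →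
      ofLinear (loopDeriv (u * incl 𝕜 V (ofPath 𝕜 p) - incl 𝕜 V (ofPath 𝕜 p) * u)) ∈
        (dgAlgebra 𝕜 V).coboundaries 2 q := by
  induction p with
  | nil =>
    intro m u _ _
    have h : incl 𝕜 V (ofPath 𝕜 Quiver.Path.nil) = vertex 𝕜 (V := V) i := incl_idem i
    rw [h]
    have h0 := loopDeriv_commutator_vertex (V := V) u i
    have h1 : ofLinear (loopDeriv (u * vertex 𝕜 (V := V) i - vertex 𝕜 (V := V) i * u)) = 0 := by
      rw [h0]
      simpa using ofLinear_smul (𝕜 := 𝕜) 0 (0 : PathAlgebra 𝕜 (GinzburgQuiver V) →ₗ[𝕜] _)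
    exact h1 ▸ zero_mem _
  | cons p a ih =>
    intro m u hu hm
    have hp := incl_mem (V := V) (ofPath_mem (𝕜 := 𝕜)
      (fun (i j : Quiver.Symmetrify V) (_ : i ⟶ j) => (1 : ℤ)) p)
    have ha : incl 𝕜 V (ofArrow 𝕜 a) ∈ weightPart 𝕜 (weight V) (0, 1) := incl_mem (ofArrow_mem (𝕜 := 𝕜)
      (fun (i j : Quiver.Symmetrify V) (_ : i ⟶ j) => (1 : ℤ)) a)
    have hm' : m + (pathWeight (fun (i j : Quiver.Symmetrify V) (_ : i ⟶ j) => (1 : ℤ)) p + 1) =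
      q + 2 := hm
    have h1 : u * incl 𝕜 V (ofPath 𝕜 p) ∈ weightPart 𝕜 (weight V) (0, 1 + q) := by
      have h := weightPart_mul_mem (weight V) _ _ _ _ hu hp
      rwa [Prod.mk_add_mk, add_zero, show m + _ = 1 + q by linarith] at h
    have h2 : incl 𝕜 V (ofArrow 𝕜 a) * u ∈ weightPart 𝕜 (weight V) (0, 1 + m) := by
      have h := weightPart_mul_mem (weight V) _ _ _ _ ha hu
      rwa [Prod.mk_add_mk, add_zero] at h
    have h3 : ofLinear (loopDeriv (u * incl 𝕜 V (ofPath 𝕜 p) * incl 𝕜 V (ofArrow 𝕜 a) -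
        incl 𝕜 V (ofArrow 𝕜 a) * (u * incl 𝕜 V (ofPath 𝕜 p)))) ∈
        (dgAlgebra 𝕜 V).coboundaries 2 q := by
      rw [incl_ofArrow]
      match a with
      | .inl α => exact commutator_arrow_mem_coboundaries h1 α
      | .inr α => exact commutator_star_mem_coboundaries h1 α
    have h4 := add_mem h3 (ih h2 (by linarith))
    have h5 : ∀ u x y : PathAlgebra 𝕜 (GinzburgQuiver V),
        u * x * y - y * (u * x) + (y * u * x - x * (y * u)) = u * (x * y) - x * y * u :=
      fun u x y => by simp only [mul_assoc]; abel
    rwa [← ofLinear_add, ← map_add, h5, ← incl_mul, ← ofPath_cons] at h4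

end Ginzburg

/-! ### The zeroth Hochschild homology of the preprojective algebra -/

namespace Preprojective

open PathAlgebra

variable {𝕜 : Type*} [Field 𝕜] {V : Type*} [Quiver V] [Fintype V] [∀ i j : V, Fintype (i ⟶ j)]

theorem proj_eq_zero {x : PathAlgebra 𝕜 (Quiver.Symmetrify V)}
    (h : RingQuot.mkAlgHom 𝕜 (fun x y : PathAlgebra 𝕜 (Quiver.Symmetrify V) =>
      x = rho 𝕜 V ∧ y = 0) x = 0) : proj 𝕜 V x = 0 := by
  rw [proj, LinearMap.comp_apply, AlgHom.toLinearMap_apply, h, map_zero]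

theorem mkAlgHom_rho : RingQuot.mkAlgHom 𝕜 (fun x y : PathAlgebra 𝕜 (Quiver.Symmetrify V) =>
    x = rho 𝕜 V ∧ y = 0) (rho 𝕜 V) = 0 :=
  (RingQuot.mkAlgHom_rel 𝕜 ⟨rfl, rfl⟩).trans (map_zero _)

theorem proj_mul_comm (x y : PathAlgebra 𝕜 (Quiver.Symmetrify V)) :
    proj 𝕜 V (x * y) = proj 𝕜 V (y * x) := by
  rw [← sub_eq_zero, ← map_sub]
  refine (Submodule.Quotient.mk_eq_zero _).mpr (Submodule.subset_span ?_)
  exact ⟨RingQuot.mkAlgHom 𝕜 _ x, RingQuot.mkAlgHom 𝕜 _ y, by simp⟩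

theorem mem_span_of_mkAlgHom_eq_zero {x : PathAlgebra 𝕜 (Quiver.Symmetrify V)}
    (h : RingQuot.mkAlgHom 𝕜 (fun x y : PathAlgebra 𝕜 (Quiver.Symmetrify V) =>
      x = rho 𝕜 V ∧ y = 0) x = 0) : x ∈ TwoSidedIdeal.span {rho 𝕜 V} := by
  let T := TwoSidedIdeal.span {rho 𝕜 V}
  have h1 := DFunLike.congr_fun (RingQuot.mkAlgHom_coe 𝕜
    (fun x y : PathAlgebra 𝕜 (Quiver.Symmetrify V) => x = rho 𝕜 V ∧ y = 0)) x
  have h2 : RingQuot.mkRingHom (fun x y : PathAlgebra 𝕜 (Quiver.Symmetrify V) =>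
    x = rho 𝕜 V ∧ y = 0) x = 0 := h1.symm.trans h
  have h3 := RingQuot.lift_mkRingHom_apply T.ringCon.mk'
    (r := fun x y : PathAlgebra 𝕜 (Quiver.Symmetrify V) => x = rho 𝕜 V ∧ y = 0) (by
      rintro _ _ ⟨rfl, rfl⟩
      exact (RingCon.eq _).mpr (TwoSidedIdeal.subset_span rfl)) x
  rw [h2, map_zero] at h3
  exact (RingCon.eq _).mp h3.symm

/-- A subspace that contains the commutators of paths and the multiples of `ρ` by paths contains the
kernel of the projection onto `Λ / [Λ, Λ]`. -/
theorem mem_of_proj_eq_zero (N : Submodule 𝕜 (PathAlgebra 𝕜 (Quiver.Symmetrify V)))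
    (hc : ∀ {i j k l : Quiver.Symmetrify V} (p : Quiver.Path i j) (p' : Quiver.Path k l),
      ofPath 𝕜 p * ofPath 𝕜 p' - ofPath 𝕜 p' * ofPath 𝕜 p ∈ N)
    (hρ : ∀ {i j k l : Quiver.Symmetrify V} (p : Quiver.Path i j) (p' : Quiver.Path k l),
      ofPath 𝕜 p * rho 𝕜 V * ofPath 𝕜 p' ∈ N)
    {x : PathAlgebra 𝕜 (Quiver.Symmetrify V)} (hx : proj 𝕜 V x = 0) : x ∈ N := by
  have hc' : ∀ x y : PathAlgebra 𝕜 (Quiver.Symmetrify V), x * y - y * x ∈ N := fun x y => by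
    refine induction 𝕜 (P := fun x => x * y - y * x ∈ N) x (by simp)
      (fun a b ha hb => ?_) fun c i j p => ?_
    · convert add_mem ha hb using 1
      simp only [mul_add, add_mul]
      abel
    refine induction 𝕜 (P := fun y => c • ofPath 𝕜 p * y - y * c • ofPath 𝕜 p ∈ N) y (by simp)
      (fun a b ha hb => ?_) fun c' k l p' => ?_
    · convert add_mem ha hb using 1
      simp only [mul_add, add_mul]
      abel
    · simp only [smul_mul_assoc, mul_smul_comm, smul_comm c' c, ← smul_sub]
      exact N.smul_mem _ (N.smul_mem _ (hc p p'))
  have hρ' : ∀ x y : PathAlgebra 𝕜 (Quiver.Symmetrify V), x * rho 𝕜 V * y ∈ N := fun x y => by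
    refine induction 𝕜 (P := fun x => x * rho 𝕜 V * y ∈ N) x (by simp)
      (fun a b ha hb => by simpa only [add_mul] using add_mem ha hb) fun c i j p => ?_
    refine induction 𝕜 (P := fun y => c • ofPath 𝕜 p * rho 𝕜 V * y ∈ N) y (by simp)
      (fun a b ha hb => by simpa only [mul_add] using add_mem ha hb) fun c' k l p' => ?_
    simp only [smul_mul_assoc, mul_smul_comm]
    exact N.smul_mem _ (N.smul_mem _ (hρ p p'))
  -- commutators of `Λ` lift to commutators of the path algebra
  have h0 : ∀ z ∈ commutators 𝕜 V, ∃ c ∈ N, RingQuot.mkAlgHom 𝕜 _ c = z := fun z hz => by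
    induction hz using Submodule.span_induction with
    | zero => exact ⟨0, zero_mem _, map_zero _⟩
    | add a b _ _ ha hb =>
      obtain ⟨a, ha, rfl⟩ := ha
      obtain ⟨b, hb, rfl⟩ := hb
      exact ⟨a + b, add_mem ha hb, map_add _ _ _⟩
    | smul c a _ ha =>
      obtain ⟨a, ha, rfl⟩ := ha
      exact ⟨c • a, N.smul_mem c ha, map_smul _ _ _⟩
    | mem z hz =>
      obtain ⟨a, b, rfl⟩ := hz
      obtain ⟨a, rfl⟩ := RingQuot.mkAlgHom_surjective 𝕜 _ a
      obtain ⟨b, rfl⟩ := RingQuot.mkAlgHom_surjective 𝕜 _ b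
      exact ⟨a * b - b * a, hc' a b, by simp⟩
  obtain ⟨c, hc, h⟩ := h0 _ ((Submodule.Quotient.mk_eq_zero _).mp hx)
  have h1 : x - c ∈ TwoSidedIdeal.span {rho 𝕜 V} :=
    mem_span_of_mkAlgHom_eq_zero (by rw [map_sub, h]; exact sub_self _)
  suffices h2 : x - c ∈ N by simpa using add_mem h2 hc
  rw [TwoSidedIdeal.mem_span_iff_mem_addSubgroup_closure] at h1
  refine (AddSubgroup.closure_le N.toAddSubgroup).mpr ?_ h1
  rintro _ ⟨_, ⟨a, -, _, rfl, rfl⟩, b, -, rfl⟩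
  exact hρ' a b

end Preprojective

/-! ### Comparison of cohomology classes with `Λ / [Λ, Λ]` -/

namespace Ginzburg

open PathAlgebra HochschildFamily DiffBigradedAlgebra

variable {𝕜 : Type*} [Field 𝕜] {V : Type*} [Quiver V] [Fintype V] [∀ i j : V, Fintype (i ⟶ j)]

variable (𝕜 V) in
/-- The trace `B → Λ / [Λ, Λ]` that annihilates the loops. -/
noncomputable def trace : PathAlgebra 𝕜 (GinzburgQuiver V) →ₗ[𝕜]
    Preprojective.PreprojectiveAlgebra 𝕜 V ⧸ Preprojective.commutators 𝕜 V :=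
  Preprojective.proj 𝕜 V ∘ₗ retract 𝕜 V

theorem trace_mul_comm (x y : PathAlgebra 𝕜 (GinzburgQuiver V)) :
    trace 𝕜 V (x * y) = trace 𝕜 V (y * x) := by
  simp only [trace, LinearMap.comp_apply, retract_mul, Preprojective.proj_mul_comm (retract 𝕜 V x)]

/-- The trace vanishes on boundaries, because the homomorphism `B → Λ` does. -/
theorem trace_d (x : PathAlgebra 𝕜 (GinzburgQuiver V)) :
    trace 𝕜 V ((dgAlgebra 𝕜 V).d x) = 0 := by
  let θ := RingQuot.mkAlgHom 𝕜 (fun x y : PathAlgebra 𝕜 (Quiver.Symmetrify V) =>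
    x = Preprojective.rho 𝕜 V ∧ y = 0)
  refine Preprojective.proj_eq_zero (?_ : θ (retract 𝕜 V ((dgAlgebra 𝕜 V).d x)) = 0)
  refine PathAlgebra.induction 𝕜 (P := fun x => θ (retract 𝕜 V ((dgAlgebra 𝕜 V).d x)) = 0) x
    (by simp only [map_zero]) (fun a b ha hb => by simp only [map_add, ha, hb, add_zero])
    fun c i j p => ?_
  simp only [map_smul]
  suffices h : θ (retract 𝕜 V ((dgAlgebra 𝕜 V).d (ofPath 𝕜 p))) = 0 by rw [h, smul_zero]
  induction p with
  | nil =>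
    have h := d_idem (𝕜 := 𝕜) (V := V) i
    rw [idem] at h
    rw [h, map_zero, map_zero]
  | cons p a ih =>
    have hp : ofPath 𝕜 p ∈ (dgAlgebra 𝕜 V).gr (pathWeight (weight V) p) := ofPath_mem _ p
    have ha : θ (retract 𝕜 V (arrowD 𝕜 V _ _ a)) = 0 := by
      match a with
      | .arrow _ => exact (congrArg θ (map_zero _)).trans (map_zero _)
      | .star _ => exact (congrArg θ (map_zero _)).trans (map_zero _)
      | .loop i =>
        have h : θ (Preprojective.rho 𝕜 V) = 0 := Preprojective.mkAlgHom_rho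
        change θ (retract 𝕜 V (vertex 𝕜 i * rho 𝕜 V * vertex 𝕜 i)) = 0
        rw [retract_mul, retract_mul, retract_rho, map_mul, map_mul, h, mul_zero, zero_mul]
    rw [ofPath_cons, (dgAlgebra 𝕜 V).leibniz _ _ _ _ hp, map_add, map_add, map_smul, map_smul,
      retract_mul, retract_mul, map_mul, map_mul, ih, d_ofArrow, ha, zero_mul, mul_zero, smul_zero,
      add_zero]

theorem sum_trace_vertex_mul_mul_vertex (y : PathAlgebra 𝕜 (GinzburgQuiver V)) :
    ∑ i : V, trace 𝕜 V (vertex 𝕜 i * y * vertex 𝕜 i) = trace 𝕜 V y := by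
  simp only [mul_assoc, trace_mul_comm (vertex 𝕜 _), vertex_mul_vertex]
  rw [← map_sum, ← Finset.mul_sum]
  exact congrArg _ (mul_one y)

/-- If `loopDeriv y` is a coboundary, then the trace of `y` vanishes: the trace of the
one-argument component `G` of a bounding cochain behaves on `ρ` like that of a derivation, hence
annihilates it, and `y` has the same trace as `∑ᵢ (d (G tᵢ) - G (d tᵢ))`. -/
theorem trace_eq_zero {q : ℤ} {y : PathAlgebra 𝕜 (GinzburgQuiver V)}
    (hy : ofLinear (loopDeriv y) ∈ (dgAlgebra 𝕜 V).coboundaries 2 q) : trace 𝕜 V y = 0 := by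
  obtain ⟨g, hg, h⟩ := hy
  change (dgAlgebra 𝕜 V).hochschildDiff 1 g = _ at h
  -- without arguments `g` has cohomological degree one, where the algebra vanishes
  have h0 : ∀ b, g 0 b = 0 := fun b => by
    have h2 : g 0 b ∈ (dgAlgebra 𝕜 V).gr (1, q) := by
      simpa using hg 0 Fin.elim0 b (fun k => k.elim0)
    exact eq_zero_of_mem_weightPart (r := 1) (s := q) one_pos h2
  let G : PathAlgebra 𝕜 (GinzburgQuiver V) →ₗ[𝕜] PathAlgebra 𝕜 (GinzburgQuiver V) :=
    { toFun := fun x => insertLeft x g 0 Fin.elim0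
      map_add' := fun x y => by
        rw [map_add, LinearMap.add_apply]
        rfl
      map_smul' := fun c x => by
        rw [map_smul, LinearMap.smul_apply]
        rfl }
  have h1' : ∀ {i j : GinzburgQuiver V} (a : i ⟶ j), loopValue y i j a =
      (dgAlgebra 𝕜 V).d (G (ofArrow 𝕜 a)) - G (arrowD 𝕜 V i j a) := fun a => by
    have h2 := insertLeft_hochschildDiff_apply_zero 1 h0 (gr_ofArrow (𝕜 := 𝕜) a) Fin.elim0
    rw [h, insertLeft_ofLinear, loopDeriv_ofArrow, zpow_one, neg_one_smul, d_ofArrow,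
      ← sub_eq_add_neg] at h2
    exact h2
  have h1 : ∀ i : V, vertex 𝕜 i * y * vertex 𝕜 i =
      (dgAlgebra 𝕜 V).d (G (ofArrow 𝕜 (V := GinzburgQuiver V) (GinzburgArrow.loop i))) -
        G (vertex 𝕜 i * rho 𝕜 V * vertex 𝕜 i) := fun i => h1' (GinzburgArrow.loop i)
  -- up to boundaries, `G` is a derivation on products of two arrows of the double quiver
  have h2 : ∀ {i j k l : GinzburgQuiver V} (a : i ⟶ j) (b : k ⟶ l), (weight V _ _ a).1 = 0 →
      arrowD 𝕜 V _ _ a = 0 → arrowD 𝕜 V _ _ b = 0 →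
      trace 𝕜 V (G (ofArrow 𝕜 a * ofArrow 𝕜 b)) =
        trace 𝕜 V (ofArrow 𝕜 a * G (ofArrow 𝕜 b)) + trace 𝕜 V (G (ofArrow 𝕜 a) * ofArrow 𝕜 b) :=
    fun a b hw ha hb => by
      have h3 := congrArg (fun f : HochschildFamily 𝕜 _ => f 0 Fin.elim0)
        (insertLeft_hochschildDiff_one g (gr_ofArrow (𝕜 := 𝕜) a) (ofArrow 𝕜 b))
      simp only [h, insertLeft_ofLinear, d_ofArrow, ha, hw, zpow_zero, one_smul, map_zero,
        LinearMap.zero_apply, insertLeft_const, HochschildFamily.add_apply, _root_.add_apply,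
        sub_zero, insertLeft_reducedD_apply_zero, hb, HochschildFamily.zero_apply,
        _root_.zero_apply, zero_sub, HochschildFamily.sub_apply, _root_.sub_apply, lmul_apply] at h3
      have h4 := congrArg (trace 𝕜 V) h3
      simp only [map_zero, map_add, map_sub, map_neg, trace_d, zero_add] at h4
      change 0 = -trace 𝕜 V (G (ofArrow 𝕜 a) * ofArrow 𝕜 b) +
        (trace 𝕜 V (G (ofArrow 𝕜 a * ofArrow 𝕜 b)) - trace 𝕜 V (ofArrow 𝕜 a * G (ofArrow 𝕜 b))) at h4
      rw [eq_comm, neg_add_eq_zero, eq_sub_iff_add_eq] at h4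
      rw [← h4, add_comm]
  have h5 : trace 𝕜 V (G (rho 𝕜 V)) = 0 := by
    simp only [rho, map_sum, map_sub]
    refine Finset.sum_eq_zero fun i _ => Finset.sum_eq_zero fun j _ => Finset.sum_eq_zero
      fun α _ => ?_
    have h6 := h2 (i := i) (j := j) (k := j) (l := i) (GinzburgArrow.arrow α) (GinzburgArrow.star α) rfl rfl rfl
    have h7 := h2 (i := j) (j := i) (k := i) (l := j) (GinzburgArrow.star α) (GinzburgArrow.arrow α) rfl rfl rfl
    change trace 𝕜 V (G (arrow 𝕜 α * star 𝕜 α)) = trace 𝕜 V (arrow 𝕜 α * G (star 𝕜 α)) +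
      trace 𝕜 V (G (arrow 𝕜 α) * star 𝕜 α) at h6
    change trace 𝕜 V (G (star 𝕜 α * arrow 𝕜 α)) = trace 𝕜 V (star 𝕜 α * G (arrow 𝕜 α)) +
      trace 𝕜 V (G (star 𝕜 α) * arrow 𝕜 α) at h7
    rw [h6, h7, trace_mul_comm (arrow 𝕜 α), trace_mul_comm (star 𝕜 α)]
    abel
  rw [← sum_trace_vertex_mul_mul_vertex]
  simp only [h1, map_sub, trace_d, zero_sub]
  rw [Finset.sum_neg_distrib, ← map_sum, ← map_sum, sum_vertex_mul_rho_mul_vertex, h5, neg_zero]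

variable (𝕜 V) in
/-- The cochain given by the derivation `tᵢ ↦ eᵢ x eᵢ`, as a linear function of an element `x` of the
path algebra of the double quiver. -/
noncomputable def loopCochain : PathAlgebra 𝕜 (Quiver.Symmetrify V) →ₗ[𝕜]
    HochschildFamily 𝕜 (PathAlgebra 𝕜 (GinzburgQuiver V)) where
  toFun x := ofLinear (loopDeriv (incl 𝕜 V x))
  map_add' x y := by simp only [map_add, ofLinear_add]
  map_smul' c x := by simp only [map_smul, ofLinear_smul, RingHom.id_apply]

variable (𝕜 V) in
/-- The subspace of the path algebra of the double quiver of the elements whose component of degree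
`q + 2` yields a coboundary. -/
noncomputable def boundingPart (q : ℤ) : Submodule 𝕜 (PathAlgebra 𝕜 (Quiver.Symmetrify V)) :=
  ((dgAlgebra 𝕜 V).coboundaries 2 q).comap (loopCochain 𝕜 V ∘ₗ
    component (fun (i j : Quiver.Symmetrify V) (_ : i ⟶ j) => (1 : ℤ)) (q + 2))

theorem mem_boundingPart {q n : ℤ} {x : PathAlgebra 𝕜 (Quiver.Symmetrify V)}
    (hx : x ∈ weightPart 𝕜 (fun (i j : Quiver.Symmetrify V) (_ : i ⟶ j) => (1 : ℤ)) n)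
    (h : n = q + 2 → loopCochain 𝕜 V x ∈ (dgAlgebra 𝕜 V).coboundaries 2 q) :
    x ∈ boundingPart 𝕜 V q := by
  rw [boundingPart, Submodule.mem_comap, LinearMap.comp_apply, component_of_mem _ hx]
  split_ifs with hn
  · exact h hn
  · rw [map_zero]
    exact zero_mem _

/-- Elements that vanish in `Λ / [Λ, Λ]` yield coboundaries. -/
theorem mem_coboundaries_of_proj_eq_zero {q : ℤ} {x : PathAlgebra 𝕜 (Quiver.Symmetrify V)}
    (hx : x ∈ weightPart 𝕜 (fun (i j : Quiver.Symmetrify V) (_ : i ⟶ j) => (1 : ℤ)) (q + 2))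
    (h : Preprojective.proj 𝕜 V x = 0) :
    loopCochain 𝕜 V x ∈ (dgAlgebra 𝕜 V).coboundaries 2 q := by
  let w := fun (i j : Quiver.Symmetrify V) (_ : i ⟶ j) => (1 : ℤ)
  have hρ : Preprojective.rho 𝕜 V ∈ weightPart 𝕜 w 2 := by
    rw [← retract_rho]
    exact (incl_retract (rho_mem 𝕜 V)).2
  have key : x ∈ boundingPart 𝕜 V q := by
    refine Preprojective.mem_of_proj_eq_zero _ (fun p p' => ?_) (fun p p' => ?_) h
    · have hp := ofPath_mem (𝕜 := 𝕜) w p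
      have hp' := ofPath_mem (𝕜 := 𝕜) w p'
      have h1 := weightPart_mul_mem w _ _ _ _ hp' hp
      rw [add_comm] at h1
      refine mem_boundingPart (sub_mem (weightPart_mul_mem w _ _ _ _ hp hp') h1) fun hn => ?_
      change ofLinear (loopDeriv (incl 𝕜 V _)) ∈ _
      rw [map_sub, incl_mul, incl_mul]
      exact commutator_mem_coboundaries p' (incl_mem hp) hn
    · have hp := ofPath_mem (𝕜 := 𝕜) w p
      have hp' := ofPath_mem (𝕜 := 𝕜) w p'
      have h1 := weightPart_mul_mem w _ _ _ _ hp hρ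
      refine mem_boundingPart (weightPart_mul_mem w _ _ _ _ h1 hp') fun hn => ?_
      have h2 := weightPart_mul_mem w _ _ _ _ hp' hp
      have h3 : incl 𝕜 V (ofPath 𝕜 p' * ofPath 𝕜 p) ∈ weightPart 𝕜 (weight V) (0, q) := by
        have h4 := incl_mem h2
        rwa [show pathWeight w p' + pathWeight w p = q by linarith] at h4
      -- `p ρ p' = [p ρ, p'] + p' p ρ`
      have h5 := add_mem (commutator_mem_coboundaries p' (incl_mem h1) hn)
        (mul_rho_mem_coboundaries h3)
      rw [← ofLinear_add, ← map_add, ← incl_rho, ← incl_mul, ← incl_mul, ← incl_mul, ← map_sub,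
        ← map_add] at h5
      change ofLinear (loopDeriv (incl 𝕜 V _)) ∈ _
      convert h5 using 4
      simp only [mul_assoc]
      abel
  rwa [boundingPart, Submodule.mem_comap, LinearMap.comp_apply, component_of_mem _ hx,
    if_pos rfl] at key

variable (𝕜 V) in
/-- The class of the derivation `tᵢ ↦ eᵢ x eᵢ`, for `x` of degree `q + 2` in the path algebra of the
double quiver. -/
noncomputable def loopClass (q : ℤ) :
    weightPart 𝕜 (fun (i j : Quiver.Symmetrify V) (_ : i ⟶ j) => (1 : ℤ)) (q + 2) →ₗ[𝕜]
      (dgAlgebra 𝕜 V).HH 2 q :=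
  Submodule.mkQ _ ∘ₗ LinearMap.codRestrict _ (loopCochain 𝕜 V ∘ₗ Submodule.subtype _)
    fun x => ofLinear_loopDeriv_mem (incl_mem x.2)

theorem loopClass_surjective (q : ℤ) : Function.Surjective (loopClass 𝕜 V q) := by
  intro z
  obtain ⟨⟨f, hf⟩, rfl⟩ := Submodule.Quotient.mk_surjective _ z
  obtain ⟨g, hg, y, hy, h⟩ := exists_add_hochschildDiff_eq_ofLinear_loopDeriv hf
  obtain ⟨h1, h2⟩ := incl_retract hy
  refine ⟨⟨retract 𝕜 V y, h2⟩, (Submodule.Quotient.eq _).mpr ?_⟩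
  change ofLinear (loopDeriv (incl 𝕜 V (retract 𝕜 V y))) - f ∈ (dgAlgebra 𝕜 V).coboundaries 2 q
  rw [h1, ← h, add_sub_cancel_left]
  exact ⟨g, hg, rfl⟩

theorem ker_loopClass (q : ℤ) : LinearMap.ker (loopClass 𝕜 V q) =
    LinearMap.ker (Preprojective.proj 𝕜 V ∘ₗ Submodule.subtype
      (weightPart 𝕜 (fun (i j : Quiver.Symmetrify V) (_ : i ⟶ j) => (1 : ℤ)) (q + 2))) := by
  ext x
  have h : x ∈ LinearMap.ker (loopClass 𝕜 V q) ↔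
      loopCochain 𝕜 V x ∈ (dgAlgebra 𝕜 V).coboundaries 2 q :=
    Submodule.Quotient.mk_eq_zero _
  rw [h]
  refine ⟨fun hx => ?_, fun hx => mem_coboundaries_of_proj_eq_zero x.2 hx⟩
  have h1 := trace_eq_zero hx
  rwa [trace, LinearMap.comp_apply, retract_incl] at h1

end Ginzburg

/-! ### The isomorphism -/

/-- For a finite connected quiver `Q` (with vertices `V`), the Hochschild cohomology
`HH^{2,q}(Π₂(Q), Π₂(Q))` is isomorphic to the degree `q + 2` part of `Λ_Q / [Λ_Q, Λ_Q]`. -/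
theorem mainTheorem2 (𝕜 : Type*) [Field 𝕜] (V : Type*) [Quiver V] [Fintype V]
    [∀ i j : V, Fintype (i ⟶ j)] [Nonempty V]
    (hconn : Quiver.IsStronglyConnected (Quiver.Symmetrify V)) (q : ℤ) :
    Nonempty ((Ginzburg.dgAlgebra 𝕜 V).HH 2 q ≃ₗ[𝕜] Preprojective.cyclicPart 𝕜 V (q + 2)) := by
  let W := PathAlgebra.weightPart 𝕜
    (fun (i j : Quiver.Symmetrify V) (_ : i ⟶ j) => (1 : ℤ)) (q + 2)
  have h : LinearMap.range (Preprojective.proj 𝕜 V ∘ₗ W.subtype) =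
      Preprojective.cyclicPart 𝕜 V (q + 2) := by
    rw [LinearMap.range_comp, Submodule.range_subtype, Preprojective.cyclicPart]
  exact ⟨((Ginzburg.loopClass 𝕜 V q).quotKerEquivOfSurjective
    (Ginzburg.loopClass_surjective q)).symm ≪≫ₗ
    Submodule.quotEquivOfEq _ _ (Ginzburg.ker_loopClass q) ≪≫ₗ
    (Preprojective.proj 𝕜 V ∘ₗ W.subtype).quotKerEquivRange ≪≫ₗ LinearEquiv.ofEq _ _ h⟩
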